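/- **Setting.** All spaces are real, $\mathbb{R}_>=(0,\infty)$. A family $\{e_i\}_{i\in I}$ in a Hilbert space $E$ is a *Riesz basis* of $E$ if the synthesis operator $c\mapsto\sum_i c_i e_i$ is a boundedly invertible operator $\ell_2(I)\to E$. Its *Riesz constants* are the best constants $0<\lambda\le\Lambda$ with $\lambda\|c\|_{\ell_2}\le\|\sum_i c_ie_i\|_E\le\Lambda\|c\|_{\ell_2}$ for all $c\in\ell_2(I)$. Let $V\subset H$ be separable Hilbert spaces with continuous dense embedding. For a Hilbert space $E$, $H^{1/2}(\mathbb{R}_>;E)$ consists of the $u\in L^2(\mathbb{R}_>;E)$ for which $$\|u\|^2_{H^{1/2}(\mathbb{R}_>;E)}=\int_0^\infty\|u(s)\|_E^2\,ds+\int_0^\infty\!\!\int_0^\infty\frac{\|u(s)-u(t)\|_E^2}{|s-t|^2}\,ds\,dt<\infty ,$$ and $H^{1/2}_{00,\{0\}}(\mathbb{R}_>;E)$ of those for which $$\|u\|^2_{H^{1/2}_{00,\{0\}}(\mathbb{R}_>;E)}=\|u\|^2_{H^{1/2}(\mathbb{R}_>;E)}+\int_0^\infty\frac{\|u(s)\|_E^2}{s}\,ds<\infty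 .$$ If $E=\mathbb{R}$ it is omitted from the notation. $H^1(\mathbb{R}_>)$ is the usual Sobolev space, and $H^1_{0,\{0\}}(\mathbb{R}_>)=\{v\in H^1(\mathbb{R}_>): v(0)=0\}$. Put $$X=H^{1/2}_{00,\{0\}}(\mathbb{R}_>;H)\cap L^2(\mathbb{R}_>;V),\qquad Y=H^{1/2}(\mathbb{R}_>;H)\cap L^2(\mathbb{R}_>;V),$$ each normed by the square root of the sum of the two squared norms. **Assumptions.** Let $\Theta^X=\{\theta^X_\lambda\}_{\lambda\in\nabla^X_t}$ and $\Theta^Y=\{\theta^Y_\lambda\}_{\lambda\in\nabla^Y_t}$ be Riesz bases of $L^2(\mathbb{R}_>)$, and let $\rho^X_\lambda,\rho^Y_\lambda>0$ be scaling factors such that $\{\rho^X_\lambda\theta^X_\lambda\}$ is a Riesz basis of $H^1_{0,\{0\}}(\mathbb{R}_>)$ and $\{\rho^Y_\lambda\theta^Y_\lambda\}$ is a Riesz basis of $H^1(\mathbb{R}_>)$. Let $\Sigma=\{\sigma_\mu\}_{\mu\in\nabla_x}\subset V$ be a Riesz basis of $H$ such that $[\Sigma]_V=\{\sigma_\mu/\|\sigma_\mu\|_V\}$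 is a Riesz basis of $V$. Write $[\Theta^X]_{1/2}=\{(\rho^X_\lambda)^{1/2}\theta^X_\lambda\}$ and $[\Theta^Y]_{1/2}=\{(\rho^Y_\lambda)^{1/2}\theta^Y_\lambda\}$. **Conclusions.** 1. $\Theta^X\otimes\Sigma=\{\theta^X_\lambda\sigma_\mu\}$ and $\Theta^Y\otimes\Sigma=\{\theta^Y_\lambda\sigma_\mu\}$ are Riesz bases of $L^2(\mathbb{R}_>;H)$. 2. $[\Theta^X]_{1/2}$ and $[\Theta^Y]_{1/2}$ are Riesz bases of $H^{1/2}_{00,\{0\}}(\mathbb{R}_>)$ and $H^{1/2}(\mathbb{R}_>)$, respectively; the collection $$\Psi^X=\left\{\frac{\theta^X_\lambda\,\sigma_\mu}{\sqrt{\|\sigma_\mu\|_V^2+\|\theta^X_\lambda\|^2_{H^{1/2}_{00,\{0\}}(\mathbb{R}_>)}}}:(\lambda,\mu)\in\nabla^X_t\times\nabla_x\right\}$$ is a Riesz basis of $X$, and $$\Psi^Y=\left\{\frac{\theta^Y_\lambda\,\sigma_\mu}{\sqrt{\|\sigma_\mu\|_V^2+\|\theta^Y_\lambda\|^2_{H^{1/2}(\mathbb{R}_>)}}}:(\lambda,\mu)\in\nabla^Y_t\times\nabla_x\right\}$$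 is a Riesz basis of $Y$. 3. The Riesz constants of the bases $\Theta^X\otimes\Sigma$ and $\Psi^X$ (resp. $\Theta^Y\otimes\Sigma$ and $\Psi^Y$) can be bounded, from below by a positive constant and from above, in terms of Riesz constants of $\Theta^X$ in $L^2(\mathbb{R}_>)$, $[\Theta^X]_{1/2}$ in $H^{1/2}_{00,\{0\}}(\mathbb{R}_>)$ (resp. $\Theta^Y$ in $L^2(\mathbb{R}_>)$, $[\Theta^Y]_{1/2}$ in $H^{1/2}(\mathbb{R}_>)$), $\Sigma$ in $H$ and $[\Sigma]_V$ in $V$ only. -/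

import Mathlib

open MeasureTheory Set
open scoped ENNReal ContDiff

/-! ### Riesz bases -/

/-- The real sequence space `ℓ₂(I)`. -/
abbrev SeqL2 (I : Type*) : Type _ := lp (fun _ : I => ℝ) 2

/-- `e` is a Riesz basis of `E` with lower and upper Riesz bounds `K.1`, `K.2`: the synthesis
operator `c ↦ ∑ i, c i • e i` is a well-defined, boundedly invertible operator `ℓ₂(I) → E`, and
`K.1 * ‖c‖ ≤ ‖∑ i, c i • e i‖ ≤ K.2 * ‖c‖`. The optimal such bounds are the Riesz constants. -/
def IsRieszBasisWith {E : Type*} [NormedAddCommGroup E] [NormedSpace ℝ E] {I : Type*}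
    (e : I → E) (K : ℝ × ℝ) : Prop :=
  0 < K.1 ∧ 0 < K.2 ∧ ∃ S : SeqL2 I ≃L[ℝ] E, ∀ c : SeqL2 I,
    HasSum (fun i => c i • e i) (S c) ∧ K.1 * ‖c‖ ≤ ‖S c‖ ∧ ‖S c‖ ≤ K.2 * ‖c‖

/-- `e` is a Riesz basis of `E`: the synthesis operator `c ↦ ∑ i, c i • e i` is a well-defined,
boundedly invertible operator `ℓ₂(I) → E`. -/
def IsRieszBasis {E : Type*} [NormedAddCommGroup E] [NormedSpace ℝ E] {I : Type*}
    (e : I → E) : Prop :=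
  ∃ S : SeqL2 I ≃L[ℝ] E, ∀ c : SeqL2 I, HasSum (fun i => c i • e i) (S c)

/-- For a space `E` embedded in `F` by the injection `j`: the family `e` in `F` consists of
elements of `E` and is a Riesz basis of `E` with Riesz bounds `K.1`, `K.2`. -/
def IsRieszBasisInWith {E F : Type*} [NormedAddCommGroup E] [NormedSpace ℝ E]
    [NormedAddCommGroup F] [NormedSpace ℝ F] (j : E →L[ℝ] F) {I : Type*} (e : I → F)
    (K : ℝ × ℝ) : Prop :=
  ∃ e' : I → E, (∀ i, j (e' i) = e i) ∧ IsRieszBasisWith e' K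

/-- For a space `E` embedded in `F` by the injection `j`: the family `e` in `F` consists of
elements of `E` and is a Riesz basis of `E`. -/
def IsRieszBasisIn {E F : Type*} [NormedAddCommGroup E] [NormedSpace ℝ E]
    [NormedAddCommGroup F] [NormedSpace ℝ F] (j : E →L[ℝ] F) {I : Type*} (e : I → F) : Prop :=
  ∃ e' : I → E, (∀ i, j (e' i) = e i) ∧ IsRieszBasis e'

/-- For a space `E` embedded in `F` by the injection `j`: the `E`-norm of an element of `F` that
belongs to `E` (the set below is then a singleton). -/
noncomputable def normIn {E F : Type*} [NormedAddCommGroup E] [NormedSpace ℝ E]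
    [NormedAddCommGroup F] [NormedSpace ℝ F] (j : E →L[ℝ] F) (u : F) : ℝ :=
  sInf {r : ℝ | ∃ p : E, j p = u ∧ ‖p‖ = r}

/-- The family `e` rescaled by the weights `ρ i ^ s`. -/
noncomputable def rescaled {F : Type*} [AddCommGroup F] [Module ℝ F] {I : Type*}
    (ρ : I → ℝ) (s : ℝ) (e : I → F) : I → F :=
  fun i => (ρ i ^ s) • e i

/-! ### Function spaces on the half line

A Sobolev-type space is realized as the Hilbert space of all tuples `(u, w, …)` in a product of
`L²`-spaces in which `w, …` (weak derivative, difference quotient, weighted function) are the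
functions determined by `u` that enter the norm. -/

/-- Lebesgue measure on the half line `ℝ_> = (0, ∞)`. -/
noncomputable abbrev halfLine : Measure ℝ := volume.restrict (Ioi 0)

/-- The Bochner space `L²(ℝ_>; E)`. -/
abbrev L2Half (E : Type*) [NormedAddCommGroup E] : Type _ := Lp E 2 halfLine

/-- Test functions on the open half line. -/
def IsTestFun (φ : ℝ → ℝ) : Prop :=
  ContDiff ℝ ∞ φ ∧ HasCompactSupport φ ∧ tsupport φ ⊆ Ioi 0

theorem L2Half.integrable_mul_of_continuous (u : L2Half ℝ) {φ : ℝ → ℝ} (hφ : Continuous φ)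
    (hc : HasCompactSupport φ) : Integrable (fun t => u t * φ t) halfLine :=
  MemLp.integrable_mul (p := 2) (q := 2) (Lp.memLp u) (hφ.memLp_of_hasCompactSupport hc)

theorem L2Half.integral_mul_add (u v : L2Half ℝ) {φ : ℝ → ℝ} (hφ : Continuous φ)
    (hc : HasCompactSupport φ) :
    ∫ t, (u + v) t * φ t ∂halfLine = ∫ t, u t * φ t ∂halfLine + ∫ t, v t * φ t ∂halfLine := by
  rw [← integral_add (u.integrable_mul_of_continuous hφ hc) (v.integrable_mul_of_continuous hφ hc)]
  refine integral_congr_ae ?_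
  filter_upwards [Lp.coeFn_add u v] with t ht
  rw [ht, Pi.add_apply, add_mul]

theorem L2Half.integral_mul_smul (c : ℝ) (u : L2Half ℝ) (φ : ℝ → ℝ) :
    ∫ t, (c • u) t * φ t ∂halfLine = c * ∫ t, u t * φ t ∂halfLine := by
  rw [← integral_const_mul]
  refine integral_congr_ae ?_
  filter_upwards [Lp.coeFn_smul c u] with t ht
  rw [ht, Pi.smul_apply, smul_eq_mul, mul_assoc]

/-- `H¹(ℝ_>)`: pairs `(u, w)` with `w ∈ L²(ℝ_>)` the distributional derivative of `u ∈ L²(ℝ_>)`,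
with norm `(‖u‖² + ‖w‖²)^(1/2)`. -/
noncomputable def H1Half : Submodule ℝ (WithLp 2 (L2Half ℝ × L2Half ℝ)) where
  carrier := {p | ∀ φ : ℝ → ℝ, IsTestFun φ →
    ∫ t, p.fst t * deriv φ t ∂halfLine = -∫ t, p.snd t * φ t ∂halfLine}
  zero_mem' := by
    intro φ hφ
    have h := fun ψ : ℝ → ℝ => L2Half.integral_mul_smul 0 0 ψ
    simp only [zero_smul, zero_mul] at h
    rw [WithLp.zero_fst, WithLp.zero_snd, h, h, neg_zero]
  add_mem' := by
    intro p q hp hq φ hφ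
    have hd : Continuous (deriv φ) := hφ.1.continuous_deriv (by simp)
    rw [WithLp.add_fst, WithLp.add_snd, L2Half.integral_mul_add _ _ hd hφ.2.1.deriv,
      L2Half.integral_mul_add _ _ hφ.1.continuous hφ.2.1, hp φ hφ, hq φ hφ, neg_add]
  smul_mem' := by
    intro c p hp φ hφ
    rw [WithLp.smul_fst, WithLp.smul_snd, L2Half.integral_mul_smul, L2Half.integral_mul_smul,
      hp φ hφ, mul_neg]

/-- `H¹_{0,{0}}(ℝ_>)`: the subspace of the `u ∈ H¹(ℝ_>)` whose continuous representative on
`[0, ∞)` vanishes at `0`. -/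
noncomputable def H1HalfZero : Submodule ℝ (WithLp 2 (L2Half ℝ × L2Half ℝ)) where
  carrier := {p | p ∈ H1Half ∧ ∃ g : ℝ → ℝ, ContinuousOn g (Ici 0) ∧ g 0 = 0 ∧
    p.fst =ᵐ[halfLine] g}
  zero_mem' := ⟨H1Half.zero_mem, 0, continuousOn_const, rfl, Lp.coeFn_zero _ _ _⟩
  add_mem' := by
    rintro p q ⟨hp, g, hg, hg0, hpg⟩ ⟨hq, h, hh, hh0, hqh⟩
    refine ⟨H1Half.add_mem hp hq, g + h, hg.add hh, by simp [hg0, hh0], ?_⟩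
    rw [WithLp.add_fst]
    exact (Lp.coeFn_add _ _).trans (hpg.add hqh)
  smul_mem' := by
    rintro c p ⟨hp, g, hg, hg0, hpg⟩
    refine ⟨H1Half.smul_mem c hp, c • g, hg.const_smul c, by simp [hg0], ?_⟩
    rw [WithLp.smul_fst]
    exact (Lp.coeFn_smul _ _).trans (hpg.const_smul c)

/-- The embedding `H¹(ℝ_>) → L²(ℝ_>)`. -/
noncomputable def H1Half.toL2 : H1Half →L[ℝ] L2Half ℝ :=
  (WithLp.fstL 2 ℝ (L2Half ℝ) (L2Half ℝ)).comp H1Half.subtypeL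

/-- The embedding `H¹_{0,{0}}(ℝ_>) → L²(ℝ_>)`. -/
noncomputable def H1HalfZero.toL2 : H1HalfZero →L[ℝ] L2Half ℝ :=
  (WithLp.fstL 2 ℝ (L2Half ℝ) (L2Half ℝ)).comp H1HalfZero.subtypeL

section VectorValued

variable (E : Type*) [NormedAddCommGroup E] [NormedSpace ℝ E]

/-- `H^{1/2}(ℝ_>; E)`: pairs `(u, w)` with `u ∈ L²(ℝ_>; E)` and
`w(s, t) = (u(s) - u(t)) / (s - t)` square integrable on `ℝ_> × ℝ_>`, with the intrinsic norm
`‖u‖² = ∫ ‖u(s)‖² ds + ∫∫ ‖u(s) - u(t)‖² / |s - t|² ds dt`. -/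
noncomputable def HHalf :
    Submodule ℝ (WithLp 2 (L2Half E × Lp E 2 (halfLine.prod halfLine))) where
  carrier := {p | p.snd =ᵐ[halfLine.prod halfLine]
    fun x => (x.1 - x.2)⁻¹ • (p.fst x.1 - p.fst x.2)}
  zero_mem' := by
    have h : ((0 : L2Half E) : ℝ → E) =ᵐ[halfLine] 0 := Lp.coeFn_zero _ _ _
    have h1 := Measure.quasiMeasurePreserving_fst (μ := halfLine) (ν := halfLine) |>.ae h
    have h2 := Measure.quasiMeasurePreserving_snd (μ := halfLine) (ν := halfLine) |>.ae h
    filter_upwards [h1, h2, Lp.coeFn_zero E 2 (halfLine.prod halfLine)] with x hx1 hx2 hx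
    simp only [WithLp.zero_fst, WithLp.zero_snd, hx1, hx2, hx, Pi.zero_apply, sub_self, smul_zero]
  add_mem' := by
    intro p q hp hq
    have h := Lp.coeFn_add p.fst q.fst
    have h1 := Measure.quasiMeasurePreserving_fst (μ := halfLine) (ν := halfLine) |>.ae h
    have h2 := Measure.quasiMeasurePreserving_snd (μ := halfLine) (ν := halfLine) |>.ae h
    change _ =ᵐ[_] _
    filter_upwards [h1, h2, Lp.coeFn_add p.snd q.snd, hp, hq] with x hx1 hx2 hx hpx hqx
    simp only [WithLp.add_fst, WithLp.add_snd, hx1, hx2, hx, Pi.add_apply, hpx, hqx]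
    rw [← smul_add]
    congr 1
    abel
  smul_mem' := by
    intro c p hp
    have h := Lp.coeFn_smul c p.fst
    have h1 := Measure.quasiMeasurePreserving_fst (μ := halfLine) (ν := halfLine) |>.ae h
    have h2 := Measure.quasiMeasurePreserving_snd (μ := halfLine) (ν := halfLine) |>.ae h
    change _ =ᵐ[_] _
    filter_upwards [h1, h2, Lp.coeFn_smul c p.snd, hp] with x hx1 hx2 hx hpx
    simp only [WithLp.smul_fst, WithLp.smul_snd, hx1, hx2, hx, Pi.smul_apply, hpx]
    rw [← smul_sub, smul_comm]

noncomputable instance HHalf.instNormedAddCommGroup : NormedAddCommGroup (HHalf E) :=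
  Submodule.normedAddCommGroup _

noncomputable instance HHalf.instNormedSpace : NormedSpace ℝ (HHalf E) :=
  Submodule.normedSpace _

/-- The embedding `H^{1/2}(ℝ_>; E) → L²(ℝ_>; E)`. -/
noncomputable def HHalf.toL2 : HHalf E →L[ℝ] L2Half E :=
  (WithLp.fstL 2 ℝ (L2Half E) (Lp E 2 (halfLine.prod halfLine))).comp (HHalf E).subtypeL

/-- `H^{1/2}_{00,{0}}(ℝ_>; E)`: pairs `(u, z)` with `u ∈ H^{1/2}(ℝ_>; E)` and `z(s) = s^{-1/2} u(s)`
square integrable on `ℝ_>`, with the intrinsic norm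
`‖u‖² = ‖u‖²_{H^{1/2}(ℝ_>; E)} + ∫ ‖u(s)‖² / s ds`. -/
noncomputable def HHalfZero : Submodule ℝ (WithLp 2 (HHalf E × L2Half E)) where
  carrier := {p | p.snd =ᵐ[halfLine] fun s => (s ^ (-1 / 2 : ℝ)) • HHalf.toL2 E p.fst s}
  zero_mem' := by
    filter_upwards [Lp.coeFn_zero E 2 halfLine] with x hx
    simp only [WithLp.zero_fst, WithLp.zero_snd, map_zero, hx, Pi.zero_apply, smul_zero]
  add_mem' := by
    intro p q hp hq
    change _ =ᵐ[_] _
    filter_upwards [Lp.coeFn_add p.snd q.snd,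
      Lp.coeFn_add (HHalf.toL2 E p.fst) (HHalf.toL2 E q.fst), hp, hq] with x hx hx1 hpx hqx
    simp only [WithLp.add_fst, WithLp.add_snd, map_add, hx, hx1, Pi.add_apply, hpx, hqx, smul_add]
  smul_mem' := by
    intro c p hp
    change _ =ᵐ[_] _
    filter_upwards [Lp.coeFn_smul c p.snd, Lp.coeFn_smul c (HHalf.toL2 E p.fst), hp]
      with x hx hx1 hpx
    simp only [WithLp.smul_fst, WithLp.smul_snd, map_smul, hx, hx1, Pi.smul_apply, hpx]
    rw [smul_comm]

noncomputable instance HHalfZero.instNormedAddCommGroup : NormedAddCommGroup (HHalfZero E) :=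
  Submodule.normedAddCommGroup _

noncomputable instance HHalfZero.instNormedSpace : NormedSpace ℝ (HHalfZero E) :=
  Submodule.normedSpace _

/-- The embedding `H^{1/2}_{00,{0}}(ℝ_>; E) → L²(ℝ_>; E)`. -/
noncomputable def HHalfZero.toL2 : HHalfZero E →L[ℝ] L2Half E :=
  ((HHalf.toL2 E).comp (WithLp.fstL 2 ℝ (HHalf E) (L2Half E))).comp (HHalfZero E).subtypeL

end VectorValued

/-! ### Intersections and tensor products -/

/-- The intersection of two spaces `E`, `G` embedded in `F`, with norm
`(‖u‖_E² + ‖u‖_G²)^(1/2)`. -/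
noncomputable def interSpace {E F G : Type*} [NormedAddCommGroup E] [NormedSpace ℝ E]
    [NormedAddCommGroup F] [NormedSpace ℝ F] [NormedAddCommGroup G] [NormedSpace ℝ G]
    (j : E →L[ℝ] F) (k : G →L[ℝ] F) : Submodule ℝ (WithLp 2 (E × G)) where
  carrier := {p | j p.fst = k p.snd}
  zero_mem' := by simp
  add_mem' := by
    intro p q hp hq
    simp only [mem_ofPred_eq] at hp hq
    simp [hp, hq]
  smul_mem' := by
    intro c p hp
    simp only [mem_ofPred_eq] at hp
    simp [hp]

noncomputable instance interSpace.instNormedAddCommGroup {E F G : Type*}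
    [NormedAddCommGroup E] [NormedSpace ℝ E] [NormedAddCommGroup F] [NormedSpace ℝ F]
    [NormedAddCommGroup G] [NormedSpace ℝ G] (j : E →L[ℝ] F) (k : G →L[ℝ] F) :
    NormedAddCommGroup (interSpace j k) :=
  Submodule.normedAddCommGroup _

noncomputable instance interSpace.instNormedSpace {E F G : Type*}
    [NormedAddCommGroup E] [NormedSpace ℝ E] [NormedAddCommGroup F] [NormedSpace ℝ F]
    [NormedAddCommGroup G] [NormedSpace ℝ G] (j : E →L[ℝ] F) (k : G →L[ℝ] F) :
    NormedSpace ℝ (interSpace j k) :=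
  Submodule.normedSpace _

/-- The embedding of the intersection of `E` and `G` in `F`. -/
noncomputable def interSpace.incl {E F G : Type*} [NormedAddCommGroup E] [NormedSpace ℝ E]
    [NormedAddCommGroup F] [NormedSpace ℝ F] [NormedAddCommGroup G] [NormedSpace ℝ G]
    (j : E →L[ℝ] F) (k : G →L[ℝ] F) : interSpace j k →L[ℝ] F :=
  (j.comp (WithLp.fstL 2 ℝ E G)).comp (interSpace j k).subtypeL

section Parabolic

variable {H V : Type*} [NormedAddCommGroup H] [InnerProductSpace ℝ H]
  [NormedAddCommGroup V] [InnerProductSpace ℝ V] (ι : V →L[ℝ] H)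

/-- The embedding `L²(ℝ_>; V) → L²(ℝ_>; H)` induced by an embedding `ι : V → H`. -/
noncomputable def bochnerIncl : L2Half V →L[ℝ] L2Half H := ι.compLpL 2 halfLine

/-- `X = H^{1/2}_{00,{0}}(ℝ_>; H) ∩ L²(ℝ_>; V)`. -/
noncomputable abbrev SpaceX : Submodule ℝ (WithLp 2 (HHalfZero H × L2Half V)) :=
  interSpace (HHalfZero.toL2 H) (bochnerIncl ι)

/-- `Y = H^{1/2}(ℝ_>; H) ∩ L²(ℝ_>; V)`. -/
noncomputable abbrev SpaceY : Submodule ℝ (WithLp 2 (HHalf H × L2Half V)) :=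
  interSpace (HHalf.toL2 H) (bochnerIncl ι)

/-- The embedding `X → L²(ℝ_>; H)`. -/
noncomputable def SpaceX.toL2 : SpaceX ι →L[ℝ] L2Half H :=
  interSpace.incl (HHalfZero.toL2 H) (bochnerIncl ι)

/-- The embedding `Y → L²(ℝ_>; H)`. -/
noncomputable def SpaceY.toL2 : SpaceY ι →L[ℝ] L2Half H :=
  interSpace.incl (HHalf.toL2 H) (bochnerIncl ι)

end Parabolic

/-- The elementary tensor `θ ⊗ h ∈ L²(ℝ_>; H)`, that is, the function `t ↦ θ(t) • h`. -/
noncomputable def elemTensor {H : Type*} [NormedAddCommGroup H] [NormedSpace ℝ H]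
    (θ : L2Half ℝ) (h : H) : L2Half H :=
  (ContinuousLinearMap.toSpanSingleton ℝ h).compLp θ

/-- The tensor product `Θ ⊗ Σ` of a temporal and a spatial family, where `σ μ ∈ V ⊆ H`. -/
noncomputable def tensorFamily {H V : Type*} [NormedAddCommGroup H] [InnerProductSpace ℝ H]
    [NormedAddCommGroup V] [InnerProductSpace ℝ V] (ι : V →L[ℝ] H) {I J : Type*}
    (θ : I → L2Half ℝ) (σ : J → V) : I × J → L2Half H :=
  fun i => elemTensor (θ i.1) (ι (σ i.2))

/-- The tensor product `Θ ⊗ Σ` with the `(l, m)`-th function divided by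
`(‖σ m‖_V² + ‖θ l‖_E²)^(1/2)`, where `E` is the space embedded in `L²(ℝ_>)` by `j`. -/
noncomputable def scaledTensorFamily {E H V : Type*} [NormedAddCommGroup E] [NormedSpace ℝ E]
    [NormedAddCommGroup H] [InnerProductSpace ℝ H]
    [NormedAddCommGroup V] [InnerProductSpace ℝ V] (j : E →L[ℝ] L2Half ℝ) (ι : V →L[ℝ] H)
    {I J : Type*} (θ : I → L2Half ℝ) (σ : J → V) : I × J → L2Half H :=
  fun i => (Real.sqrt (‖σ i.2‖ ^ 2 + normIn j (θ i.1) ^ 2))⁻¹ • tensorFamily ι θ σ i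

/-! ### Square sums and two-sided bounds -/

/-! Each function space E of order one half, and each intersection, lies in an ambient L² space F as
the set of elements of finite energy N, where N : F → [0, ∞] is the squared E-norm (`IsEnergyOf`).
If b is a Riesz basis of F, then b divided by positive weights w is a Riesz basis of E exactly when
N(∑ c_i b_i) is comparable to ∑ w_i² |c_i|² as elements of [0, ∞]. The two directions are
`IsRieszBasisInWith.of_energy` and `IsEnergyOf.sqBounds`. Everything thereby reduces to diagonal
two-sided bounds.

Tensor products: the energies are weighted integrals of ‖u(s)‖² and ‖u(s) - u(t)‖². Expanding these
values in the spatial Riesz basis and exchanging sum and integral reduces an H-valued energy to the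
scalar energies of the coordinates (`energy_sqBounds_coord`, `energy_tensorCoord_sqBounds`). The
L²-V part is the plain tensor product lemma in V. Squared norms add in an intersection, so squared
weights add, and `normIn_bounds` allows the weight ρ^(-1/2) to be replaced by the intrinsic norm of
θ. Only the bounds of the four given bases enter the constants.

Interpolation: the half-order spaces lie midway between L² and H¹, respectively H¹ with zero trace.
`approxIntegral` is a K-functional integral with a free choice of approximants v(t). In coordinates
the best strategy is to keep the i-th coefficient while t ≤ ρ_i and drop it afterwards; the cost is
a multiple of |c_i|²/ρ_i, which is the weight of [Θ]_{1/2}.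

On the function side, the Slobodeckij seminorm is an integral over h of h⁻² ‖u(· + h) - u‖². Forward
shifts (τ = 1) never see the point 0 and give H^{1/2}. Backward shifts of the extension by zero (τ =
-1) produce in addition exactly the Hardy term ∫ |u|²/s, hence H^{1/2}_{00}. Means over windows of
length t, taken forward or backward, serve as approximants; backward means vanish at 0, so they lie
in the H¹ space with zero trace (`exists_approxIntegral_le`). Conversely, the shift modulus of an H¹
function is of order h (`fracEnergy_le_approxIntegral`). -/

theorem enorm_sq_eq_ofReal {E : Type*} [NormedAddCommGroup E] (x : E) :
    ‖x‖ₑ ^ 2 = ENNReal.ofReal (‖x‖ ^ 2) := by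
  rw [ENNReal.ofReal_pow (norm_nonneg _), ofReal_norm]

theorem memlp_two_iff_summable_sq {I : Type*} (c : I → ℝ) :
    Memℓp c 2 ↔ Summable fun i => ‖c i‖ ^ 2 := by
  rw [memℓp_gen_iff (by norm_num)]
  simp

theorem memlp_two_iff {I : Type*} (c : I → ℝ) : Memℓp c 2 ↔ ∑' i, ‖c i‖ₑ ^ 2 < ⊤ := by
  rw [memlp_two_iff_summable_sq]
  simp_rw [enorm_sq_eq_ofReal]
  refine ⟨fun h => h.tsum_ofReal_lt_top, fun h => ?_⟩
  have := ENNReal.summable_toReal h.ne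
  refine this.congr fun i => ?_
  rw [ENNReal.toReal_ofReal (by positivity)]

theorem SeqL2.enorm_sq {I : Type*} (c : SeqL2 I) : ‖c‖ₑ ^ 2 = ∑' i, ‖c i‖ₑ ^ 2 := by
  have h := (memlp_two_iff_summable_sq _).1 (lp.memℓp c)
  simp_rw [enorm_sq_eq_ofReal]
  rw [← ENNReal.ofReal_tsum_of_nonneg (fun i => by positivity) h]
  have := lp.norm_rpow_eq_tsum (p := 2) (by norm_num) c
  congr 1
  simpa using this

/-- `y` is comparable to `x` with the squares of `K.1` and `K.2` as lower and upper constants. -/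
def SqBounds (K : ℝ × ℝ) (x y : ℝ≥0∞) : Prop :=
  ENNReal.ofReal K.1 ^ 2 * x ≤ y ∧ y ≤ ENNReal.ofReal K.2 ^ 2 * x

theorem SqBounds.tsum {I : Type*} {K : ℝ × ℝ} {x y : I → ℝ≥0∞} (h : ∀ i, SqBounds K (x i) (y i)) :
    SqBounds K (∑' i, x i) (∑' i, y i) := by
  constructor
  · rw [← ENNReal.tsum_mul_left]
    exact ENNReal.tsum_le_tsum fun i => (h i).1
  · rw [← ENNReal.tsum_mul_left]
    exact ENNReal.tsum_le_tsum fun i => (h i).2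

theorem SqBounds.trans {K L : ℝ × ℝ} (hK : 0 ≤ K.1) (hK' : 0 ≤ K.2) {x y z : ℝ≥0∞}
    (h : SqBounds K x y) (h' : SqBounds L y z) : SqBounds (K.1 * L.1, K.2 * L.2) x z := by
  constructor
  · refine le_trans ?_ h'.1
    rw [ENNReal.ofReal_mul hK, mul_pow, mul_comm (_ ^ 2), mul_assoc]
    gcongr
    exact h.1
  · refine h'.2.trans ?_
    rw [ENNReal.ofReal_mul hK', mul_pow, mul_comm (_ ^ 2) (ENNReal.ofReal L.2 ^ 2), mul_assoc]
    exact mul_le_mul_right h.2 _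

theorem SqBounds.mul_left {K : ℝ × ℝ} {x y : ℝ≥0∞} (h : SqBounds K x y) (a : ℝ≥0∞) :
    SqBounds K (a * x) (a * y) := by
  constructor
  · rw [mul_left_comm]
    gcongr
    exact h.1
  · rw [mul_left_comm]
    gcongr
    exact h.2

theorem SqBounds.mono {K L : ℝ × ℝ} {x y : ℝ≥0∞} (h : SqBounds K x y) (h1 : L.1 ≤ K.1)
    (h2 : K.2 ≤ L.2) : SqBounds L x y :=
  ⟨le_trans (by gcongr) h.1, h.2.trans (by gcongr)⟩

/-- Comparability in [0, ∞] carries membership along with the norm bounds: a function belongs to the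
smaller space exactly when its weighted coefficients are square summable. -/
theorem SqBounds.lt_top_iff {K : ℝ × ℝ} (hK : 0 < K.1) {x y : ℝ≥0∞} (h : SqBounds K x y) :
    y < ⊤ ↔ x < ⊤ := by
  constructor
  · intro hy
    by_contra hx
    rw [not_lt, top_le_iff] at hx
    have := h.1
    rw [hx, ENNReal.mul_top (by simpa using hK), top_le_iff] at this
    exact hy.ne this
  · intro hx
    refine h.2.trans_lt ?_
    exact ENNReal.mul_lt_top (ENNReal.pow_lt_top ENNReal.ofReal_lt_top) hx

theorem mul_norm_le_iff_enorm_sq {E F : Type*} [NormedAddCommGroup E] [NormedAddCommGroup F]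
    {K : ℝ} (hK : 0 ≤ K) (a : E) (b : F) :
    K * ‖a‖ ≤ ‖b‖ ↔ ENNReal.ofReal K ^ 2 * ‖a‖ₑ ^ 2 ≤ ‖b‖ₑ ^ 2 := by
  rw [enorm_sq_eq_ofReal, enorm_sq_eq_ofReal, ← ENNReal.ofReal_pow hK,
    ← ENNReal.ofReal_mul (by positivity), ENNReal.ofReal_le_ofReal_iff (by positivity), ← mul_pow,
    pow_le_pow_iff_left₀ (by positivity) (by positivity) (by norm_num)]

theorem norm_le_mul_iff_enorm_sq {E F : Type*} [NormedAddCommGroup E] [NormedAddCommGroup F]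
    {K : ℝ} (hK : 0 ≤ K) (a : E) (b : F) :
    ‖b‖ ≤ K * ‖a‖ ↔ ‖b‖ₑ ^ 2 ≤ ENNReal.ofReal K ^ 2 * ‖a‖ₑ ^ 2 := by
  rw [enorm_sq_eq_ofReal, enorm_sq_eq_ofReal, ← ENNReal.ofReal_pow hK,
    ← ENNReal.ofReal_mul (by positivity), ENNReal.ofReal_le_ofReal_iff (by positivity), ← mul_pow,
    pow_le_pow_iff_left₀ (by positivity) (by positivity) (by norm_num)]

theorem sqBounds_enorm_iff {E F : Type*} [NormedAddCommGroup E] [NormedAddCommGroup F]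
    {K : ℝ × ℝ} (hK : 0 ≤ K.1) (hK' : 0 ≤ K.2) (a : E) (b : F) :
    SqBounds K (‖a‖ₑ ^ 2) (‖b‖ₑ ^ 2) ↔ K.1 * ‖a‖ ≤ ‖b‖ ∧ ‖b‖ ≤ K.2 * ‖a‖ := by
  rw [mul_norm_le_iff_enorm_sq hK, norm_le_mul_iff_enorm_sq hK', SqBounds]

/-! ### Riesz bases -/

section Riesz

variable {E : Type*} [NormedAddCommGroup E] [NormedSpace ℝ E] {I : Type*} {e : I → E}

theorem IsRieszBasisWith.isRieszBasis {K : ℝ × ℝ} (h : IsRieszBasisWith e K) : IsRieszBasis e :=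
  let ⟨_, _, S, hS⟩ := h
  ⟨S, fun c => (hS c).1⟩

theorem IsRieszBasis.exists_bounds (h : IsRieszBasis e) : ∃ K, IsRieszBasisWith e K := by
  obtain ⟨S, hS⟩ := h
  refine ⟨((‖(S.symm : E →L[ℝ] SeqL2 I)‖ + 1)⁻¹, ‖(S : SeqL2 I →L[ℝ] E)‖ + 1), by positivity,
    by positivity, S, fun c => ⟨hS c, ?_, ?_⟩⟩
  · have := (S.symm : E →L[ℝ] SeqL2 I).le_opNorm (S c)
    rw [inv_mul_le_iff₀ (by positivity)]
    simp only [ContinuousLinearEquiv.coe_coe, ContinuousLinearEquiv.symm_apply_apply] at this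
    nlinarith [norm_nonneg (S c)]
  · have := (S : SeqL2 I →L[ℝ] E).le_opNorm c
    simp only [ContinuousLinearEquiv.coe_coe] at this
    show ‖S c‖ ≤ _
    nlinarith [norm_nonneg c]

theorem IsRieszBasisInWith.isRieszBasisIn {F : Type*} [NormedAddCommGroup F] [NormedSpace ℝ F]
    {j : E →L[ℝ] F} {e : I → F} {K : ℝ × ℝ} (h : IsRieszBasisInWith j e K) :
    IsRieszBasisIn j e :=
  let ⟨e', h, h'⟩ := h
  ⟨e', h, h'.isRieszBasis⟩

theorem IsRieszBasisIn.exists_bounds {F : Type*} [NormedAddCommGroup F] [NormedSpace ℝ F]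
    {j : E →L[ℝ] F} {e : I → F} (h : IsRieszBasisIn j e) : ∃ K, IsRieszBasisInWith j e K :=
  let ⟨e', h, h'⟩ := h
  let ⟨K, hK⟩ := h'.exists_bounds
  ⟨K, e', h, hK⟩

theorem IsRieszBasisWith.pos {K : ℝ × ℝ} (h : IsRieszBasisWith e K) : 0 < K.1 ∧ 0 < K.2 :=
  ⟨h.1, h.2.1⟩

theorem IsRieszBasisInWith.pos {F : Type*} [NormedAddCommGroup F] [NormedSpace ℝ F]
    {j : E →L[ℝ] F} {e : I → F} {K : ℝ × ℝ} (h : IsRieszBasisInWith j e K) : 0 < K.1 ∧ 0 < K.2 :=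
  let ⟨_, _, h'⟩ := h
  h'.pos

theorem IsRieszBasisWith.exists_synthesis {K : ℝ × ℝ} (h : IsRieszBasisWith e K) :
    ∃ S : SeqL2 I ≃L[ℝ] E, (∀ c : SeqL2 I, HasSum (fun i => c i • e i) (S c)) ∧
      ∀ c : SeqL2 I, SqBounds K (∑' i, ‖c i‖ₑ ^ 2) (‖S c‖ₑ ^ 2) := by
  obtain ⟨h1, h2, S, hS⟩ := h
  refine ⟨S, fun c => (hS c).1, fun c => ?_⟩
  rw [← SeqL2.enorm_sq, sqBounds_enorm_iff h1.le h2.le]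
  exact (hS c).2

theorem IsRieszBasisWith.of_synthesis {K : ℝ × ℝ} (h1 : 0 < K.1) (h2 : 0 < K.2)
    (S : SeqL2 I ≃L[ℝ] E) (hS : ∀ c : SeqL2 I, HasSum (fun i => c i • e i) (S c))
    (hK : ∀ c : SeqL2 I, SqBounds K (∑' i, ‖c i‖ₑ ^ 2) (‖S c‖ₑ ^ 2)) : IsRieszBasisWith e K := by
  refine ⟨h1, h2, S, fun c => ⟨hS c, ?_⟩⟩
  rw [← sqBounds_enorm_iff h1.le h2.le, SeqL2.enorm_sq]
  exact hK c

theorem IsRieszBasisWith.mono {K L : ℝ × ℝ} (h : IsRieszBasisWith e K) (hL : 0 < L.1)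
    (h1 : L.1 ≤ K.1) (h2 : K.2 ≤ L.2) : IsRieszBasisWith e L := by
  obtain ⟨S, hS, hK⟩ := h.exists_synthesis
  exact .of_synthesis hL (h.pos.2.trans_le h2) S hS fun c => (hK c).mono h1 h2

theorem SeqL2.hasSum_single (c : SeqL2 I) [DecidableEq I] :
    HasSum (fun i => c i • (lp.single 2 i (1 : ℝ) : SeqL2 I)) c := by
  have := lp.hasSum_single (p := 2) (by norm_num) c
  refine this.congr_fun fun i => ?_
  rw [← lp.single_smul, smul_eq_mul, mul_one]

theorem synthesis_single [DecidableEq I] {S : SeqL2 I ≃L[ℝ] E}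
    (hS : ∀ c : SeqL2 I, HasSum (fun i => c i • e i) (S c)) (i : I) :
    S (lp.single 2 i (1 : ℝ)) = e i := by
  refine (hS _).unique ?_
  have h := hasSum_ite_eq (L := .unconditional I) i (e i)
  refine h.congr_fun fun k => ?_
  by_cases hk : k = i
  · subst hk; simp
  · simp [hk]

theorem hasSum_synthesis_of_single [DecidableEq I] {S : SeqL2 I →L[ℝ] E}
    (hS : ∀ i, S (lp.single 2 i (1 : ℝ)) = e i) (c : SeqL2 I) :
    HasSum (fun i => c i • e i) (S c) := by
  refine ((SeqL2.hasSum_single c).mapL S).congr_fun fun i => ?_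
  simp [hS]

theorem IsRieszBasis.ne_zero (h : IsRieszBasis e) (i : I) : e i ≠ 0 := by
  classical
  obtain ⟨S, hS⟩ := h
  rw [← synthesis_single hS i, Ne, EmbeddingLike.map_eq_zero_iff]
  intro h
  have := congrArg (fun c : SeqL2 I => c i) h
  simp at this

/-- A family that is a Riesz basis of `F` is, after division by the weights `w`, a Riesz basis of
the subspace `W` of the elements of finite energy, provided that the energy is comparable to the
`w`-weighted square sum of the coefficients. -/
theorem IsRieszBasisInWith.of_energy {F W : Type*} [NormedAddCommGroup F] [NormedSpace ℝ F]
    [NormedAddCommGroup W] [NormedSpace ℝ W] {j : W →L[ℝ] F} (hj : Function.Injective j)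
    {N : F → ℝ≥0∞} (hN : ∀ p, ‖p‖ₑ ^ 2 = N (j p)) (hfin : ∀ u, N u < ⊤ → ∃ p, j p = u)
    {b : I → F} {S : SeqL2 I ≃L[ℝ] F} (hS : ∀ c : SeqL2 I, HasSum (fun i => c i • b i) (S c))
    {w : I → ℝ} (hw : ∀ i, 0 < w i) {K : ℝ × ℝ} (h1 : 0 < K.1) (h2 : 0 < K.2)
    (hK : ∀ c : SeqL2 I, SqBounds K (∑' i, ‖w i * c i‖ₑ ^ 2) (N (S c))) :
    IsRieszBasisInWith j (fun i => (w i)⁻¹ • b i) K := by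
  classical
  -- The weights stay away from zero, so division by them preserves ℓ₂. Indeed 1 ≤ ‖S⁻¹‖ ‖b i‖_F ≤
  -- ‖S⁻¹‖ ‖j‖ ‖b i‖_W, and testing `hK` on a unit vector gives ‖b i‖_W ≤ K.2 * w i.
  have hM : ∃ M : ℝ, 0 ≤ M ∧ ∀ i, (w i)⁻¹ ≤ M := by
    refine ⟨‖(S.symm : F →L[ℝ] SeqL2 I)‖ * (‖j‖ * K.2), by positivity, fun i => ?_⟩
    have hb := hK (lp.single 2 i (1 : ℝ))
    have hs : ∑' k, ‖w k * (lp.single 2 i (1 : ℝ) : SeqL2 I) k‖ₑ ^ 2 = ‖w i‖ₑ ^ 2 := by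
      rw [tsum_eq_single i]
      · simp
      · intro k hk
        simp [hk]
    rw [hs] at hb
    obtain ⟨p, hp⟩ := hfin _ ((hb.lt_top_iff h1).2 (by simp))
    rw [← hp, ← hN, sqBounds_enorm_iff h1.le h2.le] at hb
    have e1 : ‖(lp.single 2 i (1 : ℝ) : SeqL2 I)‖ = 1 := by
      rw [lp.norm_single (by norm_num)]; simp
    have e2 : ‖(lp.single 2 i (1 : ℝ) : SeqL2 I)‖ ≤ ‖(S.symm : F →L[ℝ] SeqL2 I)‖ * ‖j p‖ := by
      have := (S.symm : F →L[ℝ] SeqL2 I).le_opNorm (j p)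
      rw [hp] at this ⊢
      simpa using this
    have e3 : ‖j p‖ ≤ ‖j‖ * (K.2 * w i) := by
      refine (j.le_opNorm p).trans ?_
      have := hb.2
      rw [Real.norm_of_nonneg (hw i).le] at this
      gcongr
    rw [e1] at e2
    rw [inv_le_iff_one_le_mul₀ (hw i)]
    calc (1 : ℝ) ≤ _ := e2
      _ ≤ ‖(S.symm : F →L[ℝ] SeqL2 I)‖ * (‖j‖ * (K.2 * w i)) := by gcongr
      _ = _ := by ring
  obtain ⟨M, hM0, hM⟩ := hM
  have hmem : ∀ d : SeqL2 I, Memℓp (fun i => (w i)⁻¹ * d i) 2 := by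
    intro d
    rw [memlp_two_iff_summable_sq]
    refine Summable.of_nonneg_of_le (fun i => by positivity) (fun i => ?_)
      (((memlp_two_iff_summable_sq _).1 (lp.memℓp d)).mul_left (M ^ 2))
    rw [norm_mul, mul_pow, norm_inv, Real.norm_of_nonneg (hw i).le]
    gcongr
    · exact inv_nonneg.2 (hw i).le
    · exact hM i
  let D : SeqL2 I → SeqL2 I := fun d => ⟨fun i => (w i)⁻¹ * d i, hmem d⟩
  have hD : ∀ d : SeqL2 I, ∀ i, w i * D d i = d i := fun d i => mul_inv_cancel_left₀ (hw i).ne' _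
  have hDN : ∀ d : SeqL2 I, SqBounds K (∑' i, ‖d i‖ₑ ^ 2) (N (S (D d))) := fun d => by
    simpa only [hD] using hK (D d)
  have hex : ∀ d : SeqL2 I, ∃ p, j p = S (D d) := fun d =>
    hfin _ (((hDN d).lt_top_iff h1).2 ((memlp_two_iff _).1 (lp.memℓp d)))
  choose T hT using hex
  let TL : SeqL2 I →ₗ[ℝ] W :=
    { toFun := T
      map_add' := fun c d => hj <| by
        rw [map_add, hT, hT, hT, ← map_add]
        congr 1
        ext i
        exact mul_add _ _ _
      map_smul' := fun a c => hj <| by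
        rw [map_smul, hT, hT, ← map_smul]
        congr 1
        ext i
        exact mul_left_comm _ _ _ }
  have hTK : ∀ d, SqBounds K (‖d‖ₑ ^ 2) (‖T d‖ₑ ^ 2) := fun d => by
    rw [SeqL2.enorm_sq, hN, hT]
    exact hDN d
  have hTb := fun d => (sqBounds_enorm_iff h1.le h2.le _ _).1 (hTK d)
  have hbij : Function.Bijective TL := by
    constructor
    · rw [injective_iff_map_eq_zero]
      intro d hd
      have := (hTb d).1
      change T d = 0 at hd
      rw [hd, norm_zero] at this
      have h0 := norm_nonneg d
      exact norm_eq_zero.1 (le_antisymm (by nlinarith) h0)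
    -- Finite energy of `j p` makes the sequence w_i c_i square summable, where c are the
    -- coefficients of `j p` in b; this sequence is the preimage of p.
    · intro p
      have hc := hK (S.symm (j p))
      rw [S.apply_symm_apply, ← hN] at hc
      have hfin' := (hc.lt_top_iff h1).1 (by simp)
      refine ⟨⟨fun i => w i * S.symm (j p) i, (memlp_two_iff _).2 hfin'⟩, hj ?_⟩
      change j (T _) = _
      rw [hT]
      refine Eq.trans (congrArg S ?_) (S.apply_symm_apply (j p))
      ext i
      exact inv_mul_cancel_left₀ (hw i).ne' _
  let TE := (LinearEquiv.ofBijective TL hbij).toContinuousLinearEquivOfBounds K.2 K.1⁻¹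
    (fun d => (hTb d).2) (fun p => by
      obtain ⟨d, rfl⟩ := (LinearEquiv.ofBijective TL hbij).surjective p
      rw [LinearEquiv.symm_apply_apply, inv_mul_eq_div, le_div_iff₀ h1, mul_comm]
      exact (hTb d).1)
  refine ⟨fun i => T (lp.single 2 i 1), fun i => ?_, .of_synthesis h1 h2 TE ?_ fun d => ?_⟩
  · show _ = (w i)⁻¹ • b i
    rw [hT, ← synthesis_single hS i, ← map_smul]
    congr 1
    ext k
    by_cases hk : k = i
    · subst hk; simp [D]
    · simp [D, hk]
  · exact fun c => hasSum_synthesis_of_single (S := (TE : SeqL2 I →L[ℝ] W)) (fun i => rfl) c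
  · rw [← SeqL2.enorm_sq]
    exact hTK d

end Riesz

/-! ### Quadratic energies of functions on the half line -/

theorem SqBounds.add {K : ℝ × ℝ} {x y x' y' : ℝ≥0∞} (h : SqBounds K x y) (h' : SqBounds K x' y') :
    SqBounds K (x + x') (y + y') :=
  ⟨by rw [mul_add]; exact add_le_add h.1 h'.1, by rw [mul_add]; exact add_le_add h.2 h'.2⟩

theorem SqBounds.lintegral {α : Type*} [MeasurableSpace α] {μ : Measure α} {K : ℝ × ℝ}
    {f g : α → ℝ≥0∞} (h : ∀ x, SqBounds K (f x) (g x)) :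
    SqBounds K (∫⁻ x, f x ∂μ) (∫⁻ x, g x ∂μ) := by
  constructor
  · rw [← lintegral_const_mul' _ _ (by finiteness)]
    exact lintegral_mono fun x => (h x).1
  · rw [← lintegral_const_mul' _ _ (by finiteness)]
    exact lintegral_mono fun x => (h x).2

theorem Lp.enorm_sq {α E : Type*} [MeasurableSpace α] {μ : Measure α} [NormedAddCommGroup E]
    (f : Lp E 2 μ) : ‖f‖ₑ ^ 2 = ∫⁻ x, ‖f x‖ₑ ^ 2 ∂μ := by
  rw [Lp.enorm_def]
  have := eLpNorm_nnreal_pow_eq_lintegral (f := f) (μ := μ) (p := 2) (by norm_num)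
  simpa using this

theorem memLp_two_iff_lintegral {α E : Type*} [MeasurableSpace α] {μ : Measure α}
    [NormedAddCommGroup E] {f : α → E} (hf : AEStronglyMeasurable f μ) :
    MemLp f 2 μ ↔ ∫⁻ x, ‖f x‖ₑ ^ 2 ∂μ < ⊤ := by
  have := eLpNorm_nnreal_pow_eq_lintegral (f := f) (μ := μ) (p := 2) (by norm_num)
  have h2 : eLpNorm f 2 μ ^ 2 = ∫⁻ x, ‖f x‖ₑ ^ 2 ∂μ := by simpa using this
  rw [← h2, ENNReal.pow_lt_top_iff, MemLp]
  simp [hf]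

theorem WithLp.enorm_sq {E F : Type*} [NormedAddCommGroup E] [NormedAddCommGroup F]
    (p : WithLp 2 (E × F)) : ‖p‖ₑ ^ 2 = ‖p.fst‖ₑ ^ 2 + ‖p.snd‖ₑ ^ 2 := by
  simp_rw [enorm_sq_eq_ofReal]
  rw [WithLp.prod_norm_sq_eq_of_L2, ENNReal.ofReal_add (by positivity) (by positivity)]

theorem ae_halfLine_prod {E : Type*} {u v : ℝ → E} (h : u =ᵐ[halfLine] v) :
    ∀ᵐ z ∂halfLine.prod halfLine, u z.1 = v z.1 ∧ u z.2 = v z.2 :=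
  (Measure.quasiMeasurePreserving_fst (μ := halfLine) (ν := halfLine) |>.ae h).and
    (Measure.quasiMeasurePreserving_snd (μ := halfLine) (ν := halfLine) |>.ae h)

section Energy

variable {E : Type*} [NormedAddCommGroup E]

/-- The energy `∫ k(s) ‖u(s)‖² ds + ∫∫ κ(s,t) ‖u(s) - u(t)‖² ds dt` on the half line. -/
noncomputable def energy (k : ℝ → ℝ≥0∞) (κ : ℝ × ℝ → ℝ≥0∞) (u : ℝ → E) : ℝ≥0∞ :=
  ∫⁻ s, k s * ‖u s‖ₑ ^ 2 ∂halfLine +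
    ∫⁻ z, κ z * ‖u z.1 - u z.2‖ₑ ^ 2 ∂(halfLine.prod halfLine)

theorem energy_congr {k : ℝ → ℝ≥0∞} {κ : ℝ × ℝ → ℝ≥0∞} {u v : ℝ → E} (h : u =ᵐ[halfLine] v) :
    energy k κ u = energy k κ v := by
  unfold energy
  congr 1
  · refine lintegral_congr_ae ?_
    filter_upwards [h] with s hs
    rw [hs]
  · refine lintegral_congr_ae ?_
    filter_upwards [ae_halfLine_prod h] with z hz
    rw [hz.1, hz.2]

/-- The coordinate inequality is applied pointwise to u(s) and, by linearity, to u(s) - u(t).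
Countability of J permits the exchange of sum and integral. -/
theorem energy_sqBounds_coord [NormedSpace ℝ E] {J : Type*} [Countable J] {f : J → E →L[ℝ] ℝ}
    {K : ℝ × ℝ} (hf : ∀ x, SqBounds K (∑' j, ‖f j x‖ₑ ^ 2) (‖x‖ₑ ^ 2)) {k : ℝ → ℝ≥0∞}
    (hk : Measurable k) {κ : ℝ × ℝ → ℝ≥0∞} (hκ : Measurable κ) {u : ℝ → E}
    (hu : StronglyMeasurable u) :
    SqBounds K (∑' j, energy k κ (fun s => f j (u s))) (energy k κ u) := by
  have hm : ∀ j, Measurable fun s => f j (u s) := fun j =>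
    ((f j).continuous.comp_stronglyMeasurable hu).measurable
  unfold energy
  rw [ENNReal.tsum_add]
  refine SqBounds.add ?_ ?_
  · have h : ∀ j, AEMeasurable (fun s => k s * ‖f j (u s)‖ₑ ^ 2) halfLine := fun j =>
      (hk.mul ((hm j).enorm.pow_const 2)).aemeasurable
    rw [← lintegral_tsum h]
    refine SqBounds.lintegral fun s => ?_
    rw [ENNReal.tsum_mul_left]
    exact (hf _).mul_left _
  · have h : ∀ j, AEMeasurable (fun z : ℝ × ℝ => κ z * ‖f j (u z.1) - f j (u z.2)‖ₑ ^ 2)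
        (halfLine.prod halfLine) := fun j => (hκ.mul ((((hm j).comp measurable_fst).sub
      ((hm j).comp measurable_snd)).enorm.pow_const 2)).aemeasurable
    rw [← lintegral_tsum h]
    refine SqBounds.lintegral fun z => ?_
    rw [ENNReal.tsum_mul_left]
    simp_rw [← map_sub]
    exact (hf _).mul_left _

/-- The kernel `|s - t|⁻²`. -/
noncomputable def slopeKernel (z : ℝ × ℝ) : ℝ≥0∞ := ‖(z.1 - z.2)⁻¹‖ₑ ^ 2

theorem measurable_slopeKernel : Measurable slopeKernel := by
  unfold slopeKernel
  fun_prop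

/-- The weight `1 + s⁻¹`. -/
noncomputable def hardyWeight (s : ℝ) : ℝ≥0∞ := 1 + ‖s ^ (-1 / 2 : ℝ)‖ₑ ^ 2

theorem measurable_hardyWeight : Measurable hardyWeight := by
  unfold hardyWeight
  fun_prop

theorem L2Half.enorm_sq_eq_energy (u : L2Half E) : ‖u‖ₑ ^ 2 = energy 1 0 u := by
  simp [energy, Lp.enorm_sq]

theorem energy_hardyWeight {u : ℝ → E} (hu : StronglyMeasurable u) (κ : ℝ × ℝ → ℝ≥0∞) :
    energy hardyWeight κ u =
      energy 1 κ u + ∫⁻ s, ‖s ^ (-1 / 2 : ℝ)‖ₑ ^ 2 * ‖u s‖ₑ ^ 2 ∂halfLine := by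
  unfold energy hardyWeight
  simp only [add_mul, one_mul, Pi.one_apply]
  rw [lintegral_add_left (hu.enorm.pow_const 2)]
  ring

variable [NormedSpace ℝ E]

theorem HHalf.enorm_sq (p : HHalf E) :
    ‖p‖ₑ ^ 2 = energy 1 slopeKernel (HHalf.toL2 E p) := by
  have h : ‖p‖ₑ = ‖(p : WithLp 2 (L2Half E × Lp E 2 (halfLine.prod halfLine)))‖ₑ := rfl
  rw [h, WithLp.enorm_sq, Lp.enorm_sq, Lp.enorm_sq, energy]
  congr 1
  · simp [HHalf.toL2]
  · refine lintegral_congr_ae ?_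
    filter_upwards [p.2] with z hz
    rw [hz, enorm_smul, mul_pow]
    rfl

theorem HHalf.exists_of_energy {u : L2Half E} (h : energy 1 slopeKernel u < ⊤) :
    ∃ p, HHalf.toL2 E p = u := by
  have hu := Lp.stronglyMeasurable u
  have hm : StronglyMeasurable fun z : ℝ × ℝ => (z.1 - z.2)⁻¹ • (u z.1 - u z.2) :=
    StronglyMeasurable.smul (by fun_prop : Measurable fun z : ℝ × ℝ => (z.1 - z.2)⁻¹).stronglyMeasurable
      ((hu.comp_measurable measurable_fst).sub (hu.comp_measurable measurable_snd))
  have hL : MemLp (fun z : ℝ × ℝ => (z.1 - z.2)⁻¹ • (u z.1 - u z.2)) 2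
      (halfLine.prod halfLine) := by
    rw [memLp_two_iff_lintegral hm.aestronglyMeasurable]
    simp_rw [enorm_smul, mul_pow]
    exact lt_of_le_of_lt le_add_self h
  exact ⟨⟨WithLp.toLp 2 (u, hL.toLp _), hL.coeFn_toLp⟩, rfl⟩

theorem HHalf.toL2_injective : Function.Injective (HHalf.toL2 E) := by
  rw [injective_iff_map_eq_zero]
  intro p hp
  have := HHalf.enorm_sq p
  rw [hp, energy_congr (Lp.coeFn_zero _ _ _)] at this
  simpa [energy] using this

theorem HHalfZero.toL2_apply (p : HHalfZero E) :
    HHalfZero.toL2 E p = HHalf.toL2 E (p : WithLp 2 (HHalf E × L2Half E)).fst := rfl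

theorem HHalfZero.enorm_sq (p : HHalfZero E) :
    ‖p‖ₑ ^ 2 = energy hardyWeight slopeKernel (HHalfZero.toL2 E p) := by
  have h : ‖p‖ₑ = ‖(p : WithLp 2 (HHalf E × L2Half E))‖ₑ := rfl
  rw [h, WithLp.enorm_sq, Lp.enorm_sq, HHalf.enorm_sq, energy_hardyWeight (Lp.stronglyMeasurable _),
    HHalfZero.toL2_apply]
  congr 1
  refine lintegral_congr_ae ?_
  filter_upwards [p.2] with z hz
  rw [hz, enorm_smul, mul_pow]

theorem HHalfZero.exists_of_energy {u : L2Half E} (h : energy hardyWeight slopeKernel u < ⊤) :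
    ∃ p, HHalfZero.toL2 E p = u := by
  have hu := Lp.stronglyMeasurable u
  rw [energy_hardyWeight hu, ENNReal.add_lt_top] at h
  obtain ⟨p, rfl⟩ := HHalf.exists_of_energy h.1
  have hm : StronglyMeasurable fun s : ℝ => (s ^ (-1 / 2 : ℝ)) • HHalf.toL2 E p s :=
    StronglyMeasurable.smul (by fun_prop : Measurable fun s : ℝ => s ^ (-1 / 2 : ℝ)).stronglyMeasurable
      hu
  have hL : MemLp (fun s : ℝ => (s ^ (-1 / 2 : ℝ)) • HHalf.toL2 E p s) 2 halfLine := by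
    rw [memLp_two_iff_lintegral hm.aestronglyMeasurable]
    simp_rw [enorm_smul, mul_pow]
    exact h.2
  exact ⟨⟨WithLp.toLp 2 (p, hL.toLp _), hL.coeFn_toLp⟩, rfl⟩

theorem HHalfZero.toL2_injective : Function.Injective (HHalfZero.toL2 E) := by
  rw [injective_iff_map_eq_zero]
  intro p hp
  have := HHalfZero.enorm_sq p
  rw [hp, energy_congr (Lp.coeFn_zero _ _ _)] at this
  simpa [energy] using this

end Energy

/-! ### Coordinate functionals -/

section Coord

variable {E : Type*} [NormedAddCommGroup E] [NormedSpace ℝ E] {I : Type*} {e : I → E}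

/-- The `i`-th coordinate functional attached to a synthesis operator. -/
noncomputable def rieszCoord (S : SeqL2 I ≃L[ℝ] E) (i : I) : E →L[ℝ] ℝ :=
  (lp.evalCLM ℝ (fun _ : I => ℝ) 2 i).comp (S.symm : E →L[ℝ] SeqL2 I)

theorem rieszCoord_apply (S : SeqL2 I ≃L[ℝ] E) (i : I) (x : E) :
    rieszCoord S i x = S.symm x i := rfl

theorem rieszCoord_synthesis (S : SeqL2 I ≃L[ℝ] E) (i : I) (c : SeqL2 I) :
    rieszCoord S i (S c) = c i := by
  rw [rieszCoord_apply, S.symm_apply_apply]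

theorem rieszCoord_basis [DecidableEq I] {S : SeqL2 I ≃L[ℝ] E}
    (hS : ∀ c : SeqL2 I, HasSum (fun i => c i • e i) (S c)) (i k : I) :
    rieszCoord S i (e k) = if i = k then 1 else 0 := by
  rw [← synthesis_single hS k, rieszCoord_synthesis]
  by_cases h : i = k
  · subst h; simp
  · simp [h]

theorem rieszCoord_sqBounds {S : SeqL2 I ≃L[ℝ] E} {K : ℝ × ℝ}
    (hK : ∀ c : SeqL2 I, SqBounds K (∑' i, ‖c i‖ₑ ^ 2) (‖S c‖ₑ ^ 2)) (x : E) :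
    SqBounds K (∑' i, ‖rieszCoord S i x‖ₑ ^ 2) (‖x‖ₑ ^ 2) := by
  have := hK (S.symm x)
  rwa [S.apply_symm_apply] at this

/-- Square summability of c is not presupposed: continuity of the coordinate functional suffices.
This identifies the coefficients of series that converge in a smaller space and are then mapped into
E. -/
theorem rieszCoord_of_hasSum {S : SeqL2 I ≃L[ℝ] E}
    (hS : ∀ c : SeqL2 I, HasSum (fun i => c i • e i) (S c)) {c : I → ℝ} {x : E}
    (hx : HasSum (fun i => c i • e i) x) (i : I) : rieszCoord S i x = c i := by
  classical
  have h := hx.mapL (rieszCoord S i)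
  refine h.unique ?_
  refine (hasSum_ite_eq (L := .unconditional I) i (c i)).congr_fun fun k => ?_
  rw [map_smul, rieszCoord_basis hS]
  by_cases hk : k = i
  · subst hk; simp
  · simp [hk, Ne.symm hk]

/-- Distinct members are at distance at least K.1, so the balls of radius K.1 / 2 around them are
disjoint; a separable space has room for only countably many. -/
theorem IsRieszBasis.countable [TopologicalSpace.SeparableSpace E] (h : IsRieszBasis e) :
    Countable I := by
  classical
  obtain ⟨K, hK⟩ := h.exists_bounds
  obtain ⟨S, hS, hb⟩ := hK.exists_synthesis
  have h1 := hK.pos.1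
  have hd : ∀ i k, i ≠ k → K.1 ≤ dist (e i) (e k) := by
    intro i k hik
    have h2 := (rieszCoord_sqBounds hb (e i - e k)).1
    have h3 : (1 : ℝ≥0∞) ≤ ∑' l, ‖rieszCoord S l (e i - e k)‖ₑ ^ 2 := by
      refine le_trans ?_ (ENNReal.le_tsum i)
      rw [map_sub, rieszCoord_basis hS, rieszCoord_basis hS]
      simp [hik]
    rw [dist_eq_norm]
    have h4 := (mul_norm_le_iff_enorm_sq h1.le (1 : ℝ) (e i - e k)).2 <| by
      refine le_trans ?_ h2
      gcongr
      simpa using h3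
    simpa using h4
  refine (Pairwise.countable_of_isOpen_disjoint (s := fun i => Metric.ball (e i) (K.1 / 2))
    (fun i k hik => ?_) (fun i => Metric.isOpen_ball) (fun i => ⟨e i, by simpa using h1⟩))
  refine Metric.ball_disjoint_ball ?_
  have := hd i k hik
  linarith

end Coord

/-! ### Tensor products of Riesz bases -/

section Tensor

variable {H : Type*} [NormedAddCommGroup H] [InnerProductSpace ℝ H] {I J : Type*}

theorem compLpL_elemTensor (f : H →L[ℝ] ℝ) (v : L2Half ℝ) (h : H) :
    f.compLpL 2 halfLine (elemTensor v h) = f h • v := by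
  refine Lp.ext ?_
  refine (f.coeFn_compLp' _).trans ?_
  filter_upwards [(ContinuousLinearMap.toSpanSingleton ℝ h).coeFn_compLp v,
    Lp.coeFn_smul (f h) v] with s h1 h2
  rw [h2, elemTensor, h1]
  simp [mul_comm]

theorem energy_compLpL (f : H →L[ℝ] ℝ) (u : L2Half H) (k : ℝ → ℝ≥0∞) (κ : ℝ × ℝ → ℝ≥0∞) :
    energy k κ (f.compLpL 2 halfLine u) = energy k κ (fun s => f (u s)) :=
  energy_congr (f.coeFn_compLp u)

variable {θ : I → L2Half ℝ} {h : J → H}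

theorem tsum_prod_eq_tsum_tsum_swap (g : I × J → ℝ≥0∞) :
    ∑' x, g x = ∑' j, ∑' i, g (i, j) := by
  rw [ENNReal.tsum_prod', ENNReal.tsum_comm]

/-- If the energy of scalar functions is comparable to a weighted square sum of their coefficients,
then the energy of vector-valued functions is comparable to the weighted square sum of the
coefficients with respect to the tensor basis. -/
theorem energy_tensorCoord_sqBounds [Countable J] {T : SeqL2 I ≃L[ℝ] L2Half ℝ}
    {S : SeqL2 J ≃L[ℝ] H} {K L : ℝ × ℝ} (hK : 0 ≤ K.1 ∧ 0 ≤ K.2)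
    {k : ℝ → ℝ≥0∞} (hk : Measurable k) {κ : ℝ × ℝ → ℝ≥0∞} (hκ : Measurable κ) {w : I → ℝ}
    (hT : ∀ c : SeqL2 I, SqBounds K (∑' i, ‖w i * c i‖ₑ ^ 2) (energy k κ (T c)))
    (hS : ∀ c : SeqL2 J, SqBounds L (∑' j, ‖c j‖ₑ ^ 2) (‖S c‖ₑ ^ 2)) (u : L2Half H) :
    SqBounds (K.1 * L.1, K.2 * L.2)
      (∑' x : I × J, ‖w x.1 *
        rieszCoord T x.1 ((rieszCoord S x.2).compLpL 2 halfLine u)‖ₑ ^ 2) (energy k κ u) := by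
  rw [tsum_prod_eq_tsum_tsum_swap]
  refine SqBounds.trans hK.1 hK.2 (SqBounds.tsum fun j => ?_)
    (energy_sqBounds_coord (f := rieszCoord S) (rieszCoord_sqBounds hS) hk hκ
      (Lp.stronglyMeasurable u))
  rw [← energy_compLpL]
  have := hT (T.symm ((rieszCoord S j).compLpL 2 halfLine u))
  rwa [T.apply_symm_apply] at this

/-- The functional that takes the spatial coordinate of the values and then the temporal coordinate
is continuous and dual to the elementary tensors, so it can be applied term by term. -/
theorem rieszCoord_compLpL_tensor {T : SeqL2 I ≃L[ℝ] L2Half ℝ}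
    (hT : ∀ c : SeqL2 I, HasSum (fun i => c i • θ i) (T c)) {S : SeqL2 J ≃L[ℝ] H}
    (hS : ∀ c : SeqL2 J, HasSum (fun j => c j • h j) (S c)) {c : I × J → ℝ} {u : L2Half H}
    (hu : HasSum (fun x => c x • elemTensor (θ x.1) (h x.2)) u) (x : I × J) :
    rieszCoord T x.1 ((rieszCoord S x.2).compLpL 2 halfLine u) = c x := by
  classical
  have h := hu.mapL ((rieszCoord T x.1).comp ((rieszCoord S x.2).compLpL 2 halfLine))
  refine h.unique ?_
  refine (hasSum_ite_eq (L := .unconditional (I × J)) x (c x)).congr_fun fun y => ?_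
  rw [map_smul, ContinuousLinearMap.comp_apply, compLpL_elemTensor, map_smul,
    rieszCoord_basis hT, rieszCoord_basis hS]
  by_cases hy : y = x
  · subst hy; simp
  · by_cases h1 : x.1 = y.1
    · have : x.2 ≠ y.2 := fun h2 => hy (Prod.ext h1.symm h2.symm)
      simp [hy, this]
    · simp [hy, h1]

theorem IsRieszBasisWith.tensor [CompleteSpace H] [Countable J] {K L : ℝ × ℝ}
    (hθ : IsRieszBasisWith θ K) (hh : IsRieszBasisWith h L) :
    IsRieszBasisWith (fun x : I × J => elemTensor (θ x.1) (h x.2)) (K.1 * L.1, K.2 * L.2) := by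
  classical
  obtain ⟨T, hT, hTK⟩ := hθ.exists_synthesis
  obtain ⟨S, hS, hSL⟩ := hh.exists_synthesis
  have h1 : 0 < K.1 * L.1 := mul_pos hθ.pos.1 hh.pos.1
  have h2 : 0 < K.2 * L.2 := mul_pos hθ.pos.2 hh.pos.2
  have hb : ∀ u : L2Half H, SqBounds (K.1 * L.1, K.2 * L.2)
      (∑' x : I × J, ‖rieszCoord T x.1 ((rieszCoord S x.2).compLpL 2 halfLine u)‖ₑ ^ 2)
      (‖u‖ₑ ^ 2) := by
    intro u
    have := energy_tensorCoord_sqBounds (T := T) (S := S) (L := L) (w := fun _ => 1)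
      ⟨hθ.pos.1.le, hθ.pos.2.le⟩
      (measurable_const (a := (1 : ℝ≥0∞))) (measurable_const (a := (0 : ℝ≥0∞)))
      (fun c => by simpa [L2Half.enorm_sq_eq_energy] using! hTK c) hSL u
    simpa [L2Half.enorm_sq_eq_energy] using! this
  -- The analysis operator is built first, since the two-sided bound is known on all of L²(H); the
  -- synthesis operator is its inverse.
  let A : L2Half H →ₗ[ℝ] SeqL2 (I × J) :=
    { toFun := fun u => ⟨fun x => rieszCoord T x.1 ((rieszCoord S x.2).compLpL 2 halfLine u),
        (memlp_two_iff _).2 (((hb u).lt_top_iff h1).1 (by simp))⟩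
      map_add' := fun u v => by
        ext x
        exact (congrArg _ (map_add _ u v)).trans (map_add _ _ _)
      map_smul' := fun a u => by
        ext x
        exact (congrArg _ (map_smul _ a u)).trans (map_smul _ _ _) }
  have hA : ∀ u, K.1 * L.1 * ‖A u‖ ≤ ‖u‖ ∧ ‖u‖ ≤ K.2 * L.2 * ‖A u‖ := fun u => by
    have := hb u
    rw [← sqBounds_enorm_iff (K := (K.1 * L.1, K.2 * L.2)) h1.le h2.le, SeqL2.enorm_sq]
    exact this
  have hA1 : ∀ x : I × J, A (elemTensor (θ x.1) (h x.2)) = lp.single 2 x 1 := by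
    intro x
    ext y
    change rieszCoord T y.1 ((rieszCoord S y.2).compLpL 2 halfLine _) = _
    rw [compLpL_elemTensor, map_smul, rieszCoord_basis hT, rieszCoord_basis hS]
    by_cases hy : y = x
    · subst hy; simp
    · by_cases h1 : y.1 = x.1
      · have : y.2 ≠ x.2 := fun h2 => hy (Prod.ext h1 h2)
        simp [hy, this]
      · simp [hy, h1]
  let AL : L2Half H →L[ℝ] SeqL2 (I × J) := A.mkContinuous (K.1 * L.1)⁻¹ fun u => by
    rw [inv_mul_eq_div, le_div_iff₀ h1, mul_comm]
    exact (hA u).1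
  have hanti : AntilipschitzWith (Real.toNNReal (K.2 * L.2)) AL :=
    AddMonoidHomClass.antilipschitz_of_bound AL fun u => by
      rw [Real.coe_toNNReal _ h2.le]
      exact (hA u).2
  -- Being bounded below on a complete space, the operator has closed range; the range contains the
  -- unit vectors and hence all of ℓ₂.
  have hclosed : IsClosed (range AL) := hanti.isClosed_range AL.uniformContinuous
  have hbij : Function.Bijective A := by
    refine ⟨hanti.injective, fun c => ?_⟩
    have hc := SeqL2.hasSum_single c
    refine hclosed.mem_of_tendsto hc (Filter.Eventually.of_forall fun s => ?_)
    refine ⟨∑ x ∈ s, c x • elemTensor (θ x.1) (h x.2), ?_⟩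
    rw [map_sum]
    refine Finset.sum_congr rfl fun x _ => ?_
    rw [map_smul]
    exact congrArg _ (hA1 x)
  let AE := (LinearEquiv.ofBijective A hbij).symm.toContinuousLinearEquivOfBounds (K.2 * L.2)
    (K.1 * L.1)⁻¹ (fun c => by
      obtain ⟨u, rfl⟩ := (LinearEquiv.ofBijective A hbij).surjective c
      rw [LinearEquiv.symm_apply_apply]
      exact (hA u).2)
    (fun u => by
      rw [inv_mul_eq_div, le_div_iff₀ h1, mul_comm]
      exact (hA u).1)
  have hAE : ∀ x : I × J, AE (lp.single 2 x 1) = elemTensor (θ x.1) (h x.2) := fun x => by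
    rw [← hA1]
    exact (LinearEquiv.ofBijective A hbij).symm_apply_apply _
  refine ⟨h1, h2, AE, fun c => ⟨?_, ?_⟩⟩
  · exact hasSum_synthesis_of_single (S := (AE : SeqL2 (I × J) →L[ℝ] L2Half H)) hAE c
  · have := hA (AE c)
    have h3 : A (AE c) = c := (LinearEquiv.ofBijective A hbij).apply_symm_apply c
    rwa [h3] at this

end Tensor

/-! ### Energies attached to embedded spaces -/

section Embedded

variable {E F G : Type*} [NormedAddCommGroup E] [NormedSpace ℝ E] [NormedAddCommGroup F]
  [NormedSpace ℝ F] [NormedAddCommGroup G] [NormedSpace ℝ G]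

/-- The embedding `j` identifies `E` with the elements of `F` of finite energy `N`, and `N` is the
squared norm of `E`. -/
structure IsEnergyOf (j : E →L[ℝ] F) (N : F → ℝ≥0∞) : Prop where
  injective : Function.Injective j
  enorm_sq : ∀ p, ‖p‖ₑ ^ 2 = N (j p)
  exists_of_lt_top : ∀ u, N u < ⊤ → ∃ p, j p = u

theorem HHalf.isEnergyOf : IsEnergyOf (HHalf.toL2 E) fun u => energy 1 slopeKernel u :=
  ⟨HHalf.toL2_injective, HHalf.enorm_sq, fun _ => HHalf.exists_of_energy⟩

theorem HHalfZero.isEnergyOf :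
    IsEnergyOf (HHalfZero.toL2 E) fun u => energy hardyWeight slopeKernel u :=
  ⟨HHalfZero.toL2_injective, HHalfZero.enorm_sq, fun _ => HHalfZero.exists_of_energy⟩

/-- The squared `E`-norm on `F`, infinite outside of the range of the embedding `j`. -/
noncomputable def embEnergy (j : E →L[ℝ] F) (u : F) : ℝ≥0∞ :=
  ⨅ (p : E) (_ : j p = u), ‖p‖ₑ ^ 2

/-- Meant for L²(V) inside L²(H), whose norm is not given as an `energy` of the H-values. Outside
the range of j the infimum is over an empty set, hence infinite. -/
theorem isEnergyOf_embEnergy {j : E →L[ℝ] F} (hj : Function.Injective j) :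
    IsEnergyOf j (embEnergy j) := by
  refine ⟨hj, fun p => ?_, fun u hu => ?_⟩
  · refine le_antisymm (le_iInf₂ fun q hq => by rw [hj hq]) (iInf₂_le (f := fun (q : E) (_ : j q = j p) => ‖q‖ₑ ^ 2) p rfl)
  · by_contra h
    push Not at h
    simp [embEnergy, h] at hu

theorem IsEnergyOf.inter {j : E →L[ℝ] F} {k : G →L[ℝ] F} {N M : F → ℝ≥0∞} (hN : IsEnergyOf j N)
    (hM : IsEnergyOf k M) : IsEnergyOf (interSpace.incl j k) fun u => N u + M u := by
  have h1 : ∀ p : interSpace j k,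
      interSpace.incl j k p = j (p : WithLp 2 (E × G)).fst := fun p => rfl
  have h2 : ∀ p : interSpace j k,
      interSpace.incl j k p = k (p : WithLp 2 (E × G)).snd := fun p => (h1 p).trans p.2
  refine ⟨fun p q hpq => ?_, fun p => ?_, fun u hu => ?_⟩
  · have e1 := hN.injective (((h1 p).symm.trans hpq).trans (h1 q))
    have e2 := hM.injective (((h2 p).symm.trans hpq).trans (h2 q))
    exact Subtype.ext (WithLp.ofLp_injective 2 (Prod.ext e1 e2))
  · have h : ‖p‖ₑ = ‖(p : WithLp 2 (E × G))‖ₑ := rfl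
    rw [h, WithLp.enorm_sq, hN.enorm_sq, hM.enorm_sq, ← h1, ← h2]
  · rw [ENNReal.add_lt_top] at hu
    obtain ⟨p, hp⟩ := hN.exists_of_lt_top u hu.1
    obtain ⟨q, hq⟩ := hM.exists_of_lt_top u hu.2
    exact ⟨⟨WithLp.toLp 2 (p, q), hp.trans hq.symm⟩, hp⟩

/-- If a rescaling of a Riesz basis `b` of `F` is a Riesz basis of `E`, then the `E`-norm is
comparable to a weighted square sum of the coefficients with respect to `b`. -/
theorem IsEnergyOf.sqBounds {j : E →L[ℝ] F} {N : F → ℝ≥0∞} (hN : IsEnergyOf j N) {I : Type*}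
    {b : I → F} {S : SeqL2 I ≃L[ℝ] F} (hS : ∀ c : SeqL2 I, HasSum (fun i => c i • b i) (S c))
    {r : I → ℝ} (hr : ∀ i, 0 < r i) {K : ℝ × ℝ}
    (hK : IsRieszBasisInWith j (fun i => r i • b i) K) (c : SeqL2 I) :
    SqBounds K (∑' i, ‖(r i)⁻¹ * c i‖ₑ ^ 2) (N (S c)) := by
  obtain ⟨e, he, hK⟩ := hK
  obtain ⟨T, hT, hTK⟩ := hK.exists_synthesis
  have hjT : ∀ d : SeqL2 I, HasSum (fun i => (d i * r i) • b i) (j (T d)) := fun d => by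
    refine ((hT d).mapL j).congr_fun fun i => ?_
    rw [map_smul, he, mul_smul]
  have key : ∀ d : SeqL2 I, j (T d) = S c → (∀ i, d i = (r i)⁻¹ * c i) := fun d hd i => by
    have := rieszCoord_of_hasSum hS (hjT d) i
    rw [hd, rieszCoord_synthesis] at this
    rw [this]
    field_simp [(hr i).ne']
  have main : ∀ d : SeqL2 I, j (T d) = S c →
      SqBounds K (∑' i, ‖(r i)⁻¹ * c i‖ₑ ^ 2) (N (S c)) := fun d hd => by
    simp_rw [← key d hd]
    rw [← hd, ← hN.enorm_sq]
    exact hTK d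
  -- If either side is finite, S c is the image of some T d and the Riesz bounds of E apply.
  -- Otherwise both sides are infinite and the comparison is trivial.
  by_cases h1 : N (S c) < ⊤
  · obtain ⟨p, hp⟩ := hN.exists_of_lt_top _ h1
    exact main (T.symm p) (by rwa [T.apply_symm_apply])
  by_cases h2 : ∑' i, ‖(r i)⁻¹ * c i‖ₑ ^ 2 < ⊤
  · refine main ⟨_, (memlp_two_iff _).2 h2⟩ ((hjT _).unique ((hS c).congr_fun fun i => ?_))
    change ((r i)⁻¹ * c i * r i) • b i = _
    congr 1
    field_simp [(hr i).ne']
  · rw [not_lt, top_le_iff] at h1 h2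
    rw [h1, h2]
    refine ⟨le_top, ?_⟩
    rw [ENNReal.mul_top]
    simpa using hK.pos.2

theorem normIn_eq {j : E →L[ℝ] F} (hj : Function.Injective j) (p : E) : normIn j (j p) = ‖p‖ := by
  have : {r : ℝ | ∃ q : E, j q = j p ∧ ‖q‖ = r} = {‖p‖} := by
    ext r
    constructor
    · rintro ⟨q, hq, rfl⟩
      rw [hj hq]; rfl
    · rintro rfl
      exact ⟨p, rfl, rfl⟩
  rw [normIn, this, csInf_singleton]

theorem IsRieszBasisWith.norm_bounds {I : Type*} {e : I → E} {K : ℝ × ℝ}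
    (h : IsRieszBasisWith e K) (i : I) : K.1 ≤ ‖e i‖ ∧ ‖e i‖ ≤ K.2 := by
  classical
  obtain ⟨_, _, S, hS⟩ := h
  have h1 := (hS (lp.single 2 i 1)).2
  rw [synthesis_single (fun c => (hS c).1), lp.norm_single (by norm_num)] at h1
  simpa using h1

/-- Each member of a Riesz basis has norm between the Riesz bounds. With r = ρ^(1/2) this makes the
intrinsic norm of θ comparable to ρ^(-1/2), which removes ρ from the final normalization. -/
theorem normIn_bounds {j : E →L[ℝ] F} (hj : Function.Injective j) {I : Type*} {b : I → F}
    {r : I → ℝ} (hr : ∀ i, 0 < r i) {K : ℝ × ℝ} (hK : IsRieszBasisInWith j (fun i => r i • b i) K)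
    (i : I) : K.1 * (r i)⁻¹ ≤ normIn j (b i) ∧ normIn j (b i) ≤ K.2 * (r i)⁻¹ := by
  obtain ⟨e, he, hK⟩ := hK
  have h1 : b i = j ((r i)⁻¹ • e i) := by
    rw [map_smul, he, inv_smul_smul₀ (hr i).ne']
  rw [h1, normIn_eq hj, norm_smul, norm_inv, Real.norm_of_nonneg (hr i).le, mul_comm (r i)⁻¹]
  have hi := inv_nonneg.2 (hr i).le
  have := hK.norm_bounds i
  exact ⟨by gcongr; exact this.1, by gcongr; exact this.2⟩

end Embedded

/-! ### Normalized tensor product bases of intersection spaces -/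

section Scaled

variable {H V : Type*} [NormedAddCommGroup H] [InnerProductSpace ℝ H]
  [NormedAddCommGroup V] [InnerProductSpace ℝ V] {ι : V →L[ℝ] H}

theorem bochnerIncl_injective (hι : Function.Injective ι) :
    Function.Injective (bochnerIncl ι) := by
  rw [injective_iff_map_eq_zero]
  intro u hu
  have h1 := ι.coeFn_compLp' u
  have h2 : bochnerIncl ι u =ᵐ[halfLine] 0 := by rw [hu]; exact Lp.coeFn_zero _ _ _
  refine Lp.ext ?_
  filter_upwards [h1, h2, Lp.coeFn_zero V 2 halfLine] with s h1 h2 h3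
  rw [h3]
  refine hι ?_
  rw [Pi.zero_apply, map_zero]
  exact h1.symm.trans h2

theorem bochnerIncl_elemTensor (v : L2Half ℝ) (x : V) :
    bochnerIncl ι (elemTensor v x) = elemTensor v (ι x) := by
  refine Lp.ext ?_
  refine (ι.coeFn_compLp' _).trans ?_
  filter_upwards [(ContinuousLinearMap.toSpanSingleton ℝ x).coeFn_compLp v,
    (ContinuousLinearMap.toSpanSingleton ℝ (ι x)).coeFn_compLp v] with s h1 h2
  rw [elemTensor, elemTensor, h1, h2]
  simp

theorem elemTensor_smul {E : Type*} [NormedAddCommGroup E] [NormedSpace ℝ E] (v : L2Half ℝ)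
    (a : ℝ) (x : E) : elemTensor v (a • x) = a • elemTensor v x := by
  refine Lp.ext ?_
  filter_upwards [(ContinuousLinearMap.toSpanSingleton ℝ x).coeFn_compLp v,
    (ContinuousLinearMap.toSpanSingleton ℝ (a • x)).coeFn_compLp v,
    Lp.coeFn_smul a (elemTensor v x)] with s h1 h2 h3
  rw [h3, Pi.smul_apply, elemTensor, elemTensor, h1, h2]
  simp only [ContinuousLinearMap.toSpanSingleton_apply]
  rw [smul_comm]

theorem SqBounds.tsum_weights {I : Type*} {w r c : I → ℝ} {K : ℝ × ℝ} (hr : ∀ i, 0 < r i)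
    (hK : 0 < K.1 ∧ 0 < K.2) (hw : ∀ i, K.1 * r i ≤ w i ∧ w i ≤ K.2 * r i) :
    SqBounds (K.2⁻¹, K.1⁻¹) (∑' i, ‖w i * c i‖ₑ ^ 2) (∑' i, ‖r i * c i‖ₑ ^ 2) := by
  refine SqBounds.tsum fun i => ?_
  have h0 : 0 ≤ w i := (mul_pos hK.1 (hr i)).le.trans (hw i).1
  rw [sqBounds_enorm_iff (K := (K.2⁻¹, K.1⁻¹)) (inv_nonneg.2 hK.2.le) (inv_nonneg.2 hK.1.le),
    norm_mul, norm_mul, Real.norm_of_nonneg (hr i).le, Real.norm_of_nonneg h0, ← mul_assoc,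
    ← mul_assoc]
  constructor
  · gcongr
    rw [inv_mul_le_iff₀ hK.2]
    exact (hw i).2
  · gcongr
    rw [← div_eq_inv_mul, le_div_iff₀ hK.1, mul_comm]
    exact (hw i).1

/-- The lower and upper Riesz bounds of the normalized tensor product basis. -/
noncomputable def tensorBounds (K₁ K₂ K₃ K₄ : ℝ × ℝ) : ℝ × ℝ :=
  -- The three entries serve, in order, Θ ⊗ Σ in L²(H), the half-order part and the L²(V) part. The
  -- extra factor from K₂ pays for replacing ρ^(-1/2) by the norm of θ.
  (min (K₁.1 * K₃.1) (min (K₂.2⁻¹ * (K₂.1 * K₃.1)) (K₁.1 * K₄.1)),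
    max (K₁.2 * K₃.2) (max (K₂.1⁻¹ * (K₂.2 * K₃.2)) (K₁.2 * K₄.2)))

theorem tensorBounds_pos {K₁ K₂ K₃ K₄ : ℝ × ℝ} (h₁ : 0 < K₁.1 ∧ 0 < K₁.2)
    (h₂ : 0 < K₂.1 ∧ 0 < K₂.2) (h₃ : 0 < K₃.1 ∧ 0 < K₃.2) (h₄ : 0 < K₄.1 ∧ 0 < K₄.2) :
    0 < (tensorBounds K₁ K₂ K₃ K₄).1 ∧ 0 < (tensorBounds K₁ K₂ K₃ K₄).2 := by
  obtain ⟨a₁, b₁⟩ := h₁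
  obtain ⟨a₂, b₂⟩ := h₂
  obtain ⟨a₃, b₃⟩ := h₃
  obtain ⟨a₄, b₄⟩ := h₄
  simp only [tensorBounds, lt_min_iff, lt_max_iff]
  exact ⟨⟨by positivity, by positivity, by positivity⟩, Or.inl (by positivity)⟩

theorem IsRieszBasisWith.tensorFamily [CompleteSpace H] {I J : Type*} [Countable J]
    {θ : I → L2Half ℝ} {σ : J → V} {K L : ℝ × ℝ} (hθ : IsRieszBasisWith θ K)
    (hσ : IsRieszBasisWith (fun m => ι (σ m)) L) :
    IsRieszBasisWith (tensorFamily ι θ σ) (K.1 * L.1, K.2 * L.2) := by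
  have h := hθ.tensor hσ
  exact h

theorem scaledTensor_isRieszBasisInWith [CompleteSpace H] [TopologicalSpace.SeparableSpace H]
    [CompleteSpace V] (hι : Function.Injective ι) {W₁ W : Type*} [NormedAddCommGroup W₁]
    [NormedSpace ℝ W₁] [NormedAddCommGroup W] [NormedSpace ℝ W] {j₁ : W₁ →L[ℝ] L2Half ℝ}
    {j : W →L[ℝ] L2Half H} {k : ℝ → ℝ≥0∞} (hk : Measurable k) {κ : ℝ × ℝ → ℝ≥0∞}
    (hκ : Measurable κ) (hj₁ : IsEnergyOf j₁ fun u => energy k κ u)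
    (hj : IsEnergyOf j fun u => energy k κ u) {I J : Type*} {θ : I → L2Half ℝ} {σ : J → V}
    {ρ : I → ℝ} (hρ : ∀ l, 0 < ρ l) {K₁ K₂ K₃ K₄ : ℝ × ℝ} (hK₁ : IsRieszBasisWith θ K₁)
    (hK₂ : IsRieszBasisInWith j₁ (rescaled ρ (1 / 2) θ) K₂)
    (hK₃ : IsRieszBasisWith (fun m => ι (σ m)) K₃)
    (hK₄ : IsRieszBasisWith (fun m => ‖σ m‖⁻¹ • σ m) K₄) :
    IsRieszBasisWith (tensorFamily ι θ σ) (tensorBounds K₁ K₂ K₃ K₄) ∧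
    IsRieszBasisInWith (interSpace.incl j (bochnerIncl ι)) (scaledTensorFamily j₁ ι θ σ)
      (tensorBounds K₁ K₂ K₃ K₄) := by
  have : Countable J := hK₃.isRieszBasis.countable
  have hσ : ∀ m, 0 < ‖σ m‖ := fun m => norm_pos_iff.2 fun h =>
    hK₃.isRieszBasis.ne_zero m (by rw [h, map_zero])
  have hr : ∀ l, 0 < ρ l ^ (1 / 2 : ℝ) := fun l => Real.rpow_pos_of_pos (hρ l) _
  have p1 := hK₁.pos
  have p2 := hK₂.pos
  have p3 := hK₃.pos
  have p4 := hK₄.pos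
  obtain ⟨hlo, hup⟩ := tensorBounds_pos p1 p2 p3 p4
  have hten := hK₁.tensorFamily hK₃
  refine ⟨hten.mono hlo (min_le_left _ _) (le_max_left _ _), ?_⟩
  obtain ⟨T, hT, hTK⟩ := hK₁.exists_synthesis
  obtain ⟨S, hS, hSK⟩ := hK₃.exists_synthesis
  obtain ⟨U, hU, hUK⟩ := hten.exists_synthesis
  have hn := normIn_bounds hj₁.injective hr hK₂
  have hn0 : ∀ l, 0 < normIn j₁ (θ l) := fun l =>
    (mul_pos p2.1 (inv_pos.2 (hr l))).trans_le (hn l).1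
  have hV := isEnergyOf_embEnergy (j := bochnerIncl ι) (bochnerIncl_injective hι)
  -- The tensor product lemma is used with V in the role of H, for the V-normalized spatial basis.
  have hVb : IsRieszBasisInWith (bochnerIncl ι)
      (fun x : I × J => ‖σ x.2‖⁻¹ • tensorFamily ι θ σ x) (K₁.1 * K₄.1, K₁.2 * K₄.2) := by
    have h := hK₁.tensor hK₄
    refine ⟨_, fun x => ?_, h⟩
    rw [elemTensor_smul, map_smul, bochnerIncl_elemTensor]
    rfl
  refine IsRieszBasisInWith.of_energy (hj.inter hV).injective (hj.inter hV).enorm_sq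
    (hj.inter hV).exists_of_lt_top hU
    (w := fun x : I × J => Real.sqrt (‖σ x.2‖ ^ 2 + normIn j₁ (θ x.1) ^ 2))
    (fun x => Real.sqrt_pos.2 (add_pos (pow_pos (hσ _) 2) (pow_pos (hn0 _) 2))) hlo hup fun c => ?_
  -- The squared weight is a sum of a temporal and a spatial term, matching the two energies of the
  -- intersection; each is then bounded separately.
  have hsum : ∀ x : I × J, ‖Real.sqrt (‖σ x.2‖ ^ 2 + normIn j₁ (θ x.1) ^ 2) * c x‖ₑ ^ 2 =
      ‖normIn j₁ (θ x.1) * c x‖ₑ ^ 2 + ‖‖σ x.2‖ * c x‖ₑ ^ 2 := fun x => by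
    simp_rw [enorm_sq_eq_ofReal]
    rw [← ENNReal.ofReal_add (by positivity) (by positivity), norm_mul, norm_mul, norm_mul,
      norm_norm, mul_pow, mul_pow, mul_pow, Real.norm_of_nonneg (Real.sqrt_nonneg _),
      Real.sq_sqrt (by positivity), Real.norm_of_nonneg (hn0 _).le]
    congr 1
    ring
  simp_rw [hsum]
  rw [ENNReal.tsum_add]
  refine SqBounds.add ?_ ?_
  · have h1 := energy_tensorCoord_sqBounds (L := K₃) ⟨p2.1.le, p2.2.le⟩ hk hκ
      (hj₁.sqBounds hT hr hK₂) hSK (U c)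
    have h2 := fun x => rieszCoord_compLpL_tensor hT hS (hU c) x
    simp_rw [h2] at h1
    have h3 : SqBounds (K₂.2⁻¹, K₂.1⁻¹) (∑' x : I × J, ‖normIn j₁ (θ x.1) * c x‖ₑ ^ 2)
        (∑' x : I × J, ‖(ρ x.1 ^ (1 / 2 : ℝ))⁻¹ * c x‖ₑ ^ 2) :=
      SqBounds.tsum_weights (fun x => inv_pos.2 (hr _)) p2 fun x => hn _
    refine (h3.trans (inv_nonneg.2 p2.2.le) (inv_nonneg.2 p2.1.le) h1).mono ?_ ?_
    · exact (min_le_right _ _).trans (min_le_left _ _)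
    · exact (le_max_left _ _).trans (le_max_right _ _)
  · have h1 := hV.sqBounds hU (fun x : I × J => inv_pos.2 (hσ x.2)) hVb c
    simp_rw [inv_inv] at h1
    refine h1.mono ?_ ?_
    · exact (min_le_right _ _).trans (min_le_right _ _)
    · exact (le_max_right _ _).trans (le_max_right _ _)

end Scaled

/-! ### Interpolation of Riesz bases -/

theorem enorm_add_sq_le {E : Type*} [NormedAddCommGroup E] (x y : E) :
    ‖x + y‖ₑ ^ 2 ≤ 2 * ‖x‖ₑ ^ 2 + 2 * ‖y‖ₑ ^ 2 := by
  have h2 : (2 : ℝ≥0∞) = ENNReal.ofReal 2 := by simp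
  simp_rw [enorm_sq_eq_ofReal]
  rw [h2, ← ENNReal.ofReal_mul (by norm_num), ← ENNReal.ofReal_mul (by norm_num),
    ← ENNReal.ofReal_add (by positivity) (by positivity)]
  refine ENNReal.ofReal_le_ofReal ?_
  have := norm_add_le x y
  nlinarith [norm_nonneg (x + y), sq_nonneg (‖x‖ - ‖y‖)]

theorem exists_sqBounds {C D : ℝ≥0∞} (hC : C ≠ ⊤) (hD : D ≠ ⊤) :
    ∃ K : ℝ × ℝ, 0 < K.1 ∧ 0 < K.2 ∧ ∀ x y : ℝ≥0∞, x ≤ C * y → y ≤ D * x → SqBounds K x y := by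
  have key : ∀ C : ℝ≥0∞, C ≠ ⊤ → C ≤ ENNReal.ofReal (C.toReal + 1) ^ 2 := fun C hC => by
    rw [← ENNReal.ofReal_pow (by positivity)]
    refine ENNReal.le_ofReal_iff_toReal_le hC (by positivity) |>.2 ?_
    nlinarith [ENNReal.toReal_nonneg (a := C)]
  have hpos : 0 < C.toReal + 1 := by positivity
  refine ⟨((C.toReal + 1)⁻¹, D.toReal + 1), by positivity, by positivity, fun x y hx hy => ?_⟩
  refine ⟨?_, hy.trans (by gcongr; exact key D hD)⟩
  change ENNReal.ofReal (C.toReal + 1)⁻¹ ^ 2 * x ≤ y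
  calc _ ≤ ENNReal.ofReal (C.toReal + 1)⁻¹ ^ 2 * (ENNReal.ofReal (C.toReal + 1) ^ 2 * y) := by
        gcongr
        exact hx.trans (by gcongr; exact key C hC)
    _ = y := by
        rw [← mul_assoc, ← mul_pow, ← ENNReal.ofReal_mul (by positivity), inv_mul_cancel₀ hpos.ne']
        simp

theorem lintegral_Ioi_inv_sq {a : ℝ} (ha : 0 < a) :
    ∫⁻ t in Ioi a, (ENNReal.ofReal t)⁻¹ ^ 2 = (ENNReal.ofReal a)⁻¹ := by
  have h : ∀ t ∈ Ioi a, (ENNReal.ofReal t)⁻¹ ^ 2 = ENNReal.ofReal (t ^ (-2 : ℝ)) := fun t ht => by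
    have h0 : 0 < t := ha.trans ht
    rw [← ENNReal.ofReal_inv_of_pos h0, ← ENNReal.ofReal_pow (by positivity)]
    congr 1
    rw [Real.rpow_neg h0.le, inv_pow]
    norm_cast
  rw [setLIntegral_congr_fun measurableSet_Ioi h, ← ofReal_integral_eq_lintegral_ofReal
    (integrableOn_Ioi_rpow_of_lt (by norm_num) ha), integral_Ioi_rpow_of_lt (by norm_num) ha,
    ← ENNReal.ofReal_inv_of_pos ha]
  · congr 1
    norm_num [Real.rpow_neg_one]
  · filter_upwards [ae_restrict_mem measurableSet_Ioi] with t ht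
    have h0 : 0 < t := ha.trans ht
    positivity

section Interpolation

variable {E F : Type*} [NormedAddCommGroup E] [NormedSpace ℝ E] [NormedAddCommGroup F]
  [NormedSpace ℝ F]

/-- The square integral over the scales `t > 0` of the errors `t⁻¹ ‖u - v(t)‖` and of the norms of
the approximations `v(t)` of `u` in the subspace `E` of `F`. -/
noncomputable def approxIntegral (j : E →L[ℝ] F) (u : F) (v : ℝ → E) : ℝ≥0∞ :=
  ∫⁻ t in Ioi 0, ((ENNReal.ofReal t)⁻¹ ^ 2 * ‖u - j (v t)‖ₑ ^ 2 + ‖v t‖ₑ ^ 2)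

variable {I : Type*} {b : I → F} {S : SeqL2 I ≃L[ℝ] F} {K L : ℝ × ℝ} {ρ : I → ℝ} {j : E →L[ℝ] F}

/-- The norm of ρ_i b_i in F is at least K.1 ρ_i and, by continuity of j, at most ‖j‖ L.2.
Boundedness of ρ lets the plain L² norm be absorbed by the sum with weights 1/ρ. -/
theorem exists_bound_of_rescaled (hb : IsRieszBasisWith b K) (hρ : ∀ i, 0 < ρ i)
    (hL : IsRieszBasisInWith j (fun i => ρ i • b i) L) : ∃ M : ℝ, ∀ i, ρ i ≤ M := by
  obtain ⟨e, he, hL⟩ := hL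
  refine ⟨‖j‖ * L.2 / K.1, fun i => ?_⟩
  rw [le_div_iff₀ hb.pos.1]
  calc ρ i * K.1 ≤ ρ i * ‖b i‖ := by
        have := (hb.norm_bounds i).1
        have := (hρ i).le
        gcongr
    _ = ‖j (e i)‖ := by rw [he, norm_smul, Real.norm_of_nonneg (hρ i).le]
    _ ≤ ‖j‖ * ‖e i‖ := j.le_opNorm _
    _ ≤ ‖j‖ * L.2 := by gcongr; exact (hL.norm_bounds i).2

theorem embedding_synthesis (hS : ∀ c : SeqL2 I, HasSum (fun i => c i • b i) (S c)) {e : I → E}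
    (he : ∀ i, j (e i) = ρ i • b i) {T : SeqL2 I ≃L[ℝ] E}
    (hT : ∀ c : SeqL2 I, HasSum (fun i => c i • e i) (T c)) (d : SeqL2 I) (i : I) :
    rieszCoord S i (j (T d)) = ρ i * d i := by
  refine rieszCoord_of_hasSum (c := fun i => ρ i * d i) hS (((hT d).mapL j).congr_fun fun i => ?_) i
  rw [map_smul, he, smul_smul, mul_comm]

/-- With a = ρ_i, this is the cost of dropping a coefficient at scales t > a, and
`lintegral_indicator_Iic_inv_sq` is the cost of keeping it at scales t ≤ a. Both equal x / a, which
is the origin of the exponent 1/2. -/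
theorem lintegral_indicator_Ioi_inv_sq {a : ℝ} (ha : 0 < a) (x : ℝ≥0∞) :
    ∫⁻ t in Ioi 0, (Ioi a).indicator (fun t => (ENNReal.ofReal t)⁻¹ ^ 2 * x) t =
      (ENNReal.ofReal a)⁻¹ * x := by
  rw [setLIntegral_indicator measurableSet_Ioi, inter_eq_left.2 (Ioi_subset_Ioi ha.le),
    lintegral_mul_const _ (by fun_prop), lintegral_Ioi_inv_sq ha]

theorem lintegral_indicator_Iic_inv_sq {a : ℝ} (ha : 0 < a) (x : ℝ≥0∞) :
    ∫⁻ t in Ioi 0, (Iic a).indicator (fun _ => (ENNReal.ofReal a)⁻¹ ^ 2 * x) t =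
      (ENNReal.ofReal a)⁻¹ * x := by
  have h : Iic a ∩ Ioi 0 = Ioc 0 a := by rw [inter_comm]; rfl
  have h0 : ENNReal.ofReal a ≠ 0 := by simpa using ha
  rw [setLIntegral_indicator measurableSet_Iic, h, setLIntegral_const, Real.volume_Ioc, sub_zero,
    mul_right_comm, sq, mul_assoc _ _ (ENNReal.ofReal a),
    ENNReal.inv_mul_cancel h0 ENNReal.ofReal_ne_top, mul_one]

theorem exists_approx_le [Countable I] (hb : IsRieszBasisWith b K)
    (hS : ∀ c : SeqL2 I, HasSum (fun i => c i • b i) (S c)) (hρ : ∀ i, 0 < ρ i)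
    (hL : IsRieszBasisInWith j (fun i => ρ i • b i) L) :
    ∃ C : ℝ≥0∞, C ≠ ⊤ ∧ ∀ c : SeqL2 I, ∃ v : ℝ → E,
      ‖S c‖ₑ ^ 2 + approxIntegral j (S c) v ≤
        C * ∑' i, (ENNReal.ofReal (ρ i))⁻¹ * ‖c i‖ₑ ^ 2 := by
  obtain ⟨M, hM⟩ := exists_bound_of_rescaled hb hρ hL
  have hSn : ∀ c : SeqL2 I, ‖S c‖ₑ ^ 2 ≤ ENNReal.ofReal K.2 ^ 2 * ∑' i, ‖c i‖ₑ ^ 2 := by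
    intro c
    obtain ⟨S', hS', hK⟩ := hb.exists_synthesis
    rw [(hS c).unique (hS' c)]
    exact (hK c).2
  obtain ⟨e, he, hL⟩ := hL
  obtain ⟨T, hT, hTL⟩ := hL.exists_synthesis
  refine ⟨ENNReal.ofReal K.2 ^ 2 * ENNReal.ofReal M +
    (ENNReal.ofReal K.2 ^ 2 + ENNReal.ofReal L.2 ^ 2), by finiteness, fun c => ?_⟩
  have hρ0 : ∀ i, ENNReal.ofReal (ρ i) ≠ 0 := fun i => by simpa using hρ i
  -- The approximant v(t) keeps the terms with ρ_i ≥ t. Its coefficients carry the factor 1/ρ_i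
  -- because the basis of E is ρ_i b_i, and 1/ρ_i ≤ 1/t keeps them in ℓ₂.
  have hmem : ∀ t : ℝ, Memℓp (fun i => if 0 < t ∧ t ≤ ρ i then (ρ i)⁻¹ * c i else 0) 2 := by
    intro t
    rw [memlp_two_iff_summable_sq]
    refine Summable.of_nonneg_of_le (fun i => by positivity) (fun i => ?_)
      (((memlp_two_iff_summable_sq _).1 (lp.memℓp c)).mul_left (t⁻¹ ^ 2))
    split_ifs with h
    · rw [norm_mul, mul_pow, norm_inv, Real.norm_of_nonneg (hρ i).le]
      have := hρ i
      have := h.1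
      have := h.2
      gcongr
    · rw [norm_zero, zero_pow two_ne_zero]
      positivity
  refine ⟨fun t => T ⟨_, hmem t⟩, ?_⟩
  have hv : ∀ t ∈ Ioi (0 : ℝ), ‖T ⟨_, hmem t⟩‖ₑ ^ 2 ≤ ENNReal.ofReal L.2 ^ 2 *
      ∑' i, (Iic (ρ i)).indicator
        (fun _ => (ENNReal.ofReal (ρ i))⁻¹ ^ 2 * ‖c i‖ₑ ^ 2) t := by
    intro t ht
    refine (hTL _).2.trans ?_
    gcongr with i
    change ‖(if 0 < t ∧ t ≤ ρ i then (ρ i)⁻¹ * c i else 0)‖ₑ ^ 2 ≤ _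
    by_cases h : t ≤ ρ i
    · rw [if_pos ⟨ht, h⟩, indicator_of_mem (show t ∈ Iic (ρ i) from h), enorm_mul, mul_pow,
        enorm_inv (hρ i).ne', Real.enorm_of_nonneg (hρ i).le]
    · rw [if_neg (fun hh => h hh.2)]
      simp
  have hu : ∀ t ∈ Ioi (0 : ℝ), (ENNReal.ofReal t)⁻¹ ^ 2 * ‖S c - j (T ⟨_, hmem t⟩)‖ₑ ^ 2 ≤
      ENNReal.ofReal K.2 ^ 2 * ∑' i, (Ioi (ρ i)).indicator
        (fun t => (ENNReal.ofReal t)⁻¹ ^ 2 * ‖c i‖ₑ ^ 2) t := by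
    intro t ht
    have h1 := hSn (S.symm (S c - j (T ⟨_, hmem t⟩)))
    rw [S.apply_symm_apply] at h1
    refine (mul_le_mul_right h1 _).trans ?_
    rw [mul_left_comm, ← ENNReal.tsum_mul_left]
    gcongr with i
    rw [← rieszCoord_apply, map_sub, rieszCoord_synthesis, embedding_synthesis hS he hT]
    change _ * ‖c i - ρ i * (if 0 < t ∧ t ≤ ρ i then (ρ i)⁻¹ * c i else 0)‖ₑ ^ 2 ≤ _
    by_cases h : t ≤ ρ i
    · rw [if_pos ⟨ht, h⟩, mul_inv_cancel_left₀ (hρ i).ne']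
      simp
    · rw [if_neg (fun hh => h hh.2), indicator_of_mem (show t ∈ Ioi (ρ i) from not_le.1 h)]
      simp
  have hint : approxIntegral j (S c) (fun t => T ⟨_, hmem t⟩) ≤
      (ENNReal.ofReal K.2 ^ 2 + ENNReal.ofReal L.2 ^ 2) *
        ∑' i, (ENNReal.ofReal (ρ i))⁻¹ * ‖c i‖ₑ ^ 2 := by
    have m1 : ∀ i, Measurable ((Ioi (ρ i)).indicator
        (fun t => (ENNReal.ofReal t)⁻¹ ^ 2 * ‖c i‖ₑ ^ 2)) := fun i =>
      Measurable.indicator (by fun_prop) measurableSet_Ioi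
    have m2 : ∀ i, Measurable ((Iic (ρ i)).indicator
        (fun _ : ℝ => (ENNReal.ofReal (ρ i))⁻¹ ^ 2 * ‖c i‖ₑ ^ 2)) := fun i =>
      Measurable.indicator (by fun_prop) measurableSet_Iic
    refine (setLIntegral_mono' measurableSet_Ioi fun t ht =>
      add_le_add (hu t ht) (hv t ht)).trans ?_
    rw [lintegral_add_left ((Measurable.tsum m1).const_mul _),
      lintegral_const_mul _ (Measurable.tsum m1),
      lintegral_const_mul _ (Measurable.tsum m2),
      lintegral_tsum fun i => (m1 i).aemeasurable, lintegral_tsum fun i => (m2 i).aemeasurable,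
      add_mul]
    simp_rw [lintegral_indicator_Ioi_inv_sq (hρ _), lintegral_indicator_Iic_inv_sq (hρ _)]
    exact le_rfl
  rw [add_mul]
  refine add_le_add ((hSn c).trans ?_) hint
  rw [mul_assoc]
  refine mul_le_mul_right ?_ _
  rw [← ENNReal.tsum_mul_left]
  refine ENNReal.tsum_le_tsum fun i => ?_
  rw [← mul_assoc]
  refine le_mul_of_one_le_left (by positivity) ?_
  rw [← ENNReal.mul_inv_cancel (hρ0 i) ENNReal.ofReal_ne_top]
  gcongr
  exact hM i

/-- For any v, the coefficient c_i is an error coefficient plus ρ_i times a coefficient d_i of v(t).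
For t ≤ ρ_i this bounds ρ_i⁻² |c_i|² by 2 t⁻² |error|² + 2 |d_i|²; integration over (0, ρ_i] turns
the left side into |c_i|²/ρ_i. No measurability of v is needed. -/
theorem tsum_le_approxIntegral [Countable I] (hb : IsRieszBasisWith b K)
    (hS : ∀ c : SeqL2 I, HasSum (fun i => c i • b i) (S c)) (hρ : ∀ i, 0 < ρ i)
    (hL : IsRieszBasisInWith j (fun i => ρ i • b i) L) :
    ∃ C : ℝ≥0∞, C ≠ ⊤ ∧ ∀ (c : SeqL2 I) (v : ℝ → E),
      ∑' i, (ENNReal.ofReal (ρ i))⁻¹ * ‖c i‖ₑ ^ 2 ≤ C * approxIntegral j (S c) v := by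
  obtain ⟨e, he, hL⟩ := hL
  have inv : ∀ {k : ℝ} {x y : ℝ≥0∞}, 0 < k → ENNReal.ofReal k ^ 2 * x ≤ y →
      x ≤ (ENNReal.ofReal k ^ 2)⁻¹ * y := fun {k x y} hk h => by
    rw [mul_comm, ← div_eq_mul_inv]
    refine (ENNReal.le_div_iff_mul_le (.inl (by simpa using hk)) (.inl (by finiteness))).2 ?_
    rwa [mul_comm]
  have hSn : ∀ c : SeqL2 I, ∑' i, ‖c i‖ₑ ^ 2 ≤ (ENNReal.ofReal K.1 ^ 2)⁻¹ * ‖S c‖ₑ ^ 2 := by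
    intro c
    obtain ⟨S', hS', hK⟩ := hb.exists_synthesis
    rw [(hS c).unique (hS' c)]
    exact inv hb.pos.1 (hK c).1
  obtain ⟨T, hT, hTL⟩ := hL.exists_synthesis
  have hTn : ∀ d : SeqL2 I, ∑' i, ‖d i‖ₑ ^ 2 ≤ (ENNReal.ofReal L.1 ^ 2)⁻¹ * ‖T d‖ₑ ^ 2 :=
    fun d => inv hL.pos.1 (hTL d).1
  have hK0 : (ENNReal.ofReal K.1 ^ 2)⁻¹ ≠ ⊤ := by simpa using hb.pos.1
  have hL0 : (ENNReal.ofReal L.1 ^ 2)⁻¹ ≠ ⊤ := by simpa using hL.pos.1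
  refine ⟨2 * (ENNReal.ofReal K.1 ^ 2)⁻¹ + 2 * (ENNReal.ofReal L.1 ^ 2)⁻¹, by finiteness,
    fun c v => ?_⟩
  have m2 : ∀ i, Measurable ((Iic (ρ i)).indicator
      (fun _ : ℝ => (ENNReal.ofReal (ρ i))⁻¹ ^ 2 * ‖c i‖ₑ ^ 2)) := fun i =>
    Measurable.indicator (by fun_prop) measurableSet_Iic
  simp_rw [← lintegral_indicator_Iic_inv_sq (hρ _)]
  rw [← lintegral_tsum fun i => (m2 i).aemeasurable, approxIntegral,
    ← lintegral_const_mul' _ _ (by finiteness)]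
  refine setLIntegral_mono' measurableSet_Ioi fun t ht => ?_
  have ht' : 0 < t := ht
  set d := T.symm (v t) with hd
  have h1 : ∀ i, (Iic (ρ i)).indicator (fun _ => (ENNReal.ofReal (ρ i))⁻¹ ^ 2 * ‖c i‖ₑ ^ 2) t ≤
      2 * ((ENNReal.ofReal t)⁻¹ ^ 2 * ‖rieszCoord S i (S c - j (v t))‖ₑ ^ 2) +
        2 * ‖d i‖ₑ ^ 2 := by
    intro i
    by_cases h : t ≤ ρ i
    · rw [indicator_of_mem (show t ∈ Iic (ρ i) from h)]
      have e1 : c i = rieszCoord S i (S c - j (v t)) + ρ i * d i := by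
        rw [map_sub, rieszCoord_synthesis, ← T.apply_symm_apply (v t),
          embedding_synthesis hS he hT]
        ring
      have e2 : (ENNReal.ofReal (ρ i))⁻¹ ^ 2 * ‖ρ i * d i‖ₑ ^ 2 = ‖d i‖ₑ ^ 2 := by
        rw [← mul_pow, enorm_mul, Real.enorm_of_nonneg (hρ i).le, ← mul_assoc,
          ENNReal.inv_mul_cancel (by simpa using hρ i) ENNReal.ofReal_ne_top, one_mul]
      calc (ENNReal.ofReal (ρ i))⁻¹ ^ 2 * ‖c i‖ₑ ^ 2
          ≤ (ENNReal.ofReal (ρ i))⁻¹ ^ 2 * (2 * ‖rieszCoord S i (S c - j (v t))‖ₑ ^ 2 +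
            2 * ‖ρ i * d i‖ₑ ^ 2) := by
            gcongr
            rw [e1]
            exact enorm_add_sq_le _ _
        _ = 2 * ((ENNReal.ofReal (ρ i))⁻¹ ^ 2 * ‖rieszCoord S i (S c - j (v t))‖ₑ ^ 2) +
            2 * ((ENNReal.ofReal (ρ i))⁻¹ ^ 2 * ‖ρ i * d i‖ₑ ^ 2) := by ring
        _ ≤ _ := by
            rw [e2]
            gcongr
    · rw [indicator_of_notMem (show t ∉ Iic (ρ i) from h)]
      positivity
  calc _ ≤ ∑' i, (2 * ((ENNReal.ofReal t)⁻¹ ^ 2 * ‖rieszCoord S i (S c - j (v t))‖ₑ ^ 2) +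
        2 * ‖d i‖ₑ ^ 2) := ENNReal.tsum_le_tsum h1
    _ = 2 * ((ENNReal.ofReal t)⁻¹ ^ 2 * ∑' i, ‖rieszCoord S i (S c - j (v t))‖ₑ ^ 2) +
        2 * ∑' i, ‖d i‖ₑ ^ 2 := by
        rw [ENNReal.tsum_add, ENNReal.tsum_mul_left, ENNReal.tsum_mul_left, ENNReal.tsum_mul_left]
    _ ≤ 2 * ((ENNReal.ofReal t)⁻¹ ^ 2 * ((ENNReal.ofReal K.1 ^ 2)⁻¹ * ‖S c - j (v t)‖ₑ ^ 2)) +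
        2 * ((ENNReal.ofReal L.1 ^ 2)⁻¹ * ‖v t‖ₑ ^ 2) := by
        have e1 := hSn (S.symm (S c - j (v t)))
        have e2 := hTn d
        rw [S.apply_symm_apply] at e1
        rw [hd, T.apply_symm_apply] at e2
        simp_rw [rieszCoord_apply]
        gcongr
    _ = 2 * (ENNReal.ofReal K.1 ^ 2)⁻¹ * ((ENNReal.ofReal t)⁻¹ ^ 2 * ‖S c - j (v t)‖ₑ ^ 2) +
        2 * (ENNReal.ofReal L.1 ^ 2)⁻¹ * ‖v t‖ₑ ^ 2 := by ring
    _ ≤ (2 * (ENNReal.ofReal K.1 ^ 2)⁻¹ + 2 * (ENNReal.ofReal L.1 ^ 2)⁻¹) *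
        ((ENNReal.ofReal t)⁻¹ ^ 2 * ‖S c - j (v t)‖ₑ ^ 2) +
        (2 * (ENNReal.ofReal K.1 ^ 2)⁻¹ + 2 * (ENNReal.ofReal L.1 ^ 2)⁻¹) * ‖v t‖ₑ ^ 2 := by
        gcongr
        · exact le_self_add
        · exact le_add_self
    _ = _ := by rw [mul_add]

/-- If a rescaling by `ρ` of a Riesz basis of `F` is a Riesz basis of the subspace `E`, then its
rescaling by `ρ ^ (1 / 2)` is a Riesz basis of the space `W` whose squared norm `N` measures how
well the elements of `F` can be approximated from `E`. -/
theorem isRieszBasisIn_rescaled_half [Countable I] (hb : IsRieszBasis b) (hρ : ∀ i, 0 < ρ i)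
    (hL : IsRieszBasisIn j (rescaled ρ 1 b)) {W : Type*} [NormedAddCommGroup W] [NormedSpace ℝ W]
    {k : W →L[ℝ] F} {N : F → ℝ≥0∞} (hN : IsEnergyOf k N) {C D : ℝ≥0∞} (hC : C ≠ ⊤) (hD : D ≠ ⊤)
    (hNC : ∀ u v, N u ≤ C * (‖u‖ₑ ^ 2 + approxIntegral j u v))
    (hND : ∀ u, ∃ v, approxIntegral j u v ≤ D * N u) :
    IsRieszBasisIn k (rescaled ρ (1 / 2) b) := by
  obtain ⟨K, hK⟩ := hb.exists_bounds
  obtain ⟨L, hL⟩ := hL.exists_bounds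
  have hL : IsRieszBasisInWith j (fun i => ρ i • b i) L := by
    have : rescaled ρ 1 b = fun i => ρ i • b i := by
      funext i
      simp [rescaled]
    rwa [this] at hL
  obtain ⟨S, hS, -⟩ := hK.exists_synthesis
  obtain ⟨A, hA, hA'⟩ := exists_approx_le hK hS hρ hL
  obtain ⟨B, hB, hB'⟩ := tsum_le_approxIntegral hK hS hρ hL
  -- The weighted sum is at most B times the integral for the v of `hND`, hence at most B D N.
  -- Conversely N is at most C times the expression that the truncated expansions bound by A times
  -- the sum.
  obtain ⟨M, hM1, hM2, hM⟩ := exists_sqBounds (C := B * D) (D := C * A) (by finiteness)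
    (by finiteness)
  have hr : ∀ i, 0 < ρ i ^ (1 / 2 : ℝ) := fun i => Real.rpow_pos_of_pos (hρ i) _
  have main := IsRieszBasisInWith.of_energy hN.injective hN.enorm_sq hN.exists_of_lt_top hS
    (w := fun i => (ρ i ^ (1 / 2 : ℝ))⁻¹) (fun i => inv_pos.2 (hr i)) hM1 hM2 fun c => ?_
  · simp only [inv_inv] at main
    exact main.isRieszBasisIn
  · have hw : ∀ i, ‖(ρ i ^ (1 / 2 : ℝ))⁻¹ * c i‖ₑ ^ 2 =
        (ENNReal.ofReal (ρ i))⁻¹ * ‖c i‖ₑ ^ 2 := fun i => by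
      rw [enorm_mul, mul_pow, enorm_inv (hr i).ne', Real.enorm_of_nonneg (hr i).le,
        ← ENNReal.inv_pow, ← ENNReal.ofReal_pow (hr i).le, ← Real.sqrt_eq_rpow,
        Real.sq_sqrt (hρ i).le]
    simp_rw [hw]
    refine hM _ _ ?_ ?_
    · obtain ⟨v, hv⟩ := hND (S c)
      refine (hB' c v).trans ?_
      rw [mul_assoc]
      gcongr
    · obtain ⟨v, hv⟩ := hA' c
      refine (hNC (S c) v).trans ?_
      rw [mul_assoc]
      gcongr

end Interpolation

/-! ### Weak derivatives on the half line -/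

theorem intervalIntegrable_of_locallyIntegrable {W : ℝ → ℝ} (hW : LocallyIntegrable W) (a b : ℝ) :
    IntervalIntegrable W volume a b :=
  intervalIntegrable_iff.2
    ((hW.integrableOn_isCompact isCompact_uIcc).mono_set uIoc_subset_uIcc)

/-- Integration by parts for absolutely continuous functions on an interval (-R, R) containing the
support of φ, so that the boundary terms vanish. -/
theorem integral_primitive_mul_deriv {W : ℝ → ℝ} (hW : LocallyIntegrable W) (C : ℝ) {φ : ℝ → ℝ}
    (hφ : ContDiff ℝ 1 φ) (hc : HasCompactSupport φ) :
    ∫ x, (C + ∫ y in (0 : ℝ)..x, W y) * deriv φ x = -∫ x, W x * φ x := by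
  obtain ⟨R, hR0, hR⟩ : ∃ R, 0 < R ∧ tsupport φ ⊆ Metric.ball 0 R :=
    hc.isBounded.subset_ball_lt 0 0
  rw [Real.ball_eq_Ioo, zero_sub, zero_add] at hR
  have hint : ∀ a b, IntervalIntegrable W volume a b := intervalIntegrable_of_locallyIntegrable hW
  have h0 : ∀ x, x ∉ Ioo (-R) R → φ x = 0 := fun x hx => by
    by_contra h
    exact hx (hR (subset_tsupport _ h))
  have h1 : ∀ x, x ∉ Ioo (-R) R → deriv φ x = 0 := fun x hx => by
    by_contra h
    exact hx (hR (support_deriv_subset h))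
  have e1 : ∫ x, (C + ∫ y in (0 : ℝ)..x, W y) * deriv φ x =
      ∫ x in (-R)..R, (C + ∫ y in (0 : ℝ)..x, W y) * deriv φ x := by
    refine (intervalIntegral.integral_eq_integral_of_support_subset fun x hx => ?_).symm
    by_contra h
    exact hx (by simp [h1 x fun h' => h (Ioo_subset_Ioc_self h')])
  have e2 : ∫ x, W x * φ x = ∫ x in (-R)..R, W x * φ x := by
    refine (intervalIntegral.integral_eq_integral_of_support_subset fun x hx => ?_).symm
    by_contra h
    exact hx (by simp [h0 x fun h' => h (Ioo_subset_Ioc_self h')])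
  have hf : AbsolutelyContinuousOnInterval (fun x => C + ∫ y in (0 : ℝ)..x, W y) (-R) R := by
    have hC : AbsolutelyContinuousOnInterval (fun _ : ℝ => C) (-R) R :=
      (contDiff_const (n := 1)).contDiffOn.absolutelyContinuousOnInterval
    refine hC.add ((hint _ _).absolutelyContinuousOnInterval_intervalIntegral ?_)
    rw [uIcc_of_le (by linarith)]
    constructor <;> linarith
  have hg : AbsolutelyContinuousOnInterval φ (-R) R :=
    hφ.contDiffOn.absolutelyContinuousOnInterval
  rw [e1, e2, hf.integral_mul_deriv_eq_deriv_mul hg, h0 R (by simp), h0 (-R) (by simp)]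
  simp only [mul_zero, sub_self, zero_sub, neg_inj]
  refine intervalIntegral.integral_congr_ae ?_
  filter_upwards [_root_.LocallyIntegrable.ae_hasDerivAt_integral hW] with x hx _
  rw [((hx 0).const_add C).deriv]

theorem IsTestFun.eq_zero {φ : ℝ → ℝ} (hφ : IsTestFun φ) {x : ℝ} (hx : x ∉ Ioi (0 : ℝ)) :
    φ x = 0 := by
  by_contra h
  exact hx (hφ.2.2 (subset_tsupport _ h))

theorem IsTestFun.deriv_eq_zero {φ : ℝ → ℝ} (hφ : IsTestFun φ) {x : ℝ} (hx : x ∉ Ioi (0 : ℝ)) :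
    deriv φ x = 0 := by
  by_contra h
  exact hx (hφ.2.2 (support_deriv_subset h))

theorem IsTestFun.exists_Icc {φ : ℝ → ℝ} (hφ : IsTestFun φ) :
    ∃ a b, 0 < a ∧ a ≤ b ∧ ∀ x, x ∉ Icc a b → φ x = 0 := by
  by_cases he : (tsupport φ).Nonempty
  · have hK : IsCompact (tsupport φ) := hφ.2.1
    refine ⟨sInf (tsupport φ), sSup (tsupport φ), hφ.2.2 (hK.sInf_mem he),
      csInf_le_csSup he hK.bddBelow hK.bddAbove, fun x hx => ?_⟩
    by_contra h
    have hx' := subset_tsupport _ h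
    exact hx ⟨csInf_le hK.bddBelow hx', le_csSup hK.bddAbove hx'⟩
  · refine ⟨1, 1, one_pos, le_rfl, fun x _ => ?_⟩
    by_contra h
    exact he ⟨x, subset_tsupport _ h⟩

/-- The primitive vanishes to the left of the support trivially, and to its right because the total
integral is zero. -/
theorem IsTestFun.primitive {ψ : ℝ → ℝ} (hψ : IsTestFun ψ) (h0 : ∫ x, ψ x = 0) :
    IsTestFun (fun x => ∫ y in (0 : ℝ)..x, ψ y) ∧
      ∀ x, deriv (fun x => ∫ y in (0 : ℝ)..x, ψ y) x = ψ x := by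
  have hcont : Continuous ψ := hψ.1.continuous
  have hd : ∀ x, HasDerivAt (fun x => ∫ y in (0 : ℝ)..x, ψ y) (ψ x) x := fun x =>
    intervalIntegral.integral_hasDerivAt_right (hcont.intervalIntegrable _ _)
      (hcont.stronglyMeasurableAtFilter _ _) hcont.continuousAt
  have hderiv : deriv (fun x => ∫ y in (0 : ℝ)..x, ψ y) = ψ := funext fun x => (hd x).deriv
  obtain ⟨a, b, ha, hab, hz⟩ := hψ.exists_Icc
  have hzero : ∀ x, x ∉ Icc a b → ∫ y in (0 : ℝ)..x, ψ y = 0 := by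
    intro x hx
    rw [mem_Icc, not_and_or, not_le, not_le] at hx
    rcases hx with hx | hx
    · rw [intervalIntegral.integral_zero_ae]
      refine Filter.Eventually.of_forall fun y hy => hz y fun hy' => ?_
      have := hy.2
      have := hy'.1
      rcases le_or_gt 0 x with h | h
      · rw [max_eq_right h] at *
        linarith
      · rw [max_eq_left h.le] at *
        linarith
    · have : ∫ y in (0 : ℝ)..x, ψ y = ∫ y, ψ y := by
        refine intervalIntegral.integral_eq_integral_of_support_subset fun y hy => ?_
        by_contra h
        refine hy (hz y fun hy' => h ⟨ha.trans_le hy'.1, hy'.2.trans hx.le⟩)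
      rw [this, h0]
  have hsub : tsupport (fun x => ∫ y in (0 : ℝ)..x, ψ y) ⊆ Icc a b :=
    closure_minimal (fun x hx => by_contra fun h => hx (hzero x h)) isClosed_Icc
  refine ⟨⟨?_, ?_, hsub.trans fun x hx => ha.trans_le hx.1⟩, fun x => (hd x).deriv⟩
  · rw [contDiff_infty_iff_deriv, hderiv]
    exact ⟨fun x => (hd x).differentiableAt, hψ.1⟩
  · exact isCompact_Icc.of_isClosed_subset (isClosed_tsupport _) hsub

theorem exists_isTestFun_integral_eq_one : ∃ η : ℝ → ℝ, IsTestFun η ∧ ∫ x, η x = 1 := by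
  let f : ContDiffBump (2 : ℝ) := ⟨1 / 2, 1, by norm_num, by norm_num⟩
  refine ⟨f.normed volume, ⟨f.contDiff_normed, f.hasCompactSupport_normed, ?_⟩,
    f.integral_normed⟩
  rw [f.tsupport_normed_eq]
  intro x hx
  rw [Real.closedBall_eq_Icc] at hx
  have : (2 : ℝ) - 1 ≤ x := hx.1
  show 0 < x
  linarith

theorem IsTestFun.sub_smul {φ η : ℝ → ℝ} (hφ : IsTestFun φ) (hη : IsTestFun η) (c : ℝ) :
    IsTestFun (fun x => φ x - c * η x) := by
  have hsup : tsupport (fun x => φ x - c * η x) ⊆ tsupport φ ∪ tsupport η := by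
    refine closure_minimal (fun x hx => ?_) ((isClosed_tsupport _).union (isClosed_tsupport _))
    by_contra h
    rw [mem_union, not_or] at h
    exact hx (by simp [image_eq_zero_of_notMem_tsupport h.1, image_eq_zero_of_notMem_tsupport h.2])
  refine ⟨hφ.1.sub (contDiff_const.mul hη.1), ?_, hsup.trans (union_subset hφ.2.2 hη.2.2)⟩
  have h1 : IsCompact (tsupport φ) := hφ.2.1
  exact (h1.union hη.2.1).of_isClosed_subset (isClosed_tsupport _) hsup

/-- A function on the half line whose weak derivative vanishes is constant. -/
theorem exists_ae_eq_const_of_integral_mul_deriv_eq_zero {f : ℝ → ℝ}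
    (hf : LocallyIntegrable f halfLine)
    (h : ∀ φ, IsTestFun φ → ∫ x, f x * deriv φ x ∂halfLine = 0) :
    ∃ C : ℝ, ∀ᵐ x ∂halfLine, f x = C := by
  obtain ⟨η, hη, hη1⟩ := exists_isTestFun_integral_eq_one
  have hint : ∀ φ, IsTestFun φ → Integrable (fun x => f x * φ x) halfLine := fun φ hφ => by
    have := hf.integrable_smul_left_of_hasCompactSupport hφ.1.continuous hφ.2.1
    simpa only [smul_eq_mul, mul_comm] using this
  have hints : ∀ φ, IsTestFun φ → Integrable φ volume := fun φ hφ =>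
    hφ.1.continuous.integrable_of_hasCompactSupport hφ.2.1
  refine ⟨∫ x, f x * η x ∂halfLine, ?_⟩
  set C := ∫ x, f x * η x ∂halfLine with hC
  have hloc : LocallyIntegrableOn (fun x => f x - C) (Ioi 0) halfLine :=
    (hf.sub (locallyIntegrable_const C)).locallyIntegrableOn _
  have main := isOpen_Ioi.ae_eq_zero_of_integral_contDiff_smul_eq_zero hloc ?_
  · filter_upwards [main, ae_restrict_mem measurableSet_Ioi] with x hx hx'
    linarith [hx hx']
  · intro g hg1 hg2 hg3
    have hg : IsTestFun g := ⟨hg1, hg2, hg3⟩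
    -- Subtracting a multiple of η makes the mean zero, so the difference is the derivative of a
    -- test function and is annihilated by f. This leaves ∫ f g = C ∫ g.
    have hψ := hg.sub_smul hη (∫ x, g x)
    have hψ0 : ∫ x, (g x - (∫ x, g x) * η x) = 0 := by
      rw [integral_sub (hints g hg) ((hints η hη).const_mul _), integral_const_mul, hη1]
      ring
    obtain ⟨hΦ, hd⟩ := hψ.primitive hψ0
    have h1 := h _ hΦ
    simp_rw [hd] at h1
    have e1 : ∀ x, f x * (g x - (∫ x, g x) * η x) = f x * g x - (∫ x, g x) * (f x * η x) :=
      fun x => by ring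
    simp_rw [e1] at h1
    rw [integral_sub (hint g hg) ((hint η hη).const_mul _), integral_const_mul, ← hC] at h1
    have e2 : ∀ x, g x • (f x - C) = f x * g x - C * g x := fun x => by
      rw [smul_eq_mul]; ring
    simp_rw [e2]
    have e3 : ∫ x, g x ∂halfLine = ∫ x, g x :=
      setIntegral_eq_integral_of_forall_compl_eq_zero fun x hx => hg.eq_zero hx
    rw [integral_sub (hint g hg) ((hints g hg).restrict.const_mul _), integral_const_mul, e3]
    linarith

/-- The extension by zero of a function on the half line. -/
noncomputable def extZero (u : ℝ → ℝ) : ℝ → ℝ := (Ioi 0).indicator u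

theorem extZero_of_pos (u : ℝ → ℝ) {x : ℝ} (hx : 0 < x) : extZero u x = u x :=
  indicator_of_mem (show x ∈ Ioi (0 : ℝ) from hx) u

theorem extZero_of_nonpos (u : ℝ → ℝ) {x : ℝ} (hx : x ≤ 0) : extZero u x = 0 :=
  indicator_of_notMem (show x ∉ Ioi (0 : ℝ) from not_lt.2 hx) u

theorem memLp_extZero (u : L2Half ℝ) : MemLp (extZero u) 2 volume :=
  (memLp_indicator_iff_restrict measurableSet_Ioi).2 (Lp.memLp u)

theorem locallyIntegrable_extZero (u : L2Half ℝ) : LocallyIntegrable (extZero u) :=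
  (memLp_extZero u).locallyIntegrable (by norm_num)

theorem integral_halfLine_mul_testFun {f φ : ℝ → ℝ} (hφ : ∀ x ∉ Ioi (0 : ℝ), φ x = 0) :
    ∫ x, f x * φ x ∂halfLine = ∫ x, f x * φ x :=
  setIntegral_eq_integral_of_forall_compl_eq_zero fun x hx => by rw [hφ x hx, mul_zero]

theorem integral_extZero_mul_testFun (u : ℝ → ℝ) {φ : ℝ → ℝ} (hφ : IsTestFun φ) :
    ∫ x, u x * φ x ∂halfLine = ∫ x, extZero u x * φ x := by
  rw [← integral_halfLine_mul_testFun fun x hx => hφ.eq_zero hx]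
  refine setIntegral_congr_fun measurableSet_Ioi fun x hx => ?_
  simp only [extZero_of_pos u hx]

theorem continuous_primitive (w : L2Half ℝ) :
    Continuous fun x => ∫ y in (0 : ℝ)..x, extZero w y :=
  intervalIntegral.continuous_primitive
    (intervalIntegrable_of_locallyIntegrable (locallyIntegrable_extZero w)) 0

/-- The difference between u and the primitive of its weak derivative has weak derivative zero,
hence is constant. The primitive form is what the shift estimates use. -/
theorem mem_H1Half_iff (p : WithLp 2 (L2Half ℝ × L2Half ℝ)) :
    p ∈ H1Half ↔ ∃ C : ℝ, ∀ᵐ x ∂halfLine, p.fst x = C + ∫ y in (0 : ℝ)..x, extZero p.snd y := by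
  have hloc := locallyIntegrable_extZero p.snd
  have hP := continuous_primitive p.snd
  constructor
  · intro hp
    have hL : LocallyIntegrable (fun x => p.fst x - ∫ y in (0 : ℝ)..x, extZero p.snd y) halfLine :=
      ((Lp.memLp p.fst).locallyIntegrable (by norm_num)).sub
        (hP.locallyIntegrable (μ := halfLine))
    obtain ⟨C, hC⟩ := exists_ae_eq_const_of_integral_mul_deriv_eq_zero hL fun φ hφ => by
      have h1 := hp φ hφ
      have h2 := integral_primitive_mul_deriv hloc 0 (hφ.1.of_le (by simp)) hφ.2.1
      simp_rw [zero_add] at h2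
      rw [← integral_halfLine_mul_testFun fun x hx => hφ.deriv_eq_zero hx,
        ← integral_extZero_mul_testFun _ hφ] at h2
      have hd : Continuous (deriv φ) := hφ.1.continuous_deriv (by simp)
      have i1 := p.fst.integrable_mul_of_continuous hd hφ.2.1.deriv
      have i2 : Integrable (fun x => (∫ y in (0 : ℝ)..x, extZero p.snd y) * deriv φ x) halfLine :=
        ((hP.mul hd).integrable_of_hasCompactSupport hφ.2.1.deriv.mul_left).restrict
      simp_rw [sub_mul]
      rw [integral_sub i1 i2, h1, h2, sub_self]
    refine ⟨C, ?_⟩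
    filter_upwards [hC] with x hx
    linarith
  · rintro ⟨C, hC⟩ φ hφ
    have h2 := integral_primitive_mul_deriv hloc C (hφ.1.of_le (by simp)) hφ.2.1
    rw [integral_extZero_mul_testFun _ hφ, ← h2,
      ← integral_halfLine_mul_testFun fun x hx => hφ.deriv_eq_zero hx]
    refine integral_congr_ae ?_
    filter_upwards [hC] with x hx
    rw [hx]

theorem mem_H1HalfZero_iff (p : WithLp 2 (L2Half ℝ × L2Half ℝ)) :
    p ∈ H1HalfZero ↔ ∀ᵐ x ∂halfLine, p.fst x = ∫ y in (0 : ℝ)..x, extZero p.snd y := by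
  have hP := continuous_primitive p.snd
  constructor
  · rintro ⟨hp, g, hg, hg0, hpg⟩
    obtain ⟨C, hC⟩ := (mem_H1Half_iff p).1 hp
    have hae : g =ᵐ[volume.restrict (Ioi 0)] fun x => C + ∫ y in (0 : ℝ)..x, extZero p.snd y := by
      filter_upwards [hpg, hC] with x h1 h2
      rw [← h1, h2]
    have heq : EqOn g (fun x => C + ∫ y in (0 : ℝ)..x, extZero p.snd y) (Ioi 0) :=
      Measure.eqOn_open_of_ae_eq hae isOpen_Ioi (hg.mono Ioi_subset_Ici_self)
        (continuous_const.add hP).continuousOn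
    -- Continuity carries the equality to the endpoint 0, where it reads C = g 0 = 0.
    have heq' : EqOn g (fun x => C + ∫ y in (0 : ℝ)..x, extZero p.snd y) (Ici 0) :=
      heq.of_subset_closure hg (continuous_const.add hP).continuousOn Ioi_subset_Ici_self
        (by rw [closure_Ioi])
    have hC0 : C = 0 := by
      have := heq' (show (0 : ℝ) ∈ Ici 0 from self_mem_Ici)
      simpa [hg0] using this.symm
    simpa [hC0] using hC
  · intro h
    refine ⟨(mem_H1Half_iff p).2 ⟨0, by simpa using h⟩, _, hP.continuousOn, ?_, h⟩
    simp

/-! ### Moduli of continuity in the mean -/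

theorem lintegral_sq_le {α : Type*} [MeasurableSpace α] (μ : Measure α) {f : α → ℝ≥0∞}
    (hf : AEMeasurable f μ) : (∫⁻ x, f x ∂μ) ^ 2 ≤ μ univ * ∫⁻ x, f x ^ 2 ∂μ := by
  have h := ENNReal.lintegral_mul_le_Lp_mul_Lq μ Real.HolderConjugate.two_two
    (aemeasurable_const (b := (1 : ℝ≥0∞))) hf
  simp only [Pi.mul_apply, one_mul, ENNReal.rpow_two] at h
  refine (pow_le_pow_left' h 2).trans ?_
  have key : ∀ x : ℝ≥0∞, (x ^ (1 / 2 : ℝ)) ^ 2 = x := fun x => by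
    rw [← ENNReal.rpow_natCast, ← ENNReal.rpow_mul]
    norm_num
  rw [mul_pow, key, key]
  simp

theorem enorm_intervalIntegral_sq_le {f : ℝ → ℝ} (hf : Measurable f) {h : ℝ} (hh : 0 ≤ h) :
    ‖∫ r in (0 : ℝ)..h, f r‖ₑ ^ 2 ≤ ENNReal.ofReal h * ∫⁻ r in Ioc 0 h, ‖f r‖ₑ ^ 2 := by
  rw [intervalIntegral.integral_of_le hh]
  refine (pow_le_pow_left' (enorm_integral_le_lintegral_enorm _) 2).trans ?_
  refine (lintegral_sq_le _ hf.enorm.aemeasurable).trans ?_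
  simp

theorem enorm_sub_sq_le {E : Type*} [NormedAddCommGroup E] (x y : E) :
    ‖x - y‖ₑ ^ 2 ≤ 2 * ‖x‖ₑ ^ 2 + 2 * ‖y‖ₑ ^ 2 := by
  have := enorm_add_sq_le x (-y)
  rwa [enorm_neg, ← sub_eq_add_neg] at this

/-- The squared `L²`-modulus `∫ |U(s + a) - U(s)|² ds` over the half line. -/
noncomputable def shiftSq (a : ℝ) (U : ℝ → ℝ) : ℝ≥0∞ :=
  ∫⁻ s in Ioi 0, ‖U (s + a) - U s‖ₑ ^ 2

@[fun_prop]
theorem measurable_extZero {f : ℝ → ℝ} (hf : Measurable f) : Measurable (extZero f) :=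
  hf.indicator measurableSet_Ioi

theorem measurable_coe_L2Half (u : L2Half ℝ) : Measurable u := (Lp.stronglyMeasurable u).measurable

@[fun_prop]
theorem measurable_shiftSq {U : ℝ → ℝ} (hU : Measurable U) {f : ℝ → ℝ} (hf : Measurable f) :
    Measurable fun h => shiftSq (f h) U := by
  unfold shiftSq
  refine Measurable.lintegral_prod_right' (f := fun z : ℝ × ℝ => ‖U (z.2 + f z.1) - U z.2‖ₑ ^ 2) ?_
  fun_prop

theorem lintegral_extZero (f : ℝ → ℝ) :
    ∫⁻ x, ‖extZero f x‖ₑ ^ 2 = ∫⁻ x, ‖f x‖ₑ ^ 2 ∂halfLine := by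
  rw [← lintegral_indicator measurableSet_Ioi]
  refine lintegral_congr fun x => ?_
  by_cases hx : 0 < x
  · rw [extZero_of_pos f hx, indicator_of_mem (show x ∈ Ioi (0 : ℝ) from hx)]
  · rw [extZero_of_nonpos f (not_lt.1 hx),
      indicator_of_notMem (show x ∉ Ioi (0 : ℝ) from hx)]
    simp

theorem shiftSq_extZero_le {f : ℝ → ℝ} (hf : Measurable f) (a : ℝ) :
    shiftSq a (extZero f) ≤ 4 * ∫⁻ x, ‖f x‖ₑ ^ 2 ∂halfLine := by
  have hm : Measurable (extZero f) := measurable_extZero hf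
  calc shiftSq a (extZero f)
      ≤ ∫⁻ s, (2 * ‖extZero f (s + a)‖ₑ ^ 2 + 2 * ‖extZero f s‖ₑ ^ 2) :=
        (setLIntegral_le_lintegral _ _).trans (lintegral_mono fun s => enorm_sub_sq_le _ _)
    _ = _ := by
        rw [lintegral_add_left (by fun_prop), lintegral_const_mul _ (by fun_prop),
          lintegral_const_mul _ (by fun_prop),
          lintegral_add_right_eq_self (fun s => ‖extZero f s‖ₑ ^ 2) a, lintegral_extZero, ← add_mul]
        norm_num

theorem shiftSq_le_add {f g : ℝ → ℝ} (hf : Measurable f) (hg : Measurable g) (a : ℝ) :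
    shiftSq a (extZero f) ≤ 8 * ∫⁻ x, ‖f x - g x‖ₑ ^ 2 ∂halfLine + 2 * shiftSq a (extZero g) := by
  have h1 : Measurable (extZero g) := measurable_extZero hg
  have h2 : Measurable (extZero fun x => f x - g x) := measurable_extZero (hf.sub hg)
  have hadd : ∀ x, extZero f x = extZero (fun x => f x - g x) x + extZero g x := fun x => by
    by_cases hx : 0 < x
    · simp [extZero_of_pos _ hx]
    · simp [extZero_of_nonpos _ (not_lt.1 hx)]
  calc shiftSq a (extZero f)
      ≤ ∫⁻ s in Ioi 0, (2 * ‖extZero (fun x => f x - g x) (s + a) -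
          extZero (fun x => f x - g x) s‖ₑ ^ 2 + 2 * ‖extZero g (s + a) - extZero g s‖ₑ ^ 2) := by
        refine lintegral_mono fun s => ?_
        rw [hadd, hadd s, add_sub_add_comm]
        exact enorm_add_sq_le _ _
    _ = 2 * shiftSq a (extZero fun x => f x - g x) + 2 * shiftSq a (extZero g) := by
        rw [lintegral_add_left (by fun_prop), lintegral_const_mul _ (by fun_prop),
          lintegral_const_mul _ (by fun_prop)]
        rfl
    _ ≤ 2 * (4 * ∫⁻ x, ‖f x - g x‖ₑ ^ 2 ∂halfLine) + 2 * shiftSq a (extZero g) := by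
        gcongr
        exact shiftSq_extZero_le (hf.sub hg) a
    _ = _ := by ring

theorem measurePreserving_add_sign_mul {τ : ℝ} (hτ : τ = 1 ∨ τ = -1) (s : ℝ) :
    MeasurePreserving (fun r => s + τ * r) volume volume := by
  rcases hτ with rfl | rfl
  · simpa using measurePreserving_add_left volume s
  · simpa [sub_eq_add_neg] using Measure.measurePreserving_sub_left volume s

/-- The integral of `W` over a moving window of length `h`, as an integral over `[0, h]`. -/
theorem integral_window (τ : ℝ) (W : ℝ → ℝ) (s h : ℝ) :
    ∫ y in s..s + τ * h, W y = τ * ∫ r in (0 : ℝ)..h, W (s + τ * r) := by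
  have := intervalIntegral.smul_integral_comp_add_mul W (a := 0) (b := h) τ s
  simp only [smul_eq_mul, mul_zero, add_zero] at this
  rw [this]

theorem enorm_sign {τ : ℝ} (hτ : τ = 1 ∨ τ = -1) : ‖τ‖ₑ = 1 := by
  rcases hτ with rfl | rfl <;> simp

/-- Cauchy–Schwarz on the window gives one factor h; after Tonelli and translation invariance, the
length of the window gives the second. -/
theorem shiftSq_le_of_primitive {τ : ℝ} (hτ : τ = 1 ∨ τ = -1) {h : ℝ} (hh : 0 ≤ h) {U W : ℝ → ℝ}
    (hW : Measurable W)
    (hUW : ∀ᵐ s, 0 < s → U (s + τ * h) - U s = ∫ y in s..s + τ * h, W y) :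
    shiftSq (τ * h) U ≤ ENNReal.ofReal h ^ 2 * ∫⁻ x, ‖W x‖ₑ ^ 2 := by
  calc shiftSq (τ * h) U
      ≤ ∫⁻ s in Ioi 0, ENNReal.ofReal h * ∫⁻ r in Ioc 0 h, ‖W (s + τ * r)‖ₑ ^ 2 := by
        refine lintegral_mono_ae ?_
        rw [ae_restrict_iff' measurableSet_Ioi]
        filter_upwards [hUW] with s hs hs0
        rw [hs hs0, integral_window, enorm_mul, enorm_sign hτ, one_mul]
        exact enorm_intervalIntegral_sq_le (by fun_prop) hh
    _ ≤ ∫⁻ s, ENNReal.ofReal h * ∫⁻ r in Ioc 0 h, ‖W (s + τ * r)‖ₑ ^ 2 :=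
        setLIntegral_le_lintegral _ _
    _ = ENNReal.ofReal h * ∫⁻ r in Ioc 0 h, ∫⁻ s, ‖W (s + τ * r)‖ₑ ^ 2 := by
        rw [lintegral_const_mul' _ _ (by finiteness), lintegral_lintegral_swap]
        exact (by fun_prop : Measurable fun z : ℝ × ℝ => ‖W (z.1 + τ * z.2)‖ₑ ^ 2).aemeasurable
    _ = _ := by
        simp_rw [lintegral_add_right_eq_self (fun s => ‖W s‖ₑ ^ 2)]
        rw [setLIntegral_const, Real.volume_Ioc, sub_zero]
        ring

/-! ### Averages -/

/-- The mean value of `U` over the window between `s` and `s + a`. -/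
noncomputable def windowMean (a : ℝ) (U : ℝ → ℝ) (s : ℝ) : ℝ := a⁻¹ * ∫ y in s..s + a, U y

theorem windowMean_eq {τ : ℝ} (hτ : τ = 1 ∨ τ = -1) (h : ℝ) (U : ℝ → ℝ) (s : ℝ) :
    windowMean (τ * h) U s = h⁻¹ * ∫ r in (0 : ℝ)..h, U (s + τ * r) := by
  have hτ0 : τ ≠ 0 := by rcases hτ with rfl | rfl <;> norm_num
  rw [windowMean, integral_window, mul_inv]
  field_simp

/-- The error is, up to sign, the average over r in (0, h] of U(s + τ r) - U(s); Cauchy–Schwarz and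
Tonelli finish. -/
theorem lintegral_sub_windowMean_le {τ : ℝ} (hτ : τ = 1 ∨ τ = -1) {h : ℝ} (hh : 0 < h)
    {U : ℝ → ℝ} (hU : Measurable U) (hU2 : MemLp U 2 volume) :
    ∫⁻ s in Ioi 0, ‖U s - windowMean (τ * h) U s‖ₑ ^ 2 ≤
      (ENNReal.ofReal h)⁻¹ * ∫⁻ r in Ioc 0 h, shiftSq (τ * r) U := by
  have hpt : ∀ s, ‖U s - windowMean (τ * h) U s‖ₑ ^ 2 ≤
      (ENNReal.ofReal h)⁻¹ * ∫⁻ r in Ioc 0 h, ‖U (s + τ * r) - U s‖ₑ ^ 2 := fun s => by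
    have hint : IntervalIntegrable (fun r => U (s + τ * r)) volume 0 h :=
      intervalIntegrable_of_locallyIntegrable
        ((hU2.comp_measurePreserving (measurePreserving_add_sign_mul hτ s)).locallyIntegrable
          (by norm_num)) _ _
    have e : U s - windowMean (τ * h) U s =
        -(h⁻¹ * ∫ r in (0 : ℝ)..h, (U (s + τ * r) - U s)) := by
      rw [windowMean_eq hτ, intervalIntegral.integral_sub hint intervalIntegrable_const,
        intervalIntegral.integral_const, sub_zero, smul_eq_mul]
      field_simp
      ring
    rw [e, enorm_neg, enorm_mul, mul_pow, enorm_inv hh.ne', Real.enorm_of_nonneg hh.le]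
    refine (mul_le_mul_right (enorm_intervalIntegral_sq_le (by fun_prop) hh.le) _).trans
      (le_of_eq ?_)
    rw [← mul_assoc, sq, mul_assoc _ _ (ENNReal.ofReal h),
      ENNReal.inv_mul_cancel (by simpa using hh) ENNReal.ofReal_ne_top, mul_one]
  refine (lintegral_mono hpt).trans (le_of_eq ?_)
  rw [lintegral_const_mul' _ _ (by simpa using hh), lintegral_lintegral_swap]
  · rfl
  · exact (by fun_prop : Measurable fun z : ℝ × ℝ =>
      ‖U (z.1 + τ * z.2) - U z.1‖ₑ ^ 2).aemeasurable

/-- A window mean of a square integrable function is, up to an additive constant, the primitive of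
the corresponding difference quotient. -/
theorem windowMean_eq_primitive (u : L2Half ℝ) {a : ℝ} {s : ℝ} (hs : 0 ≤ s) :
    windowMean a (extZero u) s = windowMean a (extZero u) 0 +
      ∫ y in (0 : ℝ)..s, extZero (fun y => a⁻¹ * (extZero u (y + a) - extZero u y)) y := by
  have hloc := locallyIntegrable_extZero u
  have hi := intervalIntegrable_of_locallyIntegrable hloc
  have hi' : IntervalIntegrable (fun y => extZero u (y + a)) volume 0 s :=
    intervalIntegrable_of_locallyIntegrable
      (((memLp_extZero u).comp_measurePreserving
        (measurePreserving_add_right volume a)).locallyIntegrable (by norm_num)) _ _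
  have e1 : ∫ y in (0 : ℝ)..s, extZero (fun y => a⁻¹ * (extZero u (y + a) - extZero u y)) y =
      ∫ y in (0 : ℝ)..s, a⁻¹ * (extZero u (y + a) - extZero u y) := by
    refine intervalIntegral.integral_congr_ae (Filter.Eventually.of_forall fun y hy => ?_)
    rw [uIoc_of_le hs] at hy
    exact extZero_of_pos _ hy.1
  rw [e1, intervalIntegral.integral_const_mul, intervalIntegral.integral_sub hi' (hi _ _),
    intervalIntegral.integral_comp_add_right, windowMean, windowMean, zero_add, ← mul_add]
  congr 1
  have h1 := intervalIntegral.integral_add_adjacent_intervals (hi 0 a) (hi a (s + a))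
  have h2 := intervalIntegral.integral_add_adjacent_intervals (hi 0 s) (hi s (s + a))
  linarith

/-- The window at 0 lies where the extension vanishes. This gives backward means their zero trace.
-/
theorem windowMean_zero_of_neg (u : ℝ → ℝ) {a : ℝ} (ha : a ≤ 0) :
    windowMean a (extZero u) 0 = 0 := by
  rw [windowMean, zero_add, intervalIntegral.integral_zero_ae, mul_zero]
  refine Filter.Eventually.of_forall fun y hy => extZero_of_nonpos _ ?_
  rw [uIoc_of_ge ha] at hy
  exact hy.2

/-! ### The seminorm of order one half as an integral of moduli of continuity -/

/-- The integral `∫ h⁻² ‖U(· + τ h) - U‖² dh` over `h > 0`, where `U` is the extension by zero of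
`u` and the norm is taken over the half line. -/
noncomputable def fracEnergy (τ : ℝ) (u : ℝ → ℝ) : ℝ≥0∞ :=
  ∫⁻ h in Ioi 0, (ENNReal.ofReal h)⁻¹ ^ 2 * shiftSq (τ * h) (extZero u)

theorem lintegral_eq_two_mul_of_even {g : ℝ → ℝ≥0∞} (hg : ∀ h, g (-h) = g h) :
    ∫⁻ h, g h = 2 * ∫⁻ h in Ioi 0, g h := by
  have h1 : ∫⁻ h in Iic 0, g h = ∫⁻ h in Ioi 0, g h := by
    rw [← restrict_Iio_eq_restrict_Iic, ← lintegral_indicator measurableSet_Iio,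
      ← lintegral_indicator measurableSet_Ioi, ← lintegral_neg_eq_self]
    refine lintegral_congr fun h => ?_
    by_cases hh : 0 < h
    · rw [indicator_of_mem (show h ∈ Ioi (0 : ℝ) from hh),
        indicator_of_mem (show -h ∈ Iio (0 : ℝ) from neg_lt_zero.2 hh), hg]
    · rw [indicator_of_notMem (show h ∉ Ioi (0 : ℝ) from hh),
        indicator_of_notMem (show -h ∉ Iio (0 : ℝ) from fun h' => hh (neg_lt_zero.1 h'))]
  rw [← lintegral_add_compl g (measurableSet_Ioi (a := (0 : ℝ))), compl_Ioi, h1, two_mul]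

theorem lintegral_slopeKernel {u : ℝ → ℝ} (hu : Measurable u) :
    ∫⁻ z, slopeKernel z * ‖u z.1 - u z.2‖ₑ ^ 2 ∂(halfLine.prod halfLine) =
      2 * fracEnergy 1 u := by
  -- Extended by zero to the plane, the integrand admits the substitution y = x + h on whole lines.
  -- Its symmetry makes the inner integral even in h, hence the factor 2.
  let G : ℝ × ℝ → ℝ≥0∞ := (Ioi 0 ×ˢ Ioi 0).indicator fun z => slopeKernel z * ‖u z.1 - u z.2‖ₑ ^ 2
  have hK := measurable_slopeKernel
  have hG : Measurable G := Measurable.indicator (by fun_prop)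
    (measurableSet_Ioi.prod measurableSet_Ioi)
  have hG1 : ∀ x y, 0 < x ∧ 0 < y → G (x, y) = slopeKernel (x, y) * ‖u x - u y‖ₑ ^ 2 :=
    fun x y h => indicator_of_mem (show (x, y) ∈ Ioi (0 : ℝ) ×ˢ Ioi (0 : ℝ) from h) _
  have hG0 : ∀ x y, ¬(0 < x ∧ 0 < y) → G (x, y) = 0 :=
    fun x y h => indicator_of_notMem (show (x, y) ∉ Ioi (0 : ℝ) ×ˢ Ioi (0 : ℝ) from h) _
  have hsymm : ∀ x y, G (x, y) = G (y, x) := fun x y => by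
    have e : slopeKernel (x, y) = slopeKernel (y, x) := by
      simp only [slopeKernel]
      rw [← neg_sub y x, inv_neg, enorm_neg]
    by_cases h : 0 < x ∧ 0 < y
    · rw [hG1 x y h, hG1 y x h.symm, e, ← neg_sub, enorm_neg]
    · rw [hG0 x y h, hG0 y x fun h' => h h'.symm]
  have e1 : ∫⁻ z, slopeKernel z * ‖u z.1 - u z.2‖ₑ ^ 2 ∂(halfLine.prod halfLine) =
      ∫⁻ h, ∫⁻ x, G (x, x + h) := by
    rw [Measure.prod_restrict, ← lintegral_indicator (measurableSet_Ioi.prod measurableSet_Ioi),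
      lintegral_lintegral_swap, ← Measure.volume_eq_prod]
    · rw [Measure.volume_eq_prod, lintegral_prod _ hG.aemeasurable]
      refine lintegral_congr fun x => ?_
      rw [lintegral_add_left_eq_self (fun y => G (x, y)) x]
    · exact (by fun_prop : Measurable fun z : ℝ × ℝ => G (z.2, z.2 + z.1)).aemeasurable
  rw [e1, lintegral_eq_two_mul_of_even]
  · congr 1
    refine setLIntegral_congr_fun measurableSet_Ioi fun h hh => ?_
    have hh' : 0 < h := hh
    rw [shiftSq, ← lintegral_const_mul' _ _ (by simpa using hh'),
      ← lintegral_indicator measurableSet_Ioi]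
    refine lintegral_congr fun x => ?_
    by_cases hx : 0 < x
    · have hxh : 0 < x + h := add_pos hx hh'
      rw [indicator_of_mem (show x ∈ Ioi (0 : ℝ) from hx), one_mul, extZero_of_pos _ hx,
        extZero_of_pos _ hxh, hG1 x (x + h) ⟨hx, hxh⟩]
      simp only [slopeKernel]
      rw [sub_add_cancel_left, inv_neg, enorm_neg, enorm_inv hh'.ne', Real.enorm_of_nonneg hh'.le,
        ← neg_sub, enorm_neg]
    · rw [indicator_of_notMem (show x ∉ Ioi (0 : ℝ) from hx)]
      exact hG0 x (x + h) fun h' => hx h'.1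
  · intro h
    rw [← lintegral_add_right_eq_self _ h]
    refine lintegral_congr fun x => ?_
    rw [hsymm, add_neg_cancel_right]

/-- For s > h the backward difference is a translated forward one; for s ≤ h the point s - h lies in
the zero extension, so |u(s)|² remains. -/
theorem shiftSq_neg {u : ℝ → ℝ} (hu : Measurable u) {h : ℝ} (hh : 0 < h) :
    shiftSq (-h) (extZero u) = shiftSq h (extZero u) + ∫⁻ s in Ioc 0 h, ‖u s‖ₑ ^ 2 := by
  have hm : Measurable (extZero u) := measurable_extZero hu
  have hU : Ioi (0 : ℝ) = Ioc 0 h ∪ Ioi h := (Ioc_union_Ioi_eq_Ioi hh.le).symm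
  have hd : Disjoint (Ioc 0 h) (Ioi h) := disjoint_left.2 fun x hx hx' => not_lt.2 hx.2 hx'
  rw [shiftSq, hU, lintegral_union measurableSet_Ioi hd, add_comm]
  congr 1
  · rw [shiftSq, ← lintegral_indicator measurableSet_Ioi, ← lintegral_indicator measurableSet_Ioi,
      ← lintegral_add_right_eq_self _ h]
    refine lintegral_congr fun s => ?_
    by_cases hs : 0 < s
    · rw [indicator_of_mem (show s ∈ Ioi (0 : ℝ) from hs),
        indicator_of_mem (show s + h ∈ Ioi h from lt_add_of_pos_left _ hs), add_neg_cancel_right,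
        ← neg_sub, enorm_neg]
    · rw [indicator_of_notMem (show s ∉ Ioi (0 : ℝ) from hs),
        indicator_of_notMem (show s + h ∉ Ioi h from fun h' => hs (pos_of_lt_add_left h'))]
  · refine setLIntegral_congr_fun measurableSet_Ioc fun s hs => ?_
    rw [extZero_of_pos _ hs.1, extZero_of_nonpos u (by linarith [hs.2]), zero_sub, enorm_neg]

/-- Tonelli with ∫_s^∞ h⁻² dh = 1/s. Applied to |u|² it creates the Hardy term. -/
theorem lintegral_inv_sq_mul_lintegral_Ioc {F : ℝ → ℝ≥0∞} (hF : Measurable F) :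
    ∫⁻ h in Ioi 0, (ENNReal.ofReal h)⁻¹ ^ 2 * ∫⁻ s in Ioc 0 h, F s =
      ∫⁻ s in Ioi 0, (ENNReal.ofReal s)⁻¹ * F s := by
  have e1 : ∀ h ∈ Ioi (0 : ℝ), (ENNReal.ofReal h)⁻¹ ^ 2 * ∫⁻ s in Ioc 0 h, F s =
      ∫⁻ s in Ioi 0, {z : ℝ × ℝ | z.2 ≤ z.1}.indicator
        (fun z => (ENNReal.ofReal z.1)⁻¹ ^ 2 * F z.2) (h, s) := fun h hh => by
    have hh' : 0 < h := hh
    rw [← lintegral_const_mul' _ _ (by simpa using hh'), ← Ioi_inter_Iic, inter_comm,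
      ← setLIntegral_indicator measurableSet_Iic]
    rfl
  have e2 : ∀ s ∈ Ioi (0 : ℝ), (ENNReal.ofReal s)⁻¹ * F s =
      ∫⁻ h in Ioi 0, {z : ℝ × ℝ | z.2 ≤ z.1}.indicator
        (fun z => (ENNReal.ofReal z.1)⁻¹ ^ 2 * F z.2) (h, s) := fun s hs => by
    have hs' : 0 < s := hs
    have : ∀ h, {z : ℝ × ℝ | z.2 ≤ z.1}.indicator
        (fun z => (ENNReal.ofReal z.1)⁻¹ ^ 2 * F z.2) (h, s) =
        (Ici s).indicator (fun h => (ENNReal.ofReal h)⁻¹ ^ 2 * F s) h := fun h => rfl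
    simp_rw [this]
    rw [setLIntegral_indicator measurableSet_Ici, inter_eq_left.2 (Ici_subset_Ioi.2 hs'),
      ← restrict_Ioi_eq_restrict_Ici, lintegral_mul_const _ (by fun_prop),
      lintegral_Ioi_inv_sq hs']
  rw [setLIntegral_congr_fun measurableSet_Ioi e1, setLIntegral_congr_fun measurableSet_Ioi e2,
    lintegral_lintegral_swap]
  refine Measurable.aemeasurable (Measurable.indicator (by fun_prop) ?_)
  exact measurableSet_le measurable_snd measurable_fst

theorem fracEnergy_neg_one {u : ℝ → ℝ} (hu : Measurable u) :
    fracEnergy (-1) u =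
      fracEnergy 1 u + ∫⁻ s, ‖s ^ (-1 / 2 : ℝ)‖ₑ ^ 2 * ‖u s‖ₑ ^ 2 ∂halfLine := by
  have hm : Measurable (extZero u) := measurable_extZero hu
  have e1 : fracEnergy (-1) u = ∫⁻ h in Ioi 0, ((ENNReal.ofReal h)⁻¹ ^ 2 *
      shiftSq (1 * h) (extZero u) + (ENNReal.ofReal h)⁻¹ ^ 2 * ∫⁻ s in Ioc 0 h, ‖u s‖ₑ ^ 2) := by
    refine setLIntegral_congr_fun measurableSet_Ioi fun h hh => ?_
    rw [neg_one_mul, one_mul, shiftSq_neg hu hh, mul_add]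
  rw [e1, lintegral_add_left (by fun_prop), lintegral_inv_sq_mul_lintegral_Ioc (by fun_prop)]
  congr 1
  refine setLIntegral_congr_fun measurableSet_Ioi fun s hs => ?_
  have hs' : 0 < s := hs
  congr 1
  rw [Real.enorm_of_nonneg (by positivity), ← ENNReal.ofReal_pow (by positivity),
    ← ENNReal.ofReal_inv_of_pos hs']
  congr 1
  rw [← Real.rpow_natCast, ← Real.rpow_mul hs'.le]
  norm_num [Real.rpow_neg_one]

theorem energy_one_slopeKernel (u : L2Half ℝ) :
    energy 1 slopeKernel u = ‖u‖ₑ ^ 2 + 2 * fracEnergy 1 u := by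
  rw [energy, lintegral_slopeKernel (measurable_coe_L2Half u), Lp.enorm_sq]
  simp

theorem energy_hardyWeight_slopeKernel (u : L2Half ℝ) :
    energy hardyWeight slopeKernel u = ‖u‖ₑ ^ 2 + (fracEnergy 1 u + fracEnergy (-1) u) := by
  rw [energy_hardyWeight (Lp.stronglyMeasurable u), energy_one_slopeKernel,
    fracEnergy_neg_one (measurable_coe_L2Half u)]
  ring

/-! ### Approximation by functions with a square integrable derivative -/

theorem extZero_congr {f g : ℝ → ℝ} (h : f =ᵐ[halfLine] g) : extZero f =ᵐ[volume] extZero g := by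
  rw [Filter.EventuallyEq, ae_restrict_iff' measurableSet_Ioi] at h
  filter_upwards [h] with x hx
  by_cases hx0 : 0 < x
  · rw [extZero_of_pos _ hx0, extZero_of_pos _ hx0, hx hx0]
  · rw [extZero_of_nonpos _ (not_lt.1 hx0), extZero_of_nonpos _ (not_lt.1 hx0)]

theorem continuous_windowMean (u : L2Half ℝ) (a : ℝ) : Continuous (windowMean a (extZero u)) := by
  have hP := continuous_primitive u
  have hi := intervalIntegrable_of_locallyIntegrable (locallyIntegrable_extZero u)
  have : windowMean a (extZero u) = fun s => a⁻¹ * ((∫ y in (0 : ℝ)..s + a, extZero u y) -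
      ∫ y in (0 : ℝ)..s, extZero u y) := by
    funext s
    rw [windowMean, intervalIntegral.integral_interval_sub_left (hi _ _) (hi _ _)]
  rw [this]
  exact continuous_const.mul ((hP.comp (continuous_id.add continuous_const)).sub hP)

theorem shiftSq_lt_top (u : L2Half ℝ) (a : ℝ) : shiftSq a (extZero u) < ⊤ := by
  refine (shiftSq_extZero_le (measurable_coe_L2Half u) a).trans_lt ?_
  rw [← Lp.enorm_sq]
  finiteness

theorem memLp_windowMean {τ : ℝ} (hτ : τ = 1 ∨ τ = -1) (u : L2Half ℝ) {h : ℝ} (hh : 0 < h) :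
    MemLp (windowMean (τ * h) (extZero u)) 2 halfLine := by
  have hm : Measurable (extZero u) := measurable_extZero (measurable_coe_L2Half u)
  have hc := continuous_windowMean u (τ * h)
  have h1 : MemLp (fun s => extZero u s - windowMean (τ * h) (extZero u) s) 2 halfLine := by
    have hms : Measurable fun s => extZero u s - windowMean (τ * h) (extZero u) s :=
      hm.sub hc.measurable
    rw [memLp_two_iff_lintegral hms.aestronglyMeasurable]
    refine (lintegral_sub_windowMean_le hτ hh hm (memLp_extZero u)).trans_lt ?_
    refine ENNReal.mul_lt_top (by simpa using hh) ?_
    calc ∫⁻ r in Ioc 0 h, shiftSq (τ * r) (extZero u)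
        ≤ ∫⁻ r in Ioc 0 h, 4 * ‖u‖ₑ ^ 2 := by
          refine lintegral_mono fun r => ?_
          rw [Lp.enorm_sq]
          exact shiftSq_extZero_le (measurable_coe_L2Half u) _
      _ < ⊤ := by
          rw [setLIntegral_const, Real.volume_Ioc]
          finiteness
  have h2 := ((memLp_extZero u).restrict (Ioi 0)).sub h1
  refine h2.ae_eq (Filter.Eventually.of_forall fun s => ?_)
  simp

theorem exists_windowMean_pair {τ : ℝ} (hτ : τ = 1 ∨ τ = -1) (u : L2Half ℝ) {h : ℝ} (hh : 0 < h) :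
    ∃ p : WithLp 2 (L2Half ℝ × L2Half ℝ),
      p.fst =ᵐ[halfLine] windowMean (τ * h) (extZero u) ∧
      p.snd =ᵐ[halfLine] fun s => (τ * h)⁻¹ * (extZero u (s + τ * h) - extZero u s) := by
  have hm : Measurable (extZero u) := measurable_extZero (measurable_coe_L2Half u)
  have hτ0 : τ ≠ 0 := by rcases hτ with rfl | rfl <;> norm_num
  have h1 := memLp_windowMean hτ u hh
  have h2 : MemLp (fun s => (τ * h)⁻¹ * (extZero u (s + τ * h) - extZero u s)) 2 halfLine := by
    have hms : Measurable fun s => (τ * h)⁻¹ * (extZero u (s + τ * h) - extZero u s) := by fun_prop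
    rw [memLp_two_iff_lintegral hms.aestronglyMeasurable]
    simp_rw [enorm_mul, mul_pow]
    rw [lintegral_const_mul' _ _ (by finiteness)]
    exact ENNReal.mul_lt_top (by finiteness) (shiftSq_lt_top u _)
  exact ⟨WithLp.toLp 2 (h1.toLp _, h2.toLp _), h1.coeFn_toLp, h2.coeFn_toLp⟩

theorem windowMean_pair_primitive {a : ℝ} {u : L2Half ℝ} {p : WithLp 2 (L2Half ℝ × L2Half ℝ)}
    (h1 : p.fst =ᵐ[halfLine] windowMean a (extZero u))
    (h2 : p.snd =ᵐ[halfLine] fun s => a⁻¹ * (extZero u (s + a) - extZero u s)) :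
    ∀ᵐ x ∂halfLine, p.fst x =
      windowMean a (extZero u) 0 + ∫ y in (0 : ℝ)..x, extZero p.snd y := by
  filter_upwards [h1, ae_restrict_mem measurableSet_Ioi] with x hx hx0
  rw [hx, windowMean_eq_primitive u (le_of_lt hx0)]
  congr 1
  refine intervalIntegral.integral_congr_ae ?_
  filter_upwards [extZero_congr h2] with y hy _
  exact hy.symm

theorem exists_mem_H1Half_windowMean (u : L2Half ℝ) {h : ℝ} (hh : 0 < h) :
    ∃ p ∈ H1Half, p.fst =ᵐ[halfLine] windowMean (1 * h) (extZero u) ∧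
      p.snd =ᵐ[halfLine] fun s => (1 * h)⁻¹ * (extZero u (s + 1 * h) - extZero u s) := by
  obtain ⟨p, h1, h2⟩ := exists_windowMean_pair (.inl rfl) u hh
  exact ⟨p, (mem_H1Half_iff p).2 ⟨_, windowMean_pair_primitive h1 h2⟩, h1, h2⟩

theorem exists_mem_H1HalfZero_windowMean (u : L2Half ℝ) {h : ℝ} (hh : 0 < h) :
    ∃ p ∈ H1HalfZero, p.fst =ᵐ[halfLine] windowMean (-1 * h) (extZero u) ∧
      p.snd =ᵐ[halfLine] fun s => (-1 * h)⁻¹ * (extZero u (s + -1 * h) - extZero u s) := by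
  obtain ⟨p, h1, h2⟩ := exists_windowMean_pair (.inr rfl) u hh
  refine ⟨p, (mem_H1HalfZero_iff p).2 ?_, h1, h2⟩
  have h3 := windowMean_pair_primitive h1 h2
  rw [windowMean_zero_of_neg u (by linarith)] at h3
  simpa using h3

/-- A forward shift stays inside the half line, so the value at 0 plays no role. -/
theorem shiftSq_le_of_mem_H1Half {p : WithLp 2 (L2Half ℝ × L2Half ℝ)} (hp : p ∈ H1Half) {h : ℝ}
    (hh : 0 < h) : shiftSq (1 * h) (extZero p.fst) ≤ ENNReal.ofReal h ^ 2 * ‖p.snd‖ₑ ^ 2 := by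
  obtain ⟨C, hC⟩ := (mem_H1Half_iff p).1 hp
  rw [ae_restrict_iff' measurableSet_Ioi] at hC
  have hi := intervalIntegrable_of_locallyIntegrable (locallyIntegrable_extZero p.snd)
  rw [Lp.enorm_sq, ← lintegral_extZero]
  refine shiftSq_le_of_primitive (.inl rfl) hh.le
    (measurable_extZero (measurable_coe_L2Half p.snd)) ?_
  filter_upwards [hC, (measurePreserving_add_right volume (1 * h)).quasiMeasurePreserving.ae hC]
    with s h1 h2 hs
  have hs' : 0 < s + 1 * h := by linarith
  rw [extZero_of_pos _ hs, extZero_of_pos _ hs', h1 hs, h2 hs', add_sub_add_left_eq_sub,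
    intervalIntegral.integral_interval_sub_left (hi _ _) (hi _ _)]

/-- With zero trace, the extension by zero is a primitive on the whole line, so backward shifts
across 0 are harmless. -/
theorem shiftSq_le_of_mem_H1HalfZero {p : WithLp 2 (L2Half ℝ × L2Half ℝ)} (hp : p ∈ H1HalfZero)
    {h : ℝ} (hh : 0 < h) :
    shiftSq (-1 * h) (extZero p.fst) ≤ ENNReal.ofReal h ^ 2 * ‖p.snd‖ₑ ^ 2 := by
  have hC := (mem_H1HalfZero_iff p).1 hp
  rw [ae_restrict_iff' measurableSet_Ioi] at hC
  have hC' : ∀ᵐ x, extZero p.fst x = ∫ y in (0 : ℝ)..x, extZero p.snd y := by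
    filter_upwards [hC] with x hx
    by_cases hx0 : 0 < x
    · rw [extZero_of_pos _ hx0, hx hx0]
    · rw [extZero_of_nonpos _ (not_lt.1 hx0), intervalIntegral.integral_zero_ae]
      refine Filter.Eventually.of_forall fun y hy => extZero_of_nonpos _ ?_
      rw [uIoc_of_ge (not_lt.1 hx0)] at hy
      exact hy.2
  have hi := intervalIntegrable_of_locallyIntegrable (locallyIntegrable_extZero p.snd)
  rw [Lp.enorm_sq, ← lintegral_extZero]
  refine shiftSq_le_of_primitive (.inr rfl) hh.le
    (measurable_extZero (measurable_coe_L2Half p.snd)) ?_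
  filter_upwards [hC', (measurePreserving_add_right volume (-1 * h)).quasiMeasurePreserving.ae hC']
    with s h1 h2 _
  rw [h1, h2, intervalIntegral.integral_interval_sub_left (hi _ _) (hi _ _)]

/-! ### The half-order seminorms as approximation integrals. -/

section FracApprox

variable {G : Submodule ℝ (WithLp 2 (L2Half ℝ × L2Half ℝ))} {j : G →L[ℝ] L2Half ℝ} {τ : ℝ}

theorem fracEnergy_le_approxIntegral
    (hj : ∀ p : G, j p = (p : WithLp 2 (L2Half ℝ × L2Half ℝ)).fst)
    (hG : ∀ p ∈ G, ∀ h : ℝ, 0 < h →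
      shiftSq (τ * h) (extZero p.fst) ≤ ENNReal.ofReal h ^ 2 * ‖p.snd‖ₑ ^ 2)
    (u : L2Half ℝ) (v : ℝ → G) : fracEnergy τ u ≤ 8 * approxIntegral j u v := by
  rw [fracEnergy, approxIntegral, ← lintegral_const_mul' _ _ (by finiteness)]
  refine setLIntegral_mono' measurableSet_Ioi fun t ht => ?_
  have ht' : 0 < t := ht
  have h0 : ENNReal.ofReal t ≠ 0 := by simpa using ht'
  set p : WithLp 2 (L2Half ℝ × L2Half ℝ) := (v t : WithLp 2 (L2Half ℝ × L2Half ℝ)) with hp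
  have e1 : ∫⁻ x, ‖u x - p.fst x‖ₑ ^ 2 ∂halfLine = ‖u - j (v t)‖ₑ ^ 2 := by
    rw [Lp.enorm_sq, hj]
    refine lintegral_congr_ae ?_
    filter_upwards [Lp.coeFn_sub u p.fst] with x hx
    rw [hx, Pi.sub_apply]
  have e2 : ‖p.snd‖ₑ ^ 2 ≤ ‖v t‖ₑ ^ 2 := by
    have : ‖v t‖ₑ = ‖p‖ₑ := rfl
    rw [this, WithLp.enorm_sq]
    exact le_add_self
  have e3 := shiftSq_le_add (measurable_coe_L2Half u) (measurable_coe_L2Half p.fst) (τ * t)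
  calc (ENNReal.ofReal t)⁻¹ ^ 2 * shiftSq (τ * t) (extZero u)
      ≤ (ENNReal.ofReal t)⁻¹ ^ 2 * (8 * ‖u - j (v t)‖ₑ ^ 2 +
        2 * (ENNReal.ofReal t ^ 2 * ‖v t‖ₑ ^ 2)) := by
        rw [← e1]
        gcongr
        refine e3.trans ?_
        gcongr
        exact (hG p (v t).2 t ht').trans (by gcongr)
    _ = 8 * ((ENNReal.ofReal t)⁻¹ ^ 2 * ‖u - j (v t)‖ₑ ^ 2) + 2 * ‖v t‖ₑ ^ 2 := by
        have : (ENNReal.ofReal t)⁻¹ ^ 2 * ENNReal.ofReal t ^ 2 = 1 := by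
          rw [← mul_pow, ENNReal.inv_mul_cancel h0 ENNReal.ofReal_ne_top, one_pow]
        calc _ = 8 * ((ENNReal.ofReal t)⁻¹ ^ 2 * ‖u - j (v t)‖ₑ ^ 2) +
              2 * (((ENNReal.ofReal t)⁻¹ ^ 2 * ENNReal.ofReal t ^ 2) * ‖v t‖ₑ ^ 2) := by ring
          _ = _ := by rw [this, one_mul]
    _ ≤ _ := by
        rw [mul_add]
        gcongr
        norm_num

/-- A Hardy-type inequality: 1/t ≤ 1/r on the inner domain, after which exchanging the integrals
returns the second factor 1/r. -/
theorem lintegral_Ioc_window_le {S : ℝ → ℝ≥0∞} (hS : Measurable S) :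
    ∫⁻ t in Ioc 0 1, (ENNReal.ofReal t)⁻¹ ^ 2 * ((ENNReal.ofReal t)⁻¹ * ∫⁻ r in Ioc 0 t, S r) ≤
      ∫⁻ h in Ioi 0, (ENNReal.ofReal h)⁻¹ ^ 2 * S h := by
  calc _ ≤ ∫⁻ t in Ioi 0, (ENNReal.ofReal t)⁻¹ ^ 2 *
        ∫⁻ r in Ioc 0 t, (ENNReal.ofReal r)⁻¹ * S r := by
        refine (lintegral_mono_set Ioc_subset_Ioi_self).trans ?_
        refine setLIntegral_mono' measurableSet_Ioi fun t ht => ?_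
        have ht' : 0 < t := ht
        gcongr
        rw [← lintegral_const_mul' _ _ (by simpa using ht')]
        refine setLIntegral_mono' measurableSet_Ioc fun r hr => ?_
        have := hr.2
        gcongr
    _ = _ := by
        rw [lintegral_inv_sq_mul_lintegral_Ioc (by fun_prop)]
        refine lintegral_congr fun s => ?_
        rw [sq, mul_assoc]

theorem exists_approxIntegral_le (hτ : τ = 1 ∨ τ = -1)
    (hj : ∀ p : G, j p = (p : WithLp 2 (L2Half ℝ × L2Half ℝ)).fst)
    (hG : ∀ (u : L2Half ℝ) (h : ℝ), 0 < h → ∃ p ∈ G,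
      p.fst =ᵐ[halfLine] windowMean (τ * h) (extZero u) ∧
      p.snd =ᵐ[halfLine] fun s => (τ * h)⁻¹ * (extZero u (s + τ * h) - extZero u s))
    (u : L2Half ℝ) : ∃ v : ℝ → G, approxIntegral j u v ≤ 4 * (‖u‖ₑ ^ 2 + fracEnergy τ u) := by
  choose! p hpG hp1 hp2 using hG u
  have hm : Measurable (extZero u) := measurable_extZero (measurable_coe_L2Half u)
  -- Window means are used only for t ≤ 1. Beyond that the approximant is 0, at total cost ∫_1^∞ t⁻²
  -- ‖u‖² dt = ‖u‖².
  let v : ℝ → G := fun t => if h : 0 < t ∧ t ≤ 1 then ⟨p t, hpG t h.1⟩ else 0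
  have hv1 : ∀ t (h : 0 < t ∧ t ≤ 1), v t = ⟨p t, hpG t h.1⟩ := fun t h => dif_pos h
  have hv0 : ∀ t, 1 < t → v t = 0 := fun t h => dif_neg fun h' => not_le.2 h h'.2
  let A : ℝ → ℝ≥0∞ := fun t => (ENNReal.ofReal t)⁻¹ ^ 2 *
    ((ENNReal.ofReal t)⁻¹ * ∫⁻ r in Ioc 0 t, shiftSq (τ * r) (extZero u))
  have hbound : ∀ t ∈ Ioc (0 : ℝ) 1,
      (ENNReal.ofReal t)⁻¹ ^ 2 * ‖u - j (v t)‖ₑ ^ 2 + ‖v t‖ₑ ^ 2 ≤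
        (2 * ‖u‖ₑ ^ 2 + (ENNReal.ofReal t)⁻¹ ^ 2 * shiftSq (τ * t) (extZero u)) + 3 * A t := by
    intro t ht
    have ht0 := ht.1
    -- Since t ≤ 1, the unweighted error inside ‖v t‖² is also absorbed by A t.
    have hone : 1 ≤ (ENNReal.ofReal t)⁻¹ ^ 2 := by
      refine one_le_pow_of_one_le' (ENNReal.one_le_inv.2 ?_) 2
      simpa using ht.2
    have e1 : ‖u - (p t).fst‖ₑ ^ 2 ≤
        (ENNReal.ofReal t)⁻¹ * ∫⁻ r in Ioc 0 t, shiftSq (τ * r) (extZero u) := by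
      refine le_trans (le_of_eq ?_) (lintegral_sub_windowMean_le hτ ht0 hm (memLp_extZero u))
      rw [Lp.enorm_sq]
      refine lintegral_congr_ae ?_
      filter_upwards [Lp.coeFn_sub u (p t).fst, hp1 t ht0, ae_restrict_mem measurableSet_Ioi]
        with x h1 h2 h3
      rw [h1, Pi.sub_apply, h2, extZero_of_pos _ h3]
    have e2 : ‖(p t).fst‖ₑ ^ 2 ≤ 2 * ‖u‖ₑ ^ 2 + 2 * ‖u - (p t).fst‖ₑ ^ 2 := by
      have := enorm_sub_sq_le u (u - (p t).fst)
      rwa [sub_sub_cancel] at this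
    have e3 : ‖(p t).snd‖ₑ ^ 2 = (ENNReal.ofReal t)⁻¹ ^ 2 * shiftSq (τ * t) (extZero u) := by
      have hτ0 : τ * t ≠ 0 := by
        rcases hτ with rfl | rfl <;> simpa using ht0.ne'
      rw [Lp.enorm_sq, shiftSq, ← lintegral_const_mul' _ _ (by simpa using ht0)]
      refine lintegral_congr_ae ?_
      filter_upwards [hp2 t ht0] with x hx
      rw [hx, enorm_mul, mul_pow, enorm_inv hτ0, enorm_mul, enorm_sign hτ, one_mul,
        Real.enorm_of_nonneg ht0.le]
    have e4 : ‖v t‖ₑ ^ 2 = ‖(p t).fst‖ₑ ^ 2 + ‖(p t).snd‖ₑ ^ 2 := by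
      rw [hv1 t ht, ← WithLp.enorm_sq]
      rfl
    have e5 : j (v t) = (p t).fst := by rw [hj, hv1 t ht]
    have e6 : (ENNReal.ofReal t)⁻¹ ^ 2 * ‖u - (p t).fst‖ₑ ^ 2 ≤ A t := mul_le_mul_right e1 _
    have e7 : ‖u - (p t).fst‖ₑ ^ 2 ≤ A t := (le_mul_of_one_le_left zero_le hone).trans e6
    rw [e4, e5, e3]
    calc _ ≤ A t + ((2 * ‖u‖ₑ ^ 2 + 2 * A t) +
          (ENNReal.ofReal t)⁻¹ ^ 2 * shiftSq (τ * t) (extZero u)) := by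
          gcongr
          exact e2.trans (by gcongr)
      _ = _ := by ring
  refine ⟨v, ?_⟩
  rw [approxIntegral, ← Ioc_union_Ioi_eq_Ioi (zero_le_one (α := ℝ)),
    lintegral_union measurableSet_Ioi
      (disjoint_left.2 fun x hx hx' => not_lt.2 hx.2 (show (1 : ℝ) < x from hx'))]
  have hsm : Measurable fun r => shiftSq (τ * r) (extZero u) := by fun_prop
  have i1 : ∫⁻ t in Ioc 0 1, ((ENNReal.ofReal t)⁻¹ ^ 2 * ‖u - j (v t)‖ₑ ^ 2 + ‖v t‖ₑ ^ 2) ≤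
      (2 * ‖u‖ₑ ^ 2 + fracEnergy τ u) + 3 * fracEnergy τ u := by
    refine (setLIntegral_mono' measurableSet_Ioc hbound).trans ?_
    rw [lintegral_add_left (by fun_prop), lintegral_add_left (by fun_prop),
      setLIntegral_const, Real.volume_Ioc]
    refine add_le_add (add_le_add (by simp) (lintegral_mono_set Ioc_subset_Ioi_self)) ?_
    rw [lintegral_const_mul' _ _ (by finiteness)]
    exact mul_le_mul_right (lintegral_Ioc_window_le hsm) _
  have i2 : ∫⁻ t in Ioi 1, ((ENNReal.ofReal t)⁻¹ ^ 2 * ‖u - j (v t)‖ₑ ^ 2 + ‖v t‖ₑ ^ 2) =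
      ‖u‖ₑ ^ 2 := by
    calc _ = ∫⁻ t in Ioi 1, (ENNReal.ofReal t)⁻¹ ^ 2 * ‖u‖ₑ ^ 2 := by
          refine setLIntegral_congr_fun measurableSet_Ioi fun t ht => ?_
          rw [hv0 t ht, map_zero, sub_zero, ← ofReal_norm (0 : G), norm_zero, ENNReal.ofReal_zero,
            zero_pow two_ne_zero, add_zero]
      _ = _ := by
          rw [lintegral_mul_const _ (by fun_prop), lintegral_Ioi_inv_sq one_pos]
          simp
  rw [i2]
  calc _ ≤ ((2 * ‖u‖ₑ ^ 2 + fracEnergy τ u) + 3 * fracEnergy τ u) + ‖u‖ₑ ^ 2 := by gcongr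
    _ = 3 * ‖u‖ₑ ^ 2 + 4 * fracEnergy τ u := by ring
    _ ≤ _ := by
        rw [mul_add]
        gcongr
        norm_num

theorem isRieszBasisIn_rescaled_half_of_fracEnergy (hτ : τ = 1 ∨ τ = -1)
    (hj : ∀ p : G, j p = (p : WithLp 2 (L2Half ℝ × L2Half ℝ)).fst)
    (hG : ∀ p ∈ G, ∀ h : ℝ, 0 < h →
      shiftSq (τ * h) (extZero p.fst) ≤ ENNReal.ofReal h ^ 2 * ‖p.snd‖ₑ ^ 2)
    (hG' : ∀ (u : L2Half ℝ) (h : ℝ), 0 < h → ∃ p ∈ G,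
      p.fst =ᵐ[halfLine] windowMean (τ * h) (extZero u) ∧
      p.snd =ᵐ[halfLine] fun s => (τ * h)⁻¹ * (extZero u (s + τ * h) - extZero u s))
    {W : Type*} [NormedAddCommGroup W] [NormedSpace ℝ W] {k : W →L[ℝ] L2Half ℝ}
    {N : L2Half ℝ → ℝ≥0∞} (hN : IsEnergyOf k N)
    (hN1 : ∀ u : L2Half ℝ, N u ≤ ‖u‖ₑ ^ 2 + 2 * fracEnergy τ u)
    (hN2 : ∀ u : L2Half ℝ, ‖u‖ₑ ^ 2 + fracEnergy τ u ≤ N u) {I : Type*} {θ : I → L2Half ℝ}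
    {ρ : I → ℝ} (hρ : ∀ l, 0 < ρ l) (hθ : IsRieszBasis θ)
    (hθρ : IsRieszBasisIn j (rescaled ρ 1 θ)) : IsRieszBasisIn k (rescaled ρ (1 / 2) θ) := by
  have : Fact ((2 : ℝ≥0∞) ≠ ⊤) := ⟨ENNReal.ofNat_ne_top⟩
  have : SecondCountableTopology (L2Half ℝ) := Lp.SecondCountableTopology
  -- Separability of L² yields the countability needed to integrate sums over I term by term.
  have : Countable I := hθ.countable
  refine isRieszBasisIn_rescaled_half hθ hρ hθρ hN (C := 16) (D := 4) (by finiteness)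
    (by finiteness) (fun u v => ?_) (fun u => ?_)
  · calc N u ≤ ‖u‖ₑ ^ 2 + 2 * (8 * approxIntegral j u v) :=
          (hN1 u).trans (by gcongr; exact fracEnergy_le_approxIntegral hj hG u v)
      _ = 1 * ‖u‖ₑ ^ 2 + 16 * approxIntegral j u v := by ring
      _ ≤ _ := by
          rw [mul_add]
          gcongr
          norm_num
  · obtain ⟨v, hv⟩ := exists_approxIntegral_le hτ hj hG' u
    exact ⟨v, hv.trans (by gcongr; exact hN2 u)⟩

end FracApprox

theorem isRieszBasisIn_HHalf {I : Type*} {θ : I → L2Half ℝ} {ρ : I → ℝ} (hρ : ∀ l, 0 < ρ l)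
    (hθ : IsRieszBasis θ) (hθρ : IsRieszBasisIn H1Half.toL2 (rescaled ρ 1 θ)) :
    IsRieszBasisIn (HHalf.toL2 ℝ) (rescaled ρ (1 / 2) θ) := by
  have hN1 (u : L2Half ℝ) : energy 1 slopeKernel u ≤ ‖u‖ₑ ^ 2 + 2 * fracEnergy 1 u := by
    rw [energy_one_slopeKernel]
  have hN2 (u : L2Half ℝ) : ‖u‖ₑ ^ 2 + fracEnergy 1 u ≤ energy 1 slopeKernel u := by
    rw [energy_one_slopeKernel, two_mul]
    exact add_le_add_right le_self_add _
  have hN : IsEnergyOf (HHalf.toL2 ℝ) fun u => energy 1 slopeKernel u := HHalf.isEnergyOf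
  have h := isRieszBasisIn_rescaled_half_of_fracEnergy (τ := 1) (j := H1Half.toL2) (.inl rfl)
    (fun p => rfl) (fun p hp h hh => shiftSq_le_of_mem_H1Half hp hh)
    (fun u h hh => exists_mem_H1Half_windowMean u hh) hN hN1 hN2 hρ hθ hθρ
  exact h

theorem isRieszBasisIn_HHalfZero {I : Type*} {θ : I → L2Half ℝ} {ρ : I → ℝ} (hρ : ∀ l, 0 < ρ l)
    (hθ : IsRieszBasis θ) (hθρ : IsRieszBasisIn H1HalfZero.toL2 (rescaled ρ 1 θ)) :
    IsRieszBasisIn (HHalfZero.toL2 ℝ) (rescaled ρ (1 / 2) θ) := by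
  have hN1 (u : L2Half ℝ) :
      energy hardyWeight slopeKernel u ≤ ‖u‖ₑ ^ 2 + 2 * fracEnergy (-1) u := by
    -- The forward integral is dominated by the backward one, so τ = -1 alone controls the norm that
    -- contains both.
    have h : fracEnergy 1 u ≤ fracEnergy (-1) u := by
      rw [fracEnergy_neg_one (measurable_coe_L2Half u)]
      exact le_self_add
    rw [energy_hardyWeight_slopeKernel, two_mul]
    exact add_le_add_right (add_le_add_left h _) _
  have hN2 (u : L2Half ℝ) :
      ‖u‖ₑ ^ 2 + fracEnergy (-1) u ≤ energy hardyWeight slopeKernel u := by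
    rw [energy_hardyWeight_slopeKernel]
    exact add_le_add_right le_add_self _
  have hN : IsEnergyOf (HHalfZero.toL2 ℝ) fun u => energy hardyWeight slopeKernel u :=
    HHalfZero.isEnergyOf
  have h := isRieszBasisIn_rescaled_half_of_fracEnergy (τ := -1) (j := H1HalfZero.toL2) (.inr rfl)
    (fun p => rfl) (fun p hp h hh => shiftSq_le_of_mem_H1HalfZero hp hh)
    (fun u h hh => exists_mem_H1HalfZero_windowMean u hh) hN hN1 hN2 hρ hθ hθρ
  exact h

/-! ### Assembly of the tensor product bases of X and Y. -/

section Parabolic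

variable {H V : Type*} [NormedAddCommGroup H] [InnerProductSpace ℝ H] [CompleteSpace H]
  [TopologicalSpace.SeparableSpace H] [NormedAddCommGroup V] [InnerProductSpace ℝ V]
  [CompleteSpace V] {ι : V →L[ℝ] H} {I J : Type*} {θ : I → L2Half ℝ} {σ : J → V} {ρ : I → ℝ}

theorem scaledTensor_isRieszBasisIn (hι : Function.Injective ι) {W₁ W : Type*}
    [NormedAddCommGroup W₁] [NormedSpace ℝ W₁] [NormedAddCommGroup W] [NormedSpace ℝ W]
    {j₁ : W₁ →L[ℝ] L2Half ℝ} {j : W →L[ℝ] L2Half H} {k : ℝ → ℝ≥0∞} (hk : Measurable k)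
    {κ : ℝ × ℝ → ℝ≥0∞} (hκ : Measurable κ) (hj₁ : IsEnergyOf j₁ fun u => energy k κ u)
    (hj : IsEnergyOf j fun u => energy k κ u) (hρ : ∀ l, 0 < ρ l)
    (hσ : IsRieszBasis (fun m => ι (σ m))) (hσV : IsRieszBasis (fun m => ‖σ m‖⁻¹ • σ m))
    (hθ : IsRieszBasis θ) (hhalf : IsRieszBasisIn j₁ (rescaled ρ (1 / 2) θ)) :
    IsRieszBasis (tensorFamily ι θ σ) ∧ IsRieszBasisIn j₁ (rescaled ρ (1 / 2) θ) ∧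
    IsRieszBasisIn (interSpace.incl j (bochnerIncl ι)) (scaledTensorFamily j₁ ι θ σ) ∧
    ∀ K₁ K₂ K₃ K₄ : ℝ × ℝ, IsRieszBasisWith θ K₁ →
      IsRieszBasisInWith j₁ (rescaled ρ (1 / 2) θ) K₂ →
      IsRieszBasisWith (fun m => ι (σ m)) K₃ → IsRieszBasisWith (fun m => ‖σ m‖⁻¹ • σ m) K₄ →
        IsRieszBasisWith (tensorFamily ι θ σ)
          ((tensorBounds K₁ K₂ K₃ K₄).1, (tensorBounds K₁ K₂ K₃ K₄).2) ∧
        IsRieszBasisInWith (interSpace.incl j (bochnerIncl ι)) (scaledTensorFamily j₁ ι θ σ)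
          ((tensorBounds K₁ K₂ K₃ K₄).1, (tensorBounds K₁ K₂ K₃ K₄).2) := by
  obtain ⟨K₁, hK₁⟩ := hθ.exists_bounds
  obtain ⟨K₂, hK₂⟩ := hhalf.exists_bounds
  obtain ⟨K₃, hK₃⟩ := hσ.exists_bounds
  obtain ⟨K₄, hK₄⟩ := hσV.exists_bounds
  have h := scaledTensor_isRieszBasisInWith hι hk hκ hj₁ hj hρ hK₁ hK₂ hK₃ hK₄
  exact ⟨h.1.isRieszBasis, hhalf, h.2.isRieszBasisIn, fun _ _ _ _ hL₁ hL₂ hL₃ hL₄ =>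
    scaledTensor_isRieszBasisInWith hι hk hκ hj₁ hj hρ hL₁ hL₂ hL₃ hL₄⟩

end Parabolic

theorem mainTheorem4 :
    ∃ lo up : ℝ × ℝ → ℝ × ℝ → ℝ × ℝ → ℝ × ℝ → ℝ,
      ∀ (H : Type*) [NormedAddCommGroup H] [InnerProductSpace ℝ H] [CompleteSpace H]
        [TopologicalSpace.SeparableSpace H]
        (V : Type*) [NormedAddCommGroup V] [InnerProductSpace ℝ V] [CompleteSpace V]
        [TopologicalSpace.SeparableSpace V]
        (ι : V →L[ℝ] H), Function.Injective ι → DenseRange ι →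
      ∀ (J : Type*) (σ : J → V),
        IsRieszBasis (fun m => ι (σ m)) → IsRieszBasis (fun m => ‖σ m‖⁻¹ • σ m) →
        -- the trial space `X`
        (∀ (I : Type*) (θ : I → L2Half ℝ) (ρ : I → ℝ), (∀ l, 0 < ρ l) →
          IsRieszBasis θ → IsRieszBasisIn H1HalfZero.toL2 (rescaled ρ 1 θ) →
            IsRieszBasis (tensorFamily ι θ σ) ∧
            IsRieszBasisIn (HHalfZero.toL2 ℝ) (rescaled ρ (1 / 2) θ) ∧
            IsRieszBasisIn (SpaceX.toL2 ι) (scaledTensorFamily (HHalfZero.toL2 ℝ) ι θ σ) ∧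
            ∀ K₁ K₂ K₃ K₄ : ℝ × ℝ,
              IsRieszBasisWith θ K₁ →
              IsRieszBasisInWith (HHalfZero.toL2 ℝ) (rescaled ρ (1 / 2) θ) K₂ →
              IsRieszBasisWith (fun m => ι (σ m)) K₃ →
              IsRieszBasisWith (fun m => ‖σ m‖⁻¹ • σ m) K₄ →
                IsRieszBasisWith (tensorFamily ι θ σ)
                  (lo K₁ K₂ K₃ K₄, up K₁ K₂ K₃ K₄) ∧
                IsRieszBasisInWith (SpaceX.toL2 ι)
                  (scaledTensorFamily (HHalfZero.toL2 ℝ) ι θ σ)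
                  (lo K₁ K₂ K₃ K₄, up K₁ K₂ K₃ K₄)) ∧
        -- the test space `Y`
        (∀ (I : Type*) (θ : I → L2Half ℝ) (ρ : I → ℝ), (∀ l, 0 < ρ l) →
          IsRieszBasis θ → IsRieszBasisIn H1Half.toL2 (rescaled ρ 1 θ) →
            IsRieszBasis (tensorFamily ι θ σ) ∧
            IsRieszBasisIn (HHalf.toL2 ℝ) (rescaled ρ (1 / 2) θ) ∧
            IsRieszBasisIn (SpaceY.toL2 ι) (scaledTensorFamily (HHalf.toL2 ℝ) ι θ σ) ∧
            ∀ K₁ K₂ K₃ K₄ : ℝ × ℝ,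
              IsRieszBasisWith θ K₁ →
              IsRieszBasisInWith (HHalf.toL2 ℝ) (rescaled ρ (1 / 2) θ) K₂ →
              IsRieszBasisWith (fun m => ι (σ m)) K₃ →
              IsRieszBasisWith (fun m => ‖σ m‖⁻¹ • σ m) K₄ →
                IsRieszBasisWith (tensorFamily ι θ σ)
                  (lo K₁ K₂ K₃ K₄, up K₁ K₂ K₃ K₄) ∧
                IsRieszBasisInWith (SpaceY.toL2 ι)
                  (scaledTensorFamily (HHalf.toL2 ℝ) ι θ σ)
                  (lo K₁ K₂ K₃ K₄, up K₁ K₂ K₃ K₄)) := by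
  -- The bounds are fixed before any space or basis, so they depend on the four pairs only. The same
  -- pair serves X and Y, because the energies differ only in the weight k, which does not enter the
  -- constants.
  refine ⟨fun K₁ K₂ K₃ K₄ => (tensorBounds K₁ K₂ K₃ K₄).1,
    fun K₁ K₂ K₃ K₄ => (tensorBounds K₁ K₂ K₃ K₄).2, ?_⟩
  intro H _ _ _ _ V _ _ _ _ ι hι _ J σ hσ hσV
  constructor <;> intro I θ ρ hρ hθ hθρ
  · have hhalf := isRieszBasisIn_HHalfZero hρ hθ hθρ
    have hj₁ : IsEnergyOf (HHalfZero.toL2 ℝ) fun u => energy hardyWeight slopeKernel u := HHalfZero.isEnergyOf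
    have hj : IsEnergyOf (HHalfZero.toL2 H) fun u => energy hardyWeight slopeKernel u := HHalfZero.isEnergyOf
    have h := scaledTensor_isRieszBasisIn (j₁ := HHalfZero.toL2 ℝ) (j := HHalfZero.toL2 H) hι
      measurable_hardyWeight measurable_slopeKernel hj₁ hj hρ hσ hσV hθ hhalf
    exact h
  · have hhalf := isRieszBasisIn_HHalf hρ hθ hθρ
    have hj₁ : IsEnergyOf (HHalf.toL2 ℝ) fun u => energy 1 slopeKernel u := HHalf.isEnergyOf
    have hj : IsEnergyOf (HHalf.toL2 H) fun u => energy 1 slopeKernel u := HHalf.isEnergyOf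
    have h := scaledTensor_isRieszBasisIn (j₁ := HHalf.toL2 ℝ) (j := HHalf.toL2 H) hι
      measurable_one measurable_slopeKernel hj₁ hj hρ hσ hσV hθ hhalf
    exact h
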